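/- Let $d\ge 2$ and let $\mathbb B^d$ be the set of nonoriented nearest-neighbour bonds of $\mathbb Z^d$. Let $p\in(1,\infty)$ and $q\in(\frac d2,\infty)$ satisfy $\frac1p+\frac1q<\frac2{d-1}$. Put $$\delta_1:=\tfrac2{d-1}-\tfrac1p-\tfrac1q,\quad \delta_2:=\tfrac2d-\tfrac1q,\quad \theta:=\begin{cases}p&\text{if }d=2,\\ 1+p\,\delta_1&\text{if }d\ge3,\end{cases}\quad \nu:=1-\delta_2\bigl(1-\tfrac1\theta\bigr),\quad \gamma:=2+\tfrac1p+\tfrac1{\theta q}.$$ Notation. $B(n):=([-n,n]\cap\mathbb Z)^d$. For a bond $\mathrm e=\{x,x+e_i\}$ and $f:\mathbb Z^d\to\mathbb R$ put $\nabla f(\mathrm e):=f(x+e_i)-f(x)$. For $\omega\in(0,\infty)^{\mathbb B^d}$ put $(\mathcal L^\omega f)(x):=\sum_{y:\{x,y\}\in\mathbb B^d}\omega(\{x,y\})(f(y)-f(x))$. For a finite set $S\subset\mathbb Z^d$ and $r>0$, $\|f\|_{\underline L^r(S)}:=\bigl(\frac1{|S|}\sum_{x\in S}|f(x)|^r\bigr)^{1/r}$;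 for functions on bonds (such as $\omega$, $\omega^{-1}$, $\sqrt\omega\,\nabla f$) the same notation means the average over the bonds with both endpoints in $S$. For a bounded interval $I$ and $v$ depending on time, $v_t:=v(t,\cdot)$, $\|v\|_{\underline L^2(I\times S)}^2:=\frac1{|I|}\int_I\|v_t\|_{\underline L^2(S)}^2\,dt$ (likewise for functions on bonds), and $$\|v\|_{\underline H^1(I\times S)}^2:=|S|^{-\frac2d}\,\|\omega^{-1}\|_{\underline L^q(S)}^{-1}\,\|v\|_{\underline L^2(I\times S)}^2+\|\sqrt\omega\,\nabla v\|_{\underline L^2(I\times S)}^2 .$$ A function $u$ is subcaloric in $I\times S$ if, for every $x\in S$ and $t\in I$, $u(\cdot,x)$ is differentiable at $t$ (one-sidedly at endpoints of $I$) and $\partial_t u_t(x)-(\mathcal L^\omega u_t)(x)\le0$. Claim. One has $\delta_1>0$, $\delta_2>0$, $\theta>1$, $\nu\in(0,1)$, $\gamma>2$, and there is a constant $c=c(d,p,q)\in[1,\infty)$ such that the following holds. Let $\omega\in(0,\infty)^{\mathbb B^d}$, let $n,m\in\mathbb N$ with $n<m\le 2n$, let $0<s_1<s_2$, and put $I_1:=[-s_1,0]$,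 $I_2:=[-s_2,0]$. Let $u$ be subcaloric in $I_2\times B(m)$ and nonnegative on $I_2\times B(m)$. Then for every real $\alpha\ge1$: (i) $$\sup_{t\in I_1}s_1^{-1}\|u_t^\alpha\|_{\underline L^2(B(n))}^2+\|u^\alpha\|_{\underline H^1(I_1\times B(n))}^2\le c\,\alpha^2\Bigl(\sup_{t\in I_2}s_2^{-1}\|u_t^\alpha\|_{\underline L^2(B(m))}^2\Bigr)^{1-\nu}s_2^{1-\nu}\,\|\omega^{-1}\|_{\underline L^q(B(m))}\Bigl(\frac{\|\omega\|_{\underline L^p(B(m))}}{(1-\frac nm)^\gamma}+\frac{m^2}{s_2-s_1}\Bigr)\frac{s_2}{s_1}\,\|u^{\alpha\nu}\|_{\underline H^1(I_2\times B(m))}^2;$$ (ii) $$\sup_{t\in I_1}s_1^{-1}\|u_t^\alpha\|_{\underline L^2(B(n))}^2+\|\sqrt\omega\,\nabla(u^\alpha)\|_{\underline L^2(I_1\times B(n))}^2\le \frac{c\,\alpha^2}{m^2}\Bigl(\frac{\|\omega\|_{\underline L^p(B(m))}}{(1-\frac nm)^2}+\frac{m^2}{s_2-s_1}\Bigr)\frac{s_2}{s_1}\,\frac1{|I_2|}\int_{I_2}\|u_t^\alpha\|_{\underline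 L^{\frac{2p}{p-1}}(B(m))}^2\,dt;$$ (iii) $$\sup_{t\in I_1}s_1^{-1}\|u_t^\alpha\|_{\underline L^2(B(n))}^2\le c\,\alpha^2\,\|\omega^{-1}\|_{\underline L^q(B(m))}\Bigl(\frac{\|\omega\|_{\underline L^p(B(m))}}{(1-\frac nm)^{2+\frac1p+\frac1q}}+\frac{m^2}{s_2-s_1}\Bigr)\frac{s_2}{s_1}\,\|u^\alpha\|_{\underline H^1(I_2\times B(m))}^2 .$$ -/

import Mathlib

open MeasureTheory
open scoped BigOperators

noncomputable section

namespace RandomConductance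

/-- The vertices of the lattice `ℤ^d`. -/
abbrev Vertex (d : ℕ) : Type := Fin d → ℤ

/-- The nonoriented nearest-neighbour bonds of `ℤ^d`. Every bond is `{x, x + e_i}` for exactly one
vertex `x` and one direction `i`, and is represented by the pair `(x, i)`. -/
abbrev Bond (d : ℕ) : Type := Vertex d × Fin d

/-- The `i`-th unit vector of `ℤ^d`. -/
def unitVec {d : ℕ} (i : Fin d) : Vertex d := Pi.single i 1

/-- The endpoint `x` of the bond `{x, x + e_i}`. -/
def Bond.lower {d : ℕ} (b : Bond d) : Vertex d := b.1

/-- The endpoint `x + e_i` of the bond `{x, x + e_i}`. -/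
def Bond.upper {d : ℕ} (b : Bond d) : Vertex d := b.1 + unitVec b.2

/-- The box `B(n) = ([-n, n] ∩ ℤ)^d`. -/
def box (d n : ℕ) : Finset (Vertex d) :=
  Fintype.piFinset fun _ => Finset.Icc (-(n : ℤ)) (n : ℤ)

/-- The bonds with both endpoints in `B(n)`. -/
def boxBonds (d n : ℕ) : Finset (Bond d) :=
  (box d n ×ˢ (Finset.univ : Finset (Fin d))).filter
    fun b => Bond.lower b ∈ box d n ∧ Bond.upper b ∈ box d n

/-- The discrete derivative `∇f(e) = f(upper e) - f(lower e)`. -/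
def grad {d : ℕ} (f : Vertex d → ℝ) (b : Bond d) : ℝ :=
  f (Bond.upper b) - f (Bond.lower b)

/-- The generator `(L^ω f)(x) = ∑_{y} ω(x,y) (f(y) - f(x))`. Since `ω(x,y) = 0` unless `{x,y}` is a
bond, the sum runs over the `2d` neighbours `x + e_i` and `x - e_i` of `x`. -/
def generator {d : ℕ} (ω : Bond d → ℝ) (f : Vertex d → ℝ) (x : Vertex d) : ℝ :=
  ∑ i : Fin d, (ω (x, i) * (f (x + unitVec i) - f x)
    + ω (x - unitVec i, i) * (f (x - unitVec i) - f x))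

/-- `u` is subcaloric in `I × V`: at every `t ∈ I` and `x ∈ V` the time derivative of `u` exists
(one-sided at an endpoint of `I`) and `∂ₜu - L^ω u ≤ 0`. -/
def IsSubcaloric {d : ℕ} (ω : Bond d → ℝ) (u : ℝ → Vertex d → ℝ) (I : Set ℝ)
    (V : Finset (Vertex d)) : Prop :=
  ∀ x ∈ V, ∀ t ∈ I, DifferentiableWithinAt ℝ (fun s => u s x) I t ∧
    derivWithin (fun s => u s x) I t - generator ω (u t) x ≤ 0

/-- The normalized norm `(|S|⁻¹ ∑_{i ∈ S} |f i|^r)^(1/r)`, for functions of vertices or of bonds. -/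
def avgNorm {ι : Type} (r : ℝ) (S : Finset ι) (f : ι → ℝ) : ℝ :=
  ((S.card : ℝ)⁻¹ * ∑ i ∈ S, |f i| ^ r) ^ (1 / r)

/-- `‖√ω ∇v‖²` in the normalized `L²(I × B(n))`. -/
def gradNormSq {d : ℕ} (ω : Bond d → ℝ) (I : Set ℝ) (n : ℕ) (v : ℝ → Vertex d → ℝ) : ℝ :=
  ⨍ t in I, avgNorm 2 (boxBonds d n) (fun b => √(ω b) * grad (v t) b) ^ 2

/-- The squared weighted norm `‖v‖²` in `H¹(I × B(n); ω)`, namely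
`|B(n)|^(-2/d) ‖ω⁻¹‖_{L^q(B(n))}⁻¹ ‖v‖²_{L²(I × B(n))} + ‖√ω ∇v‖²_{L²(I × B(n))}`
with normalized norms. -/
def hOneNormSq {d : ℕ} (ω : Bond d → ℝ) (q : ℝ) (I : Set ℝ) (n : ℕ)
    (v : ℝ → Vertex d → ℝ) : ℝ :=
  ((box d n).card : ℝ) ^ (-2 / (d : ℝ)) * (avgNorm q (boxBonds d n) fun b => (ω b)⁻¹)⁻¹ *
      (⨍ t in I, avgNorm 2 (box d n) (v t) ^ 2)
    + gradNormSq ω I n v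

/-- `δ₁ = 2/(d-1) - 1/p - 1/q`. -/
def deltaOne (d : ℕ) (p q : ℝ) : ℝ := 2 / ((d : ℝ) - 1) - 1 / p - 1 / q

/-- `δ₂ = 2/d - 1/q`. -/
def deltaTwo (d : ℕ) (q : ℝ) : ℝ := 2 / (d : ℝ) - 1 / q

/-- `θ = p` if `d = 2`, and `θ = 1 + p δ₁` if `d ≥ 3`. -/
def theta (d : ℕ) (p q : ℝ) : ℝ := if d = 2 then p else 1 + p * deltaOne d p q

/-- `ν = 1 - δ₂ (1 - 1/θ)`. -/
def nu (d : ℕ) (p q : ℝ) : ℝ := 1 - deltaTwo d q * (1 - 1 / theta d p q)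

/-- `γ = 2 + 1/p + 1/(θ q)`. -/
def gam (d : ℕ) (p q : ℝ) : ℝ := 2 + 1 / p + 1 / (theta d p q * q)

end RandomConductance

end

open RandomConductance

open RandomConductance

/-! The proof combines a parabolic Caccioppoli inequality, weighted Sobolev inequalities on boxes of
dimension `d` and `d - 1`, and a spatial cutoff adapted to `ω` and `u`.

Testing the subcaloric inequality with `η² u^(2α-1)`, integrating in time and averaging over the
initial time in `[-s₂, -s₁]` bounds the sum of `u^(2α)` at each time, and the Dirichlet energy of
`u^α`, on the small cylinder by `(s₂ - s₁)⁻¹ ∫ ∑ u^(2α) + 4 α² ∫ ∑ ω |∇η|² (u^(2α) at both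
endpoints)` (`caccioppoli`). Estimate (ii) follows with the linear cutoff and Hölder's inequality
with exponents `p` and `p/(p-1)`.

For (i) and (iii) a fixed cutoff followed by Sobolev's inequality in dimension `d` would need `1/p +
1/q ≤ 2/d`. Instead, `η` is a product of one-dimensional profiles of `|x_i|`, each decreasing by
equal jumps at the radii of a set `G ⊆ [n, m)`. Then `∇η` is carried by bonds crossing between
neighbouring hyperplane slices, and the cutoff term becomes a sum over slices of dimension `D = d -
1`, where Sobolev's inequality only asks for `1/p + 1/q ≤ 2/(d-1)`. By Markov's inequality at least
half of the radii are good: there, the slice averages of `ω^p`, `ω^(-q)`, the energy and an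
auxiliary density `A` are at most a constant times `(1 - n/m)⁻¹` times the averages over the whole
box. These losses, together with the factor `1/|G|`, give the power `2 + 1/p + c/q` of `(1 - n/m)⁻¹`
(`exists_cutoff_integral_le`).

Here `u^(2α) = A^b (w²)^c` with `b + c = 1`, and the slice estimate needs `1/p + b + σ c ≤ 1`, with
`σ` the Sobolev exponent of the slices. For (iii), `b = 0`, `c = 1`, `w = u^α`. For (i), `w =
u^(αν)`, `A = u^(2αδ₂) w²` and `c = 1/θ`: the value of `θ` makes the constraint an equality, and `ν`
is determined by `δ₂ (1 - 1/θ) = 1 - ν`. The integral of `A` is bounded by Hölder and Sobolev in the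
full dimension `d`, with `u^α` measured in `L^∞(L²)`; this produces the power `1 - ν` of the
supremum.

The weighted Sobolev inequality itself comes from the Gagliardo-Nirenberg inequality applied to
`|w|^s`, writing `∇w = ω^(-1/2) · ω^(1/2) ∇w` in Hölder's inequality. The energy carries the
zeroth-order term of the `H¹` norm, so neither a mean value nor a boundary condition enters. -/

/-! ### Pointwise inequalities for the test function -/

/-- Power function comparison used for testing with powers of a subsolution. -/
theorem sq_sub_rpow_le {α a b : ℝ} (hα : 1 ≤ α) (hb : 0 ≤ b) (hab : b ≤ a) :
    (a ^ α - b ^ α) ^ 2 ≤ α * ((a - b) * (a ^ (2 * α - 1) - b ^ (2 * α - 1))) ∧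
    (a ^ (2 * α - 1) + b ^ (2 * α - 1)) * (a - b) ≤ (a ^ α + b ^ α) * (a ^ α - b ^ α) := by
  have ha : 0 ≤ a := hb.trans hab
  have split1 : ∀ x : ℝ, 0 ≤ x → x ^ α = x ^ (α - 1) * x := fun x hx => by
    rcases hx.eq_or_lt with rfl | hx
    · rw [Real.zero_rpow (by linarith)]; simp
    · rw [← Real.rpow_add_one hx.ne']; congr 1; ring
  have split2 : ∀ x : ℝ, 0 ≤ x → x ^ (2 * α - 1) = x ^ (α - 1) * x ^ α := fun x hx => by
    rw [← Real.rpow_add_of_nonneg hx (by linarith) (by linarith)]; congr 1; ring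
  have hP : b ^ (α - 1) ≤ a ^ (α - 1) := Real.rpow_le_rpow hb hab (by linarith)
  have hQ : b ^ α ≤ a ^ α := Real.rpow_le_rpow hb hab (by linarith)
  have hbα : 0 ≤ b ^ α := Real.rpow_nonneg hb _
  have hb1 : 0 ≤ b ^ (α - 1) := Real.rpow_nonneg hb _
  -- Bernoulli's inequality for `(b/a)^α`, multiplied by `a^α`.
  have bern : a ^ α - b ^ α ≤ α * (a ^ (α - 1) * (a - b)) := by
    rcases ha.eq_or_lt with h0 | h0
    · have : b = 0 := by linarith
      subst this; rw [← h0]; simp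
    · have h := one_add_mul_self_le_rpow_one_add (s := b / a - 1) (p := α)
        (by have := div_nonneg hb ha; linarith) hα
      rw [add_sub_cancel, Real.div_rpow hb ha, le_div_iff₀ (Real.rpow_pos_of_pos h0 _)] at h
      have e : (1 + α * (b / a - 1)) * a ^ α = a ^ α + α * (a ^ (α - 1) * (b - a)) := by
        rw [split1 a ha]; field_simp
      rw [e] at h
      nlinarith
  have low : a ^ (α - 1) * (a - b) ≤ a ^ α - b ^ α := by
    rw [split1 a ha, split1 b hb]; nlinarith
  rw [split2 a ha, split2 b hb]
  have hab' : 0 ≤ a - b := by linarith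
  have ha1 : 0 ≤ a ^ (α - 1) := hb1.trans hP
  constructor
  · calc (a ^ α - b ^ α) ^ 2 ≤ (α * (a ^ (α - 1) * (a - b))) * (a ^ α - b ^ α) := by
          rw [sq]; exact mul_le_mul_of_nonneg_right bern (by linarith)
      _ = α * ((a - b) * (a ^ (α - 1) * a ^ α - a ^ (α - 1) * b ^ α)) := by ring
      _ ≤ _ := by
          refine mul_le_mul_of_nonneg_left (mul_le_mul_of_nonneg_left ?_ hab') (by linarith)
          have := mul_le_mul_of_nonneg_right hP hbα
          linarith
  · calc _ ≤ (a ^ (α - 1) * a ^ α + a ^ (α - 1) * b ^ α) * (a - b) := by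
          refine mul_le_mul_of_nonneg_right ?_ hab'
          have := mul_le_mul_of_nonneg_right hP hbα
          linarith
      _ = (a ^ α + b ^ α) * (a ^ (α - 1) * (a - b)) := by ring
      _ ≤ _ := mul_le_mul_of_nonneg_left low (by linarith)

/-- One bond of the tested equation. The increment of `η² u^(2α-1)` splits into a part where the
cutoff is averaged, which is coercive, and a part carrying `η² - ξ²`, half of whose cost is absorbed
by Young's inequality. -/
theorem cutoff_pairing_ge {α a b η ξ : ℝ} (hα : 1 ≤ α) (ha : 0 ≤ a) (hb : 0 ≤ b) :
    (η ^ 2 + ξ ^ 2) * (a ^ α - b ^ α) ^ 2 / 2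
        - 4 * α ^ 2 * ((η - ξ) ^ 2 * ((a ^ α) ^ 2 + (b ^ α) ^ 2))
      ≤ 2 * α * ((η ^ 2 * a ^ (2 * α - 1) - ξ ^ 2 * b ^ (2 * α - 1)) * (a - b)) := by
  wlog hab : b ≤ a generalizing a b η ξ
  · have := this (η := ξ) (ξ := η) hb ha (by linarith)
    calc _ = (ξ ^ 2 + η ^ 2) * (b ^ α - a ^ α) ^ 2 / 2
        - 4 * α ^ 2 * ((ξ - η) ^ 2 * ((b ^ α) ^ 2 + (a ^ α) ^ 2)) := by ring
      _ ≤ _ := this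
      _ = _ := by ring
  obtain ⟨h1, h2⟩ := sq_sub_rpow_le hα hb hab
  have hA : 0 ≤ a ^ α := Real.rpow_nonneg ha _
  have hB : 0 ≤ b ^ α := Real.rpow_nonneg hb _
  have hBA : b ^ α ≤ a ^ α := Real.rpow_le_rpow hb hab (by linarith)
  have hP : 0 ≤ (a ^ (2 * α - 1) + b ^ (2 * α - 1)) * (a - b) :=
    mul_nonneg (add_nonneg (Real.rpow_nonneg ha _) (Real.rpow_nonneg hb _)) (by linarith)
  set A := a ^ α
  set B := b ^ α
  set P := a ^ (2 * α - 1)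
  set Q := b ^ (2 * α - 1)
  -- Discrete product rule: mean of the cutoff times increment of the power, plus increment of the
  -- cutoff times mean of the power.
  have e : (η ^ 2 * P - ξ ^ 2 * Q) * (a - b)
      = (η ^ 2 + ξ ^ 2) / 2 * ((a - b) * (P - Q)) + (η ^ 2 - ξ ^ 2) / 2 * ((P + Q) * (a - b)) := by
    ring
  have t1 : (η ^ 2 + ξ ^ 2) * (A - B) ^ 2 ≤ 2 * α * ((η ^ 2 + ξ ^ 2) / 2 * ((a - b) * (P - Q))) := by
    nlinarith [mul_le_mul_of_nonneg_left h1 (by positivity : 0 ≤ η ^ 2 + ξ ^ 2)]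
  have t2 : -(|η ^ 2 - ξ ^ 2| * ((A + B) * (A - B))) ≤ (η ^ 2 - ξ ^ 2) * ((P + Q) * (a - b)) := by
    have := mul_le_mul_of_nonneg_left h2 (abs_nonneg (η ^ 2 - ξ ^ 2))
    have := mul_le_mul_of_nonneg_right (neg_abs_le (η ^ 2 - ξ ^ 2)) hP
    linarith
  -- Young's inequality with weight chosen so that only half of the coercive term is spent; it
  -- leaves `2 α²`, which is within the stated `4 α²`.
  have t3 : α * (|η ^ 2 - ξ ^ 2| * ((A + B) * (A - B)))
      ≤ (η ^ 2 + ξ ^ 2) * (A - B) ^ 2 / 2 + 4 * α ^ 2 * ((η - ξ) ^ 2 * (A ^ 2 + B ^ 2)) / 2 := by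
    have : |η ^ 2 - ξ ^ 2| = |η - ξ| * |η + ξ| := by rw [← abs_mul]; ring_nf
    rw [this]
    have k1 : |η + ξ| ^ 2 ≤ 2 * (η ^ 2 + ξ ^ 2) := by rw [sq_abs]; nlinarith [sq_nonneg (η - ξ)]
    have k2 : (A + B) ^ 2 ≤ 2 * (A ^ 2 + B ^ 2) := by nlinarith [sq_nonneg (A - B)]
    have k3 : α * (|η - ξ| * |η + ξ| * ((A + B) * (A - B)))
        ≤ (|η + ξ| * (A - B)) ^ 2 / 4 + (α * |η - ξ| * (A + B)) ^ 2 := by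
      nlinarith [sq_nonneg (|η + ξ| * (A - B) / 2 - α * |η - ξ| * (A + B))]
    have k4 : (|η + ξ| * (A - B)) ^ 2 ≤ 2 * (η ^ 2 + ξ ^ 2) * (A - B) ^ 2 := by
      rw [mul_pow]; exact mul_le_mul_of_nonneg_right k1 (sq_nonneg _)
    have k5 : (α * |η - ξ| * (A + B)) ^ 2 ≤ α ^ 2 * (η - ξ) ^ 2 * (2 * (A ^ 2 + B ^ 2)) := by
      rw [mul_pow, mul_pow, sq_abs]; exact mul_le_mul_of_nonneg_left k2 (by positivity)
    linarith
  rw [e]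
  have t4 : 0 ≤ α ^ 2 * ((η - ξ) ^ 2 * (A ^ 2 + B ^ 2)) := by positivity
  have t5 := mul_le_mul_of_nonneg_left t2 (by linarith : 0 ≤ α)
  nlinarith

/-! ### Hölder's inequality for sums and integrals -/

section Holder

variable {ι : Type*} (S : Finset ι)

theorem sum_rpow_mul_rpow_le {f g : ι → ℝ} {a b : ℝ} (hf : ∀ i ∈ S, 0 ≤ f i)
    (hg : ∀ i ∈ S, 0 ≤ g i) (ha : 0 ≤ a) (hb : 0 ≤ b) (hab : a + b = 1) :
    ∑ i ∈ S, f i ^ a * g i ^ b ≤ (∑ i ∈ S, f i) ^ a * (∑ i ∈ S, g i) ^ b := by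
  rcases ha.eq_or_lt with rfl | ha
  · have : b = 1 := by linarith
    subst this; simp
  rcases hb.eq_or_lt with rfl | hb
  · have : a = 1 := by linarith
    subst this; simp
  have hpq : (1 / a).HolderConjugate (1 / b) := by
    rw [Real.holderConjugate_iff]
    constructor
    · rw [lt_div_iff₀ ha]; linarith
    · simpa using hab
  have h := Real.inner_le_Lp_mul_Lq_of_nonneg S hpq (f := fun i => f i ^ a) (g := fun i => g i ^ b)
    (fun i hi => Real.rpow_nonneg (hf i hi) _) (fun i hi => Real.rpow_nonneg (hg i hi) _)
  have e1 : ∑ i ∈ S, (f i ^ a) ^ (1 / a) = ∑ i ∈ S, f i := Finset.sum_congr rfl fun i hi => by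
    rw [← Real.rpow_mul (hf i hi), mul_one_div_cancel ha.ne', Real.rpow_one]
  have e2 : ∑ i ∈ S, (g i ^ b) ^ (1 / b) = ∑ i ∈ S, g i := Finset.sum_congr rfl fun i hi => by
    rw [← Real.rpow_mul (hg i hi), mul_one_div_cancel hb.ne', Real.rpow_one]
  rw [e1, e2, one_div_one_div, one_div_one_div] at h
  exact h

/-- Two applications of the two-factor inequality: the first two factors are grouped with relative
weights `a/(a+b)` and `b/(a+b)`. The degenerate case `a + b = 0` is separate because these weights
are then undefined. -/
theorem sum_rpow_mul_rpow_mul_rpow_le {f g h : ι → ℝ} {a b c : ℝ} (hf : ∀ i ∈ S, 0 ≤ f i)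
    (hg : ∀ i ∈ S, 0 ≤ g i) (hh : ∀ i ∈ S, 0 ≤ h i) (ha : 0 ≤ a) (hb : 0 ≤ b) (hc : 0 ≤ c)
    (habc : a + b + c = 1) :
    ∑ i ∈ S, f i ^ a * g i ^ b * h i ^ c
      ≤ (∑ i ∈ S, f i) ^ a * (∑ i ∈ S, g i) ^ b * (∑ i ∈ S, h i) ^ c := by
  rcases (add_nonneg ha hb).eq_or_lt with h0 | h0
  · have ha0 : a = 0 := by linarith
    have hb0 : b = 0 := by linarith
    have hc0 : c = 1 := by linarith
    simp [ha0, hb0, hc0]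
  have hF := Finset.sum_nonneg hf
  have hG := Finset.sum_nonneg hg
  have e : ∀ x y : ℝ, 0 ≤ x → 0 ≤ y →
      (x ^ (a / (a + b)) * y ^ (b / (a + b))) ^ (a + b) = x ^ a * y ^ b := fun x y hx hy => by
    rw [Real.mul_rpow (Real.rpow_nonneg hx _) (Real.rpow_nonneg hy _), ← Real.rpow_mul hx,
      ← Real.rpow_mul hy, div_mul_cancel₀ _ h0.ne', div_mul_cancel₀ _ h0.ne']
  have hk : ∀ i ∈ S, 0 ≤ f i ^ (a / (a + b)) * g i ^ (b / (a + b)) := fun i hi =>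
    mul_nonneg (Real.rpow_nonneg (hf i hi) _) (Real.rpow_nonneg (hg i hi) _)
  calc _ = ∑ i ∈ S, (f i ^ (a / (a + b)) * g i ^ (b / (a + b))) ^ (a + b) * h i ^ c :=
        Finset.sum_congr rfl fun i hi => by rw [e _ _ (hf i hi) (hg i hi)]
    _ ≤ (∑ i ∈ S, f i ^ (a / (a + b)) * g i ^ (b / (a + b))) ^ (a + b) * (∑ i ∈ S, h i) ^ c :=
        sum_rpow_mul_rpow_le S hk hh h0.le hc habc
    _ ≤ ((∑ i ∈ S, f i) ^ (a / (a + b)) * (∑ i ∈ S, g i) ^ (b / (a + b))) ^ (a + b)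
          * (∑ i ∈ S, h i) ^ c := by
        refine mul_le_mul_of_nonneg_right ?_ (Real.rpow_nonneg (Finset.sum_nonneg hh) _)
        refine Real.rpow_le_rpow (Finset.sum_nonneg hk) ?_ h0.le
        exact sum_rpow_mul_rpow_le S hf hg (by positivity) (by positivity) (by field_simp)
    _ = _ := by rw [e _ _ hF hG]

end Holder

/-- After normalising both integrals to `1` this is the integrated weighted arithmetic-geometric
mean inequality. If one integral vanishes, so does the product almost everywhere. -/
theorem integral_rpow_mul_rpow_le {X : Type*} [MeasurableSpace X] {μ : Measure X} {f g : X → ℝ}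
    {a b : ℝ} (hf : Integrable f μ) (hg : Integrable g μ) (hf0 : 0 ≤ᵐ[μ] f) (hg0 : 0 ≤ᵐ[μ] g)
    (ha : 0 < a) (hb : 0 < b) (hab : a + b = 1) :
    ∫ x, f x ^ a * g x ^ b ∂μ ≤ (∫ x, f x ∂μ) ^ a * (∫ x, g x ∂μ) ^ b := by
  have hF : 0 ≤ ∫ x, f x ∂μ := integral_nonneg_of_ae hf0
  have hG : 0 ≤ ∫ x, g x ∂μ := integral_nonneg_of_ae hg0
  rcases hF.eq_or_lt with h | hF
  · have := (integral_eq_zero_iff_of_nonneg_ae hf0 hf).1 h.symm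
    rw [← h, Real.zero_rpow ha.ne', zero_mul]
    refine (integral_eq_zero_of_ae ?_).le
    filter_upwards [this] with x hx
    simp [hx, Real.zero_rpow ha.ne']
  rcases hG.eq_or_lt with h | hG
  · have := (integral_eq_zero_iff_of_nonneg_ae hg0 hg).1 h.symm
    rw [← h, Real.zero_rpow hb.ne', mul_zero]
    refine (integral_eq_zero_of_ae ?_).le
    filter_upwards [this] with x hx
    simp [hx, Real.zero_rpow hb.ne']
  set F := ∫ x, f x ∂μ
  set G := ∫ x, g x ∂μ
  have hFG : 0 ≤ F ^ a * G ^ b := by positivity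
  calc ∫ x, f x ^ a * g x ^ b ∂μ
      ≤ ∫ x, F ^ a * G ^ b * (a * (f x / F) + b * (g x / G)) ∂μ := by
        refine integral_mono_of_nonneg ?_ ?_ ?_
        · filter_upwards [hf0, hg0] with x h1 h2
          exact mul_nonneg (Real.rpow_nonneg h1 _) (Real.rpow_nonneg h2 _)
        · exact (((hf.div_const F).const_mul a).add ((hg.div_const G).const_mul b)).const_mul _
        · filter_upwards [hf0, hg0] with x h1 h2
          have := Real.geom_mean_le_arith_mean2_weighted ha.le hb.le (div_nonneg h1 hF.le)
            (div_nonneg h2 hG.le) hab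
          rw [Real.div_rpow h1 hF.le, Real.div_rpow h2 hG.le] at this
          have := mul_le_mul_of_nonneg_left this hFG
          refine le_trans (le_of_eq ?_) this
          field_simp
    _ = F ^ a * G ^ b * (a * (F / F) + b * (G / G)) := by
        rw [integral_const_mul, integral_add ((hf.div_const F).const_mul a)
          ((hg.div_const G).const_mul b), integral_const_mul, integral_const_mul,
          integral_div, integral_div]
    _ = _ := by rw [div_self hF.ne', div_self hG.ne', mul_one, mul_one, hab, mul_one]

/-! ### Total variation and the Gagliardo-Nirenberg inequality on boxes -/

theorem abs_sub_le_sum_Ico_abs_sub (f : ℤ → ℝ) {a b : ℤ} (hab : a ≤ b) :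
    |f b - f a| ≤ ∑ j ∈ Finset.Ico a b, |f (j + 1) - f j| := by
  induction b, hab using Int.leInduction with
  | base => simp
  | succ b hb ih =>
    have : Finset.Ico a (b + 1) = insert b (Finset.Ico a b) := by
      ext x; simp only [Finset.mem_Ico, Finset.mem_insert]; omega
    rw [this, Finset.sum_insert (by simp)]
    calc |f (b + 1) - f a| = |(f (b + 1) - f b) + (f b - f a)| := by ring_nf
      _ ≤ _ := (abs_add_le _ _).trans (by gcongr)

theorem card_Icc_neg_self (m : ℕ) : (Finset.Icc (-(m : ℤ)) m).card = 2 * m + 1 := by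
  rw [Int.card_Icc]; omega

/-- Compare `f k` with every `f l` through the variation between them and average over `l`. The mean
replaces a boundary condition. -/
theorem abs_le_sum_Ico_add_mean (f : ℤ → ℝ) {m : ℕ} {k : ℤ} (hk : k ∈ Finset.Icc (-(m : ℤ)) m) :
    |f k| ≤ ∑ j ∈ Finset.Ico (-(m : ℤ)) m, |f (j + 1) - f j|
      + (2 * (m : ℝ) + 1)⁻¹ * ∑ j ∈ Finset.Icc (-(m : ℤ)) m, |f j| := by
  set V := ∑ j ∈ Finset.Ico (-(m : ℤ)) m, |f (j + 1) - f j|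
  have key : ∀ l ∈ Finset.Icc (-(m : ℤ)) m, |f k| ≤ V + |f l| := fun l hl => by
    simp only [Finset.mem_Icc] at hk hl
    have h1 : |f k - f l| ≤ V := by
      rcases le_total l k with h | h
      · refine (abs_sub_le_sum_Ico_abs_sub f h).trans
          (Finset.sum_le_sum_of_subset_of_nonneg ?_ fun _ _ _ => abs_nonneg _)
        exact Finset.Ico_subset_Ico hl.1 hk.2
      · rw [abs_sub_comm]
        refine (abs_sub_le_sum_Ico_abs_sub f h).trans
          (Finset.sum_le_sum_of_subset_of_nonneg ?_ fun _ _ _ => abs_nonneg _)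
        exact Finset.Ico_subset_Ico hk.1 hl.2
    have := abs_sub_abs_le_abs_sub (f k) (f l)
    linarith
  have h := Finset.sum_le_sum key
  rw [Finset.sum_add_distrib, Finset.sum_const, Finset.sum_const, card_Icc_neg_self] at h
  simp only [nsmul_eq_mul] at h
  push_cast at h
  have hN : (0 : ℝ) < 2 * m + 1 := by positivity
  rw [inv_mul_eq_div, ← sub_le_iff_le_add', le_div_iff₀ hN]
  linarith

section Box

variable {D : ℕ}

theorem mem_box {m : ℕ} {x : Vertex D} : x ∈ box D m ↔ ∀ i, -(m : ℤ) ≤ x i ∧ x i ≤ m := by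
  simp [box]

theorem mem_boxBonds {m : ℕ} {b : Bond D} :
    b ∈ boxBonds D m ↔ b.1 ∈ box D m ∧ b.1 + unitVec b.2 ∈ box D m := by
  unfold boxBonds
  refine Finset.mem_filter.trans ⟨fun h => h.2, fun h => ⟨?_, h⟩⟩
  exact Finset.mem_product.2 ⟨h.1, Finset.mem_univ _⟩

theorem card_box (D m : ℕ) : (box D m).card = (2 * m + 1) ^ D := by
  simp only [box, Fintype.card_piFinset, card_Icc_neg_self, Finset.prod_const, Finset.card_univ,
    Fintype.card_fin]

theorem sum_boxBonds (m : ℕ) (F : Bond D → ℝ) :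
    ∑ b ∈ boxBonds D m, F b
      = ∑ x ∈ box D m, ∑ i, if x + unitVec i ∈ box D m then F (x, i) else 0 := by
  rw [boxBonds, Finset.sum_filter, Finset.sum_product]
  refine Finset.sum_congr rfl fun x hx => Finset.sum_congr rfl fun i _ => ?_
  simp [Bond.lower, Bond.upper, hx]

theorem sum_boxBonds_lower_le {m : ℕ} {f : Vertex D → ℝ} (hf : ∀ x, 0 ≤ f x) :
    ∑ b ∈ boxBonds D m, f b.1 ≤ D * ∑ x ∈ box D m, f x := by
  rw [sum_boxBonds, Finset.mul_sum]
  refine Finset.sum_le_sum fun x _ => ?_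
  calc _ ≤ ∑ i : Fin D, f x := Finset.sum_le_sum fun i _ => by
        split_ifs
        · exact le_rfl
        · exact hf x
    _ = _ := by simp

/-- A bond is determined by its upper endpoint and its direction, so each vertex is counted at most
`D` times. -/
theorem sum_boxBonds_upper_le {m : ℕ} {f : Vertex D → ℝ} (hf : ∀ x, 0 ≤ f x) :
    ∑ b ∈ boxBonds D m, f (b.1 + unitVec b.2) ≤ D * ∑ x ∈ box D m, f x := by
  calc _ ≤ ∑ b ∈ box D m ×ˢ (Finset.univ : Finset (Fin D)), f b.1 := by
        have hinj : Function.Injective fun b : Bond D => ((b.1 + unitVec b.2, b.2) : Bond D) := by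
          rintro ⟨x, i⟩ ⟨y, j⟩ h
          simp only [Prod.mk.injEq] at h
          obtain ⟨h1, rfl⟩ := h
          simpa using h1
        rw [← Finset.sum_image (s := boxBonds D m)
          (g := fun b : Bond D => ((b.1 + unitVec b.2, b.2) : Bond D))
          (f := fun b : Bond D => f b.1) hinj.injOn]
        refine Finset.sum_le_sum_of_subset_of_nonneg ?_ fun _ _ _ => hf _
        intro b hb
        obtain ⟨c, hc, rfl⟩ := Finset.mem_image.1 hb
        exact Finset.mem_product.2 ⟨(mem_boxBonds.1 hc).2, Finset.mem_univ _⟩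
    _ = _ := by
        rw [Finset.sum_product, Finset.mul_sum]
        refine Finset.sum_congr rfl fun x _ => ?_
        simp

/-- The density at `x` of the total variation norm of `f` on a box of side length `2m+1`. -/
noncomputable def varDensity (m : ℕ) (f : Vertex D → ℝ) (x : Vertex D) : ℝ :=
  ∑ i, (if x + unitVec i ∈ box D m then |grad f (x, i)| else 0) + (2 * (m : ℝ) + 1)⁻¹ * |f x|

/-- The total variation norm of `f` on a box. -/
noncomputable def varNorm (m : ℕ) (f : Vertex D → ℝ) : ℝ :=
  ∑ b ∈ boxBonds D m, |grad f b| + (2 * (m : ℝ) + 1)⁻¹ * ∑ x ∈ box D m, |f x|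

theorem varDensity_nonneg (m : ℕ) (f : Vertex D → ℝ) (x : Vertex D) : 0 ≤ varDensity m f x := by
  refine add_nonneg (Finset.sum_nonneg fun i _ => ?_) (by positivity)
  split_ifs <;> positivity

theorem sum_varDensity (m : ℕ) (f : Vertex D → ℝ) :
    ∑ x ∈ box D m, varDensity m f x = varNorm m f := by
  simp only [varDensity, varNorm, Finset.sum_add_distrib, Finset.mul_sum, sum_boxBonds]

theorem varNorm_nonneg (m : ℕ) (f : Vertex D → ℝ) : 0 ≤ varNorm m f := by
  rw [← sum_varDensity]; exact Finset.sum_nonneg fun x _ => varDensity_nonneg m f x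

theorem update_mem_box {m : ℕ} {x : Vertex D} (hx : x ∈ box D m) (i : Fin D) (k : ℤ) :
    Function.update x i k ∈ box D m ↔ k ∈ Finset.Icc (-(m : ℤ)) m := by
  rw [mem_box] at *
  constructor
  · intro h; simpa using h i
  · intro h j
    rcases eq_or_ne j i with rfl | hj
    · simpa using h
    · simpa [Function.update_of_ne hj] using hx j

theorem update_add_unitVec (x : Vertex D) (i : Fin D) (k : ℤ) :
    Function.update x i k + unitVec i = Function.update x i (k + 1) := by
  ext j
  rcases eq_or_ne j i with rfl | hj <;> simp [unitVec, *]

/-- The one-dimensional bound on the line through `x` in direction `i`: the remaining directional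
derivatives in the density are only discarded. This is the input, one line per direction, of the
Gagliardo-Nirenberg argument. -/
theorem abs_le_sum_varDensity {m : ℕ} (f : Vertex D → ℝ) {x : Vertex D} (hx : x ∈ box D m)
    (i : Fin D) :
    |f x| ≤ ∑ k ∈ Finset.Icc (-(m : ℤ)) m, varDensity m f (Function.update x i k) := by
  have h := abs_le_sum_Ico_add_mean (fun k => f (Function.update x i k)) (m := m) (k := x i)
    (by simpa using mem_box.1 hx i)
  simp only [Function.update_eq_self] at h
  refine h.trans ?_
  simp only [varDensity]
  rw [Finset.sum_add_distrib, Finset.mul_sum]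
  refine add_le_add_left ?_ _
  calc _ ≤ ∑ k ∈ Finset.Ico (-(m : ℤ)) m, ∑ l,
        (if Function.update x i k + unitVec l ∈ box D m
          then |grad f (Function.update x i k, l)| else 0) := by
        refine Finset.sum_le_sum fun k hk => ?_
        refine le_trans ?_ (Finset.single_le_sum (f := fun l =>
          (if Function.update x i k + unitVec l ∈ box D m
          then |grad f (Function.update x i k, l)| else 0)) (fun l _ => by split_ifs <;> positivity)
          (Finset.mem_univ i))
        have hk' : Function.update x i (k + 1) ∈ box D m := by
          rw [update_mem_box hx]; simp only [Finset.mem_Ico, Finset.mem_Icc] at *; omega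
        simp only [update_add_unitVec, hk', if_true, grad, Bond.upper, Bond.lower]
        exact le_rfl
    _ ≤ _ := Finset.sum_le_sum_of_subset_of_nonneg Finset.Ico_subset_Icc_self
        fun k _ _ => Finset.sum_nonneg fun l _ => by split_ifs <;> positivity

theorem abs_le_varNorm [NeZero D] {m : ℕ} (f : Vertex D → ℝ) {x : Vertex D} (hx : x ∈ box D m) :
    |f x| ≤ varNorm m f := by
  refine (abs_le_sum_varDensity f hx 0).trans ?_
  rw [← sum_varDensity]
  rw [← Finset.sum_image (f := varDensity m f) (g := fun k => Function.update x 0 k)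
    (fun a _ b _ h => Function.update_injective x 0 h)]
  refine Finset.sum_le_sum_of_subset_of_nonneg ?_ fun _ _ _ => varDensity_nonneg _ _ _
  intro y hy
  obtain ⟨k, hk, rfl⟩ := Finset.mem_image.1 hy
  exact (update_mem_box hx _ _).2 hk

theorem lintegral_pi_count (g : Vertex D → ENNReal) :
    ∫⁻ x, g x ∂(Measure.pi fun _ : Fin D => (Measure.count : Measure ℤ)) = ∑' x, g x := by
  rw [lintegral_countable']
  refine tsum_congr fun x => ?_
  rw [Measure.pi_singleton]
  simp

/-- The Gagliardo-Nirenberg inequality on a box of `ℤ^D`. -/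
theorem sum_abs_rpow_le_varNorm (hD : 2 ≤ D) (m : ℕ) (f : Vertex D → ℝ) :
    ∑ x ∈ box D m, |f x| ^ ((D : ℝ) / (D - 1)) ≤ varNorm m f ^ ((D : ℝ) / (D - 1)) := by
  have hD' : (2 : ℝ) ≤ D := by exact_mod_cast hD
  have hp : Real.HolderConjugate (Fintype.card (Fin D) : ℝ) ((D : ℝ) / (D - 1)) := by
    rw [Fintype.card_fin]
    have : (D : ℝ) / (D - 1) = Real.conjExponent D := rfl
    rw [this]
    exact Real.HolderConjugate.conjExponent (by linarith)
  have hpos : 0 ≤ (D : ℝ) / (D - 1) := div_nonneg (by linarith) (by linarith)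
  -- Extension by zero, so that the inequality for product measures on all of `ℤ^D` sees only the
  -- box.
  let g : Vertex D → ENNReal := fun x => if x ∈ box D m then ENNReal.ofReal (varDensity m f x) else 0
  have h := lintegral_prod_lintegral_pow_le (fun _ : Fin D => (Measure.count : Measure ℤ)) hp
    (f := g) (measurable_of_countable g)
  rw [lintegral_pi_count, lintegral_pi_count] at h
  have hg : ∑' x, g x = ENNReal.ofReal (varNorm m f) := by
    rw [tsum_eq_sum (s := box D m) (fun x hx => by simp [g, hx]), ← sum_varDensity,
      ENNReal.ofReal_sum_of_nonneg fun x _ => varDensity_nonneg m f x]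
    exact Finset.sum_congr rfl fun x hx => by simp [g, hx]
  rw [hg] at h
  have hle : ∑ x ∈ box D m, ENNReal.ofReal (|f x| ^ ((D : ℝ) / (D - 1))) ≤
      ENNReal.ofReal (varNorm m f) ^ ((D : ℝ) / (D - 1)) := by
    refine le_trans ?_ h
    refine le_trans (Finset.sum_le_sum fun x hx => ?_) (ENNReal.sum_le_tsum (box D m))
    rw [Fintype.card_fin]
    have line : ∀ i : Fin D, ENNReal.ofReal |f x|
        ≤ ∫⁻ k, g (Function.update x i k) ∂(Measure.count : Measure ℤ) := fun i => by
      rw [lintegral_count, tsum_eq_sum (s := Finset.Icc (-(m : ℤ)) m) (fun k hk => by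
        simp only [g, update_mem_box hx, hk, if_false])]
      refine (ENNReal.ofReal_le_ofReal (abs_le_sum_varDensity f hx i)).trans ?_
      rw [ENNReal.ofReal_sum_of_nonneg fun k _ => varDensity_nonneg m f _]
      exact (Finset.sum_congr rfl fun k hk => by
        simp only [g, update_mem_box hx, hk, if_true]).le
    -- The power `D/(D-1)` is split into `D` equal factors, and each is bounded by the line sum in
    -- its own direction.
    calc ENNReal.ofReal (|f x| ^ ((D : ℝ) / (D - 1)))
        = ∏ _i : Fin D, ENNReal.ofReal |f x| ^ ((1 : ℝ) / (D - 1)) := by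
          rw [Finset.prod_const, Finset.card_univ, Fintype.card_fin, ← ENNReal.rpow_natCast,
            ← ENNReal.rpow_mul, ← ENNReal.ofReal_rpow_of_nonneg (abs_nonneg _) hpos]
          congr 1; ring
      _ ≤ _ := Finset.prod_le_prod' fun i _ =>
          ENNReal.rpow_le_rpow (line i) (div_nonneg zero_le_one (by linarith))
  rw [← ENNReal.ofReal_sum_of_nonneg fun x _ => Real.rpow_nonneg (abs_nonneg _) _,
    ENNReal.ofReal_rpow_of_nonneg (varNorm_nonneg m f) hpos] at hle
  exact (ENNReal.ofReal_le_ofReal_iff (Real.rpow_nonneg (varNorm_nonneg m f) _)).1 hle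

end Box

/-! ### Weighted Sobolev inequalities -/

/-- A chain rule for `x^s`, symmetric in the endpoints so that it applies to a bond whichever
endpoint carries the larger value; the upper bound by the larger endpoint is again Bernoulli's
inequality. -/
theorem abs_rpow_sub_rpow_le {s a b : ℝ} (hs : 1 ≤ s) (ha : 0 ≤ a) (hb : 0 ≤ b) :
    |a ^ s - b ^ s| ≤ s * (a ^ (s - 1) + b ^ (s - 1)) * |a - b| := by
  wlog hab : b ≤ a generalizing a b
  · rw [abs_sub_comm, abs_sub_comm a, add_comm]
    exact this hb ha (by linarith)
  rw [abs_of_nonneg (by linarith : 0 ≤ a - b),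
    abs_of_nonneg (sub_nonneg.2 (Real.rpow_le_rpow hb hab (by linarith)))]
  have hb1 : 0 ≤ b ^ (s - 1) := Real.rpow_nonneg hb _
  rcases ha.eq_or_lt with h0 | h0
  · have : b = 0 := by linarith
    subst this; rw [← h0]; simp
  have h := one_add_mul_self_le_rpow_one_add (s := b / a - 1) (p := s)
    (by have := div_nonneg hb ha; linarith) hs
  rw [add_sub_cancel, Real.div_rpow hb ha, le_div_iff₀ (Real.rpow_pos_of_pos h0 _)] at h
  have e : (1 + s * (b / a - 1)) * a ^ s = a ^ s + s * (a ^ (s - 1) * (b - a)) := by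
    have : a ^ s = a ^ (s - 1) * a := by rw [← Real.rpow_add_one h0.ne']; congr 1; ring
    rw [this]; field_simp
  rw [e] at h
  have := mul_nonneg (mul_nonneg (by linarith : 0 ≤ s) hb1) (sub_nonneg.2 hab)
  nlinarith

section Weighted

variable {D : ℕ}

/-- The sum of `ω^{-q}` over the bonds of a box, with a lower bound in terms of `l`. -/
noncomputable def invSum (ω : Bond D → ℝ) (q l : ℝ) (m : ℕ) : ℝ :=
  ∑ b ∈ boxBonds D m, (ω b)⁻¹ ^ q + (box D m).card * l ^ q

/-- The weighted Dirichlet energy on a box, with a zeroth order term. -/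
noncomputable def energySum (ω : Bond D → ℝ) (l : ℝ) (m : ℕ) (w : Vertex D → ℝ) : ℝ :=
  ∑ b ∈ boxBonds D m, ω b * grad w b ^ 2
    + ((2 * (m : ℝ) + 1) ^ 2 * l)⁻¹ * ∑ x ∈ box D m, w x ^ 2

variable {ω : Bond D → ℝ} {q l : ℝ}

theorem invSum_nonneg (hω : ∀ b, 0 < ω b) (hl : 0 < l) (m : ℕ) : 0 ≤ invSum ω q l m :=
  add_nonneg (Finset.sum_nonneg fun b _ => Real.rpow_nonneg (inv_nonneg.2 (hω b).le) _)
    (mul_nonneg (Nat.cast_nonneg _) (Real.rpow_nonneg hl.le _))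

theorem energySum_nonneg (hω : ∀ b, 0 < ω b) (hl : 0 < l) (m : ℕ) (w : Vertex D → ℝ) :
    0 ≤ energySum ω l m w :=
  add_nonneg (Finset.sum_nonneg fun b _ => mul_nonneg (hω b).le (sq_nonneg _))
    (mul_nonneg (by positivity) (Finset.sum_nonneg fun b _ => sq_nonneg _))

/-- Hölder's inequality for the total variation norm of a power. -/
theorem varNorm_rpow_le [NeZero D] (hω : ∀ b, 0 < ω b) (hq : 1 < q) (hl : 0 < l) {s : ℝ}
    (hs : 1 ≤ s) (m : ℕ) (w : Vertex D → ℝ) {X k : ℝ} (hk : k = 1 / 2 - 1 / (2 * q))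
    (hX : X = ∑ x ∈ box D m, |w x| ^ ((s - 1) / k)) :
    varNorm m (fun x => |w x| ^ s)
      ≤ (2 * s * D + 1) * (invSum ω q l m ^ (1 / (2 * q)) * energySum ω l m w ^ (1 / 2 : ℝ)
        * X ^ k) := by
  have hq0 : 0 < q := by linarith
  have hk0 : 0 < k := by
    rw [hk, sub_pos]; exact one_div_lt_one_div_of_lt (by norm_num) (by linarith)
  have hk1 : k ≤ 1 := by
    have : 0 < 1 / (2 * q) := by positivity
    rw [hk]; linarith
  have hD1 : (1 : ℝ) ≤ D := by exact_mod_cast NeZero.one_le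
  have hX0 : 0 ≤ X := by rw [hX]; exact Finset.sum_nonneg fun x _ => Real.rpow_nonneg (abs_nonneg _) _
  have hZ := invSum_nonneg (q := q) hω hl m
  have hE := energySum_nonneg hω hl m w
  set Z := invSum ω q l m with hZdef
  set E := energySum ω l m w with hEdef
  have hsum1 : 0 ≤ ∑ b ∈ boxBonds D m, (ω b)⁻¹ ^ q :=
    Finset.sum_nonneg fun b _ => Real.rpow_nonneg (inv_nonneg.2 (hω b).le) _
  have hsum2 : 0 ≤ ∑ b ∈ boxBonds D m, ω b * grad w b ^ 2 :=
    Finset.sum_nonneg fun b _ => mul_nonneg (hω b).le (sq_nonneg _)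
  have hsum3 : 0 ≤ ((box D m).card : ℝ) * l ^ q :=
    mul_nonneg (Nat.cast_nonneg _) (Real.rpow_nonneg hl.le _)
  have hsum4 : 0 ≤ ((2 * (m : ℝ) + 1) ^ 2 * l)⁻¹ * ∑ x ∈ box D m, w x ^ 2 :=
    mul_nonneg (by positivity) (Finset.sum_nonneg fun b _ => sq_nonneg _)
  have powk : ∀ x : ℝ, (|x| ^ ((s - 1) / k)) ^ k = |x| ^ (s - 1) := fun x => by
    rw [← Real.rpow_mul (abs_nonneg _), div_mul_cancel₀ _ hk0.ne']
  have half : ∀ x : ℝ, (x ^ 2) ^ (1 / 2 : ℝ) = |x| := fun x => by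
    rw [← Real.sqrt_eq_rpow, Real.sqrt_sq_eq_abs]
  have qpow : ∀ x : ℝ, 0 ≤ x → (x ^ q) ^ (1 / (2 * q)) = x ^ (1 / 2 : ℝ) := fun x hx => by
    rw [← Real.rpow_mul hx]; congr 1; field_simp
  -- the gradient term, weighted by the value at an endpoint
  have main : ∀ e : Bond D → Vertex D, (∑ b ∈ boxBonds D m, |w (e b)| ^ ((s - 1) / k) ≤ D * X) →
      ∑ b ∈ boxBonds D m, |w (e b)| ^ (s - 1) * |grad w b|
        ≤ D * (Z ^ (1 / (2 * q)) * E ^ (1 / 2 : ℝ) * X ^ k) := fun e he => by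
    calc _ = ∑ b ∈ boxBonds D m, ((ω b)⁻¹ ^ q) ^ (1 / (2 * q)) * (ω b * grad w b ^ 2) ^ (1 / 2 : ℝ)
          * (|w (e b)| ^ ((s - 1) / k)) ^ k := by
          refine Finset.sum_congr rfl fun b _ => ?_
          rw [powk, qpow _ (inv_nonneg.2 (hω b).le), Real.mul_rpow (hω b).le (sq_nonneg _), half,
            Real.inv_rpow (hω b).le]
          have := (Real.rpow_pos_of_pos (hω b) (1 / 2 : ℝ)).ne'
          field_simp
      _ ≤ (∑ b ∈ boxBonds D m, (ω b)⁻¹ ^ q) ^ (1 / (2 * q))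
          * (∑ b ∈ boxBonds D m, ω b * grad w b ^ 2) ^ (1 / 2 : ℝ)
          * (∑ b ∈ boxBonds D m, |w (e b)| ^ ((s - 1) / k)) ^ k :=
          sum_rpow_mul_rpow_mul_rpow_le _
            (fun b _ => Real.rpow_nonneg (inv_nonneg.2 (hω b).le) _)
            (fun b _ => mul_nonneg (hω b).le (sq_nonneg _))
            (fun b _ => Real.rpow_nonneg (abs_nonneg _) _) (by positivity) (by norm_num) hk0.le
            (by rw [hk]; ring)
      _ ≤ Z ^ (1 / (2 * q)) * E ^ (1 / 2 : ℝ) * (D * X ^ k) := by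
          have h1 : (∑ b ∈ boxBonds D m, |w (e b)| ^ ((s - 1) / k)) ^ k ≤ D * X ^ k := by
            refine (Real.rpow_le_rpow (Finset.sum_nonneg fun b _ =>
              Real.rpow_nonneg (abs_nonneg _) _) he hk0.le).trans ?_
            rw [Real.mul_rpow (by positivity) hX0]
            refine mul_le_mul_of_nonneg_right ?_ (Real.rpow_nonneg hX0 _)
            calc (D : ℝ) ^ k ≤ (D : ℝ) ^ (1 : ℝ) := Real.rpow_le_rpow_of_exponent_le hD1 hk1
              _ = D := Real.rpow_one _
          have h2 : (∑ b ∈ boxBonds D m, (ω b)⁻¹ ^ q) ^ (1 / (2 * q)) ≤ Z ^ (1 / (2 * q)) :=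
            Real.rpow_le_rpow hsum1 (le_add_of_nonneg_right hsum3) (by positivity)
          have h3 : (∑ b ∈ boxBonds D m, ω b * grad w b ^ 2) ^ (1 / 2 : ℝ) ≤ E ^ (1 / 2 : ℝ) :=
            Real.rpow_le_rpow hsum2 (le_add_of_nonneg_right hsum4) (by norm_num)
          gcongr
      _ = _ := by ring
  have hlower : ∑ b ∈ boxBonds D m, |w b.1| ^ ((s - 1) / k) ≤ D * X := by
    rw [hX]
    exact sum_boxBonds_lower_le (f := fun x => |w x| ^ ((s - 1) / k))
      fun _ => Real.rpow_nonneg (abs_nonneg _) _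
  have hupper : ∑ b ∈ boxBonds D m, |w (b.1 + unitVec b.2)| ^ ((s - 1) / k) ≤ D * X := by
    rw [hX]
    exact sum_boxBonds_upper_le (f := fun x => |w x| ^ ((s - 1) / k))
      fun _ => Real.rpow_nonneg (abs_nonneg _) _
  have m1 := main (fun b => b.1) hlower
  have m2 := main (fun b => b.1 + unitVec b.2) hupper
  have hgrad : ∑ b ∈ boxBonds D m, |grad (fun x => |w x| ^ s) b|
      ≤ 2 * s * D * (Z ^ (1 / (2 * q)) * E ^ (1 / 2 : ℝ) * X ^ k) := by
    calc _ ≤ ∑ b ∈ boxBonds D m, s * (|w (b.1 + unitVec b.2)| ^ (s - 1) * |grad w b|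
            + |w b.1| ^ (s - 1) * |grad w b|) := by
          refine Finset.sum_le_sum fun b _ => ?_
          simp only [grad, Bond.upper, Bond.lower]
          refine (abs_rpow_sub_rpow_le hs (abs_nonneg _) (abs_nonneg _)).trans ?_
          have := abs_abs_sub_abs_le_abs_sub (w (b.1 + unitVec b.2)) (w b.1)
          rw [← add_mul, ← mul_assoc]
          gcongr
      _ ≤ _ := by
          rw [← Finset.mul_sum, Finset.sum_add_distrib]
          nlinarith
  have hzero : (2 * (m : ℝ) + 1)⁻¹ * ∑ x ∈ box D m, |(|w x| ^ s)|
      ≤ Z ^ (1 / (2 * q)) * E ^ (1 / 2 : ℝ) * X ^ k := by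
    have hN : (0 : ℝ) < 2 * m + 1 := by positivity
    calc _ = ∑ x ∈ box D m, (l ^ q) ^ (1 / (2 * q))
          * (((2 * (m : ℝ) + 1) ^ 2 * l)⁻¹ * w x ^ 2) ^ (1 / 2 : ℝ)
          * (|w x| ^ ((s - 1) / k)) ^ k := by
          rw [Finset.mul_sum]
          refine Finset.sum_congr rfl fun x _ => ?_
          rw [powk, qpow _ hl.le, Real.mul_rpow (by positivity) (sq_nonneg _), half,
            mul_inv, Real.mul_rpow (by positivity) (by positivity), Real.inv_rpow (by positivity),
            half, abs_of_pos hN, Real.inv_rpow hl.le, abs_of_nonneg (Real.rpow_nonneg (abs_nonneg _) _)]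
          have h1 := (Real.rpow_pos_of_pos hl (1 / 2 : ℝ)).ne'
          have h2 : |w x| ^ s = |w x| * |w x| ^ (s - 1) := by
            rcases (abs_nonneg (w x)).eq_or_lt with h | h
            · rw [← h, Real.zero_rpow (by linarith), zero_mul]
            · nth_rewrite 2 [← Real.rpow_one |w x|]
              rw [← Real.rpow_add h]; congr 1; ring
          rw [h2]
          field_simp
      _ ≤ (∑ x ∈ box D m, l ^ q) ^ (1 / (2 * q))
          * (∑ x ∈ box D m, ((2 * (m : ℝ) + 1) ^ 2 * l)⁻¹ * w x ^ 2) ^ (1 / 2 : ℝ)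
          * (∑ x ∈ box D m, |w x| ^ ((s - 1) / k)) ^ k :=
          sum_rpow_mul_rpow_mul_rpow_le _
            (fun b _ => Real.rpow_nonneg hl.le _) (fun b _ => by positivity)
            (fun b _ => Real.rpow_nonneg (abs_nonneg _) _) (by positivity) (by norm_num) hk0.le
            (by rw [hk]; ring)
      _ ≤ _ := by
          rw [← hX, ← Finset.mul_sum, Finset.sum_const, nsmul_eq_mul]
          have h2 : (((box D m).card : ℝ) * l ^ q) ^ (1 / (2 * q)) ≤ Z ^ (1 / (2 * q)) :=
            Real.rpow_le_rpow hsum3 (le_add_of_nonneg_left hsum1) (by positivity)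
          have h3 : (((2 * (m : ℝ) + 1) ^ 2 * l)⁻¹ * ∑ x ∈ box D m, w x ^ 2) ^ (1 / 2 : ℝ)
              ≤ E ^ (1 / 2 : ℝ) :=
            Real.rpow_le_rpow hsum4 (le_add_of_nonneg_left hsum2) (by norm_num)
          gcongr
  rw [varNorm]
  linarith

/-- The weighted Sobolev inequality on a box. -/
theorem sobolev_box (hD : 2 ≤ D) (hω : ∀ b, 0 < ω b) (hq : 1 < q) (hl : 0 < l) (m : ℕ)
    (w : Vertex D → ℝ) {σ : ℝ} (hσ : σ = 1 + 1 / q - 2 / D) :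
    (∑ x ∈ box D m, |w x| ^ (2 / σ)) ^ σ
      ≤ (2 * (2 / σ) * D + 1) ^ 2 * (invSum ω q l m ^ (1 / q) * energySum ω l m w) := by
  have : NeZero D := ⟨by omega⟩
  have hD' : (2 : ℝ) ≤ D := by exact_mod_cast hD
  have hq0 : 0 < q := by linarith
  have hiq : 1 / q < 1 := by rw [div_lt_one hq0]; exact hq
  have hiq0 : 0 < 1 / q := by positivity
  have hiD : 2 / (D : ℝ) ≤ 1 := by rw [div_le_one (by linarith)]; exact hD'
  have hiD0 : 0 < 2 / (D : ℝ) := by positivity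
  have hσ0 : 0 < σ := by rw [hσ]; linarith
  set k := 1 / 2 - 1 / (2 * q) with hk
  have hkq : k = 1 / 2 - 1 / q / 2 := by rw [hk, div_div, mul_comm]
  have hk0 : 0 < k := by rw [hkq]; linarith
  set s := 1 + 2 / σ * k with hs
  have hs1 : 1 ≤ s := by rw [hs]; have : 0 < 2 / σ * k := by positivity
                         linarith
  have hse : (s - 1) / k = 2 / σ := by rw [hs]; field_simp; ring
  have hsD : s * ((D : ℝ) / (D - 1)) = 2 / σ := by
    have hD0 : (D : ℝ) - 1 ≠ 0 := by linarith
    have : s = 2 / σ * ((D - 1) / D) := by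
      have e : (1 : ℝ) = 2 / σ * (σ / 2) := by field_simp
      rw [hs]
      nth_rewrite 1 [e]
      rw [← mul_add, hkq, hσ]
      congr 1
      field_simp
      ring
    rw [this]; field_simp
  have hsle : s ≤ 2 / σ := by
    rw [← hsD]
    refine le_mul_of_one_le_right (by linarith) ?_
    rw [le_div_iff₀ (by linarith)]; linarith
  set X := ∑ x ∈ box D m, |w x| ^ (2 / σ) with hX
  have hX0 : 0 ≤ X := Finset.sum_nonneg fun x _ => Real.rpow_nonneg (abs_nonneg _) _
  have hv := varNorm_rpow_le (w := w) hω hq hl hs1 m (k := k) rfl rfl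
  rw [hse, ← hX] at hv
  have hZ := invSum_nonneg (q := q) hω hl m
  have hE := energySum_nonneg hω hl m w
  have hg := sum_abs_rpow_le_varNorm hD m (fun x => |w x| ^ s)
  have e1 : ∑ x ∈ box D m, |(|w x| ^ s)| ^ ((D : ℝ) / (D - 1)) = X := by
    refine Finset.sum_congr rfl fun x _ => ?_
    rw [abs_of_nonneg (Real.rpow_nonneg (abs_nonneg _) _), ← Real.rpow_mul (abs_nonneg _), hsD]
  rw [e1] at hg
  set Z := invSum ω q l m
  set E := energySum ω l m w
  -- A power of `X` will be cancelled from both sides, which needs `X` positive.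
  rcases hX0.eq_or_lt with h0 | hXpos
  · rw [← h0, Real.zero_rpow hσ0.ne']; positivity
  have hg2 : X ^ (((D : ℝ) - 1) / D) ≤ varNorm m (fun x => |w x| ^ s) := by
    have h1 := Real.rpow_le_rpow hX0 hg (by
      apply div_nonneg <;> linarith : 0 ≤ ((D : ℝ) - 1) / D)
    rwa [← Real.rpow_mul (varNorm_nonneg _ _), div_mul_div_cancel₀ (by linarith),
      div_self (by linarith), Real.rpow_one] at h1
  have hg3 := hg2.trans hv
  have e2 : X ^ (((D : ℝ) - 1) / D) = X ^ (σ / 2) * X ^ k := by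
    rw [← Real.rpow_add hXpos, hkq, hσ]; congr 1; field_simp; ring
  rw [e2, ← mul_assoc] at hg3
  have hg4 := le_of_mul_le_mul_right hg3 (Real.rpow_pos_of_pos hXpos k)
  have hg5 : X ^ (σ / 2) ≤ (2 * (2 / σ) * D + 1) * (Z ^ (1 / (2 * q)) * E ^ (1 / 2 : ℝ)) := by
    refine hg4.trans ?_
    gcongr
  have hg6 := pow_le_pow_left₀ (Real.rpow_nonneg hX0 _) hg5 2
  rw [mul_pow, mul_pow, ← Real.rpow_natCast (X ^ (σ / 2)), ← Real.rpow_mul hX0,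
    ← Real.rpow_natCast (Z ^ _), ← Real.rpow_mul hZ, ← Real.rpow_natCast (E ^ _),
    ← Real.rpow_mul hE] at hg6
  have e3 : σ / 2 * ((2 : ℕ) : ℝ) = σ := by push_cast; ring
  have e4 : 1 / (2 * q) * ((2 : ℕ) : ℝ) = 1 / q := by push_cast; field_simp
  have e5 : (1 / 2 : ℝ) * ((2 : ℕ) : ℝ) = 1 := by norm_num
  rwa [e3, e4, e5, Real.rpow_one] at hg6

/-- The weighted Sobolev inequality on an interval. -/
theorem sobolev_interval {ω : Bond 1 → ℝ} (hω : ∀ b, 0 < ω b) (hq : 1 < q) (hl : 0 < l) (m : ℕ)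
    (w : Vertex 1 → ℝ) {x : Vertex 1} (hx : x ∈ box 1 m) :
    w x ^ 2 ≤ 9 * ((2 * (m : ℝ) + 1) ^ (1 - 1 / q) * (invSum ω q l m ^ (1 / q)
      * energySum ω l m w)) := by
  have hq0 : 0 < q := by linarith
  have h1 := abs_le_varNorm (fun x => |w x| ^ (1 : ℝ)) hx
  -- With `s = 1` the leftover exponent is `0`, so the leftover sum is just the number of vertices;
  -- squaring the prefactor `2 · 1 · 1 + 1` gives the constant `9`.
  have h2 := varNorm_rpow_le (w := w) hω hq hl le_rfl m (k := 1 / 2 - 1 / (2 * q)) rfl rfl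
  have h3 := h1.trans h2
  simp only [Real.rpow_one, abs_abs, sub_self, zero_div, Real.rpow_zero, Finset.sum_const,
    card_box, nsmul_eq_mul, mul_one, pow_one, Nat.cast_one] at h3
  have hZ := invSum_nonneg (q := q) hω hl m
  have hE := energySum_nonneg hω hl m w
  have hg6 := pow_le_pow_left₀ (abs_nonneg _) h3 2
  have hN : (0 : ℝ) ≤ ((2 * m + 1 : ℕ) : ℝ) := Nat.cast_nonneg _
  rw [sq_abs, mul_pow, mul_pow, mul_pow, ← Real.rpow_natCast (invSum ω q l m ^ _),
    ← Real.rpow_mul hZ, ← Real.rpow_natCast (energySum ω l m w ^ _), ← Real.rpow_mul hE,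
    ← Real.rpow_natCast (((2 * m + 1 : ℕ) : ℝ) ^ _), ← Real.rpow_mul hN] at hg6
  have e4 : 1 / (2 * q) * ((2 : ℕ) : ℝ) = 1 / q := by push_cast; field_simp
  have e5 : (1 / 2 : ℝ) * ((2 : ℕ) : ℝ) = 1 := by norm_num
  have e6 : (1 / 2 - 1 / (2 * q)) * ((2 : ℕ) : ℝ) = 1 - 1 / q := by push_cast; field_simp
  rw [e4, e5, e6, Real.rpow_one] at hg6
  push_cast at hg6
  linarith

end Weighted

/-- The Sobolev exponent `σ` for which the weighted Sobolev inequality controls `L^{2/σ}`;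
`σ = 0` stands for the supremum norm. -/
def IsSobolevExponent (D : ℕ) (q σ : ℝ) : Prop :=
  (D = 1 ∧ σ = 0) ∨ (2 ≤ D ∧ σ = 1 + 1 / q - 2 / D)

/-- Hölder's inequality with weights `e`, `b` and `σ c`, where the last factor is the `L^(2/σ)` norm
from Sobolev's inequality. On an interval `σ = 0`: the pointwise bound on `w²` is pulled out and
costs no Hölder weight. The power of `2m+1` lets both cases share one formula. -/
theorem exists_sum_rpow_le_of_sobolev {D : ℕ} {q σ : ℝ} (hσ : IsSobolevExponent D q σ)
    (hq : 1 < q) :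
    ∃ C : ℝ, 1 ≤ C ∧ ∀ (ω : Bond D → ℝ) (l : ℝ) (m : ℕ) (a A w : Vertex D → ℝ) (e b c : ℝ),
      (∀ b, 0 < ω b) → 0 < l → (∀ x ∈ box D m, 0 ≤ a x) → (∀ x ∈ box D m, 0 ≤ A x) →
      0 ≤ e → 0 ≤ b → 0 ≤ c → e + b + σ * c = 1 →
      ∑ x ∈ box D m, a x ^ e * A x ^ b * (w x ^ 2) ^ c
        ≤ (∑ x ∈ box D m, a x) ^ e * (∑ x ∈ box D m, A x) ^ b *
          (C * ((2 * (m : ℝ) + 1) ^ (2 - D / q - D + D * σ) *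
            (invSum ω q l m ^ (1 / q) * energySum ω l m w))) ^ c := by
  have hq0 : 0 < q := by linarith
  rcases hσ with ⟨rfl, rfl⟩ | ⟨hD, hσ⟩
  · refine ⟨9, by norm_num, fun ω l m a A w e b c hω hl ha hA he hb hc hsum => ?_⟩
    have hZ := invSum_nonneg (q := q) hω hl m
    have hE := energySum_nonneg hω hl m w
    have hexp : (2 - ((1 : ℕ) : ℝ) / q - ((1 : ℕ) : ℝ) + ((1 : ℕ) : ℝ) * 0) = 1 - 1 / q := by
      push_cast; ring
    rw [hexp]
    set K := 9 * ((2 * (m : ℝ) + 1) ^ (1 - 1 / q) * (invSum ω q l m ^ (1 / q)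
      * energySum ω l m w))
    calc _ ≤ ∑ x ∈ box 1 m, a x ^ e * A x ^ b * K ^ c := by
          refine Finset.sum_le_sum fun x hx => mul_le_mul_of_nonneg_left ?_
            (mul_nonneg (Real.rpow_nonneg (ha x hx) _) (Real.rpow_nonneg (hA x hx) _))
          exact Real.rpow_le_rpow (sq_nonneg _) (sobolev_interval hω hq hl m w hx) hc
      _ = (∑ x ∈ box 1 m, a x ^ e * A x ^ b) * K ^ c := by rw [Finset.sum_mul]
      _ ≤ _ := by
          refine mul_le_mul_of_nonneg_right ?_ (Real.rpow_nonneg (by positivity) _)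
          exact sum_rpow_mul_rpow_le _ ha hA he hb (by linarith)
  · have hσ0 : 0 < σ := by
      have : (2 : ℝ) ≤ D := by exact_mod_cast hD
      have h1 : 2 / (D : ℝ) ≤ 1 := by rw [div_le_one (by linarith)]; exact this
      have : 0 < 1 / q := by positivity
      linarith
    refine ⟨(2 * (2 / σ) * D + 1) ^ 2, one_le_pow₀ (le_add_of_nonneg_left (by positivity)),
      fun ω l m a A w e b c hω hl ha hA he hb hc hsum => ?_⟩
    -- In dimension at least two `σ` is the scaling exponent itself, so the power of the side length
    -- is trivial.
    have hexp : (2 - (D : ℝ) / q - D + D * σ) = 0 := by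
      have : (D : ℝ) ≠ 0 := by positivity
      rw [hσ]; field_simp; ring
    rw [hexp, Real.rpow_zero, one_mul]
    have hpt : ∀ x, (w x ^ 2) ^ c = (|w x| ^ (2 / σ)) ^ (σ * c) := fun x => by
      rw [← Real.rpow_mul (abs_nonneg _), ← sq_abs, ← Real.rpow_natCast, ← Real.rpow_mul
        (abs_nonneg _)]
      congr 1; push_cast; field_simp
    have hX0 : 0 ≤ ∑ x ∈ box D m, |w x| ^ (2 / σ) :=
      Finset.sum_nonneg fun x _ => Real.rpow_nonneg (abs_nonneg _) _
    simp only [hpt]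
    refine (sum_rpow_mul_rpow_mul_rpow_le _ ha hA (fun x _ => Real.rpow_nonneg (abs_nonneg _) _)
      he hb (by positivity) hsum).trans ?_
    refine mul_le_mul_of_nonneg_left ?_ (mul_nonneg (Real.rpow_nonneg (Finset.sum_nonneg ha) _)
      (Real.rpow_nonneg (Finset.sum_nonneg hA) _))
    rw [Real.rpow_mul hX0]
    exact Real.rpow_le_rpow (Real.rpow_nonneg hX0 _) (sobolev_box hD hω hq hl m w hσ) hc

/-- Scale invariant combination of Hölder's and Sobolev's inequalities on a box. -/
theorem exists_mean_rpow_le_of_sobolev {D : ℕ} {q σ : ℝ} (hσ : IsSobolevExponent D q σ)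
    (hq : 1 < q) :
    ∃ C : ℝ, 1 ≤ C ∧ ∀ (ω : Bond D → ℝ) (l : ℝ) (m : ℕ) (a A w : Vertex D → ℝ) (e b c : ℝ),
      (∀ b, 0 < ω b) → 0 < l → (∀ x ∈ box D m, 0 ≤ a x) → (∀ x ∈ box D m, 0 ≤ A x) →
      0 ≤ e → 0 ≤ b → 0 ≤ c → c ≤ 1 → e + b + σ * c = 1 →
      (∑ x ∈ box D m, a x ^ e * A x ^ b * (w x ^ 2) ^ c) / (2 * (m : ℝ) + 1) ^ D
        ≤ C * (((∑ x ∈ box D m, a x) / (2 * (m : ℝ) + 1) ^ D) ^ e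
          * ((∑ x ∈ box D m, A x) / (2 * (m : ℝ) + 1) ^ D) ^ b *
          ((2 * (m : ℝ) + 1) ^ 2 * ((invSum ω q l m / (2 * (m : ℝ) + 1) ^ D) ^ (1 / q)
            * (energySum ω l m w / (2 * (m : ℝ) + 1) ^ D))) ^ c) := by
  obtain ⟨C, hC, H⟩ := exists_sum_rpow_le_of_sobolev hσ hq
  refine ⟨C, hC, fun ω l m a A w e b c hω hl ha hA he hb hc hc1 hsum => ?_⟩
  have hq0 : 0 < q := by linarith
  have hZ := invSum_nonneg (q := q) hω hl m
  have hE := energySum_nonneg hω hl m w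
  have hN : (0 : ℝ) < 2 * m + 1 := by positivity
  have hsa := Finset.sum_nonneg ha
  have hsA := Finset.sum_nonneg hA
  rw [div_le_iff₀ (by positivity)]
  refine (H ω l m a A w e b c hω hl ha hA he hb hc hsum).trans ?_
  have hCc : C ^ c ≤ C := by
    calc C ^ c ≤ C ^ (1 : ℝ) := Real.rpow_le_rpow_of_exponent_le hC hc1
      _ = C := Real.rpow_one _
  have hZq := Real.rpow_nonneg hZ (1 / q)
  rw [Real.mul_rpow (by linarith) (by positivity)]
  -- The bookkeeping of the side length: the condition `e + b + σ c = 1` is what makes all powers of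
  -- `2m+1` cancel once sums are replaced by averages.
  have key : ((∑ x ∈ box D m, a x) / (2 * (m : ℝ) + 1) ^ D) ^ e
          * ((∑ x ∈ box D m, A x) / (2 * (m : ℝ) + 1) ^ D) ^ b *
          ((2 * (m : ℝ) + 1) ^ 2 * ((invSum ω q l m / (2 * (m : ℝ) + 1) ^ D) ^ (1 / q)
            * (energySum ω l m w / (2 * (m : ℝ) + 1) ^ D))) ^ c * (2 * (m : ℝ) + 1) ^ D
      = (∑ x ∈ box D m, a x) ^ e * (∑ x ∈ box D m, A x) ^ b *
          ((2 * (m : ℝ) + 1) ^ (2 - D / q - D + D * σ) *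
            (invSum ω q l m ^ (1 / q) * energySum ω l m w)) ^ c := by
    generalize (∑ x ∈ box D m, a x) = Sa at *
    generalize (∑ x ∈ box D m, A x) = SA at *
    generalize invSum ω q l m = Z at *
    generalize energySum ω l m w = E at *
    generalize (2 * (m : ℝ) + 1) = N at *
    have hM : 0 < N ^ D := by positivity
    rw [Real.div_rpow hsa hM.le, Real.div_rpow hsA hM.le, Real.div_rpow hZ hM.le,
      Real.mul_rpow (by positivity) (by positivity), Real.mul_rpow (by positivity) (by positivity),
      Real.div_rpow (by positivity) (by positivity), Real.div_rpow hE hM.le,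
      Real.mul_rpow (by positivity) (by positivity), Real.mul_rpow (by positivity) (by positivity)]
    have e1 : N ^ D = N ^ (D : ℝ) := (Real.rpow_natCast _ _).symm
    have e2 : N ^ 2 = N ^ (2 : ℝ) := by norm_cast
    have hexp : (N ^ (2 - (D : ℝ) / q - D + D * σ)) ^ c
        = (N ^ (2 : ℝ)) ^ c * N ^ (D : ℝ) / ((N ^ (D : ℝ)) ^ e * (N ^ (D : ℝ)) ^ b
            * (((N ^ (D : ℝ)) ^ (1 / q)) ^ c * (N ^ (D : ℝ)) ^ c)) := by
      rw [← Real.rpow_mul hN.le, ← Real.rpow_mul hN.le, ← Real.rpow_mul hN.le,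
        ← Real.rpow_mul hN.le, ← Real.rpow_mul hN.le, ← Real.rpow_mul hN.le,
        ← Real.rpow_mul hN.le, ← Real.rpow_add hN, ← Real.rpow_add hN, ← Real.rpow_add hN,
        ← Real.rpow_add hN, ← Real.rpow_sub hN]
      congr 1
      have : e = 1 - b - σ * c := by linarith
      rw [this]
      field_simp
      ring
    rw [hexp, e1, e2]
    have p1 := (Real.rpow_pos_of_pos (Real.rpow_pos_of_pos hN (D : ℝ)) e).ne'
    have p2 := (Real.rpow_pos_of_pos (Real.rpow_pos_of_pos hN (D : ℝ)) b).ne'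
    have p3 := (Real.rpow_pos_of_pos (Real.rpow_pos_of_pos hN (D : ℝ)) c).ne'
    have p4 := (Real.rpow_pos_of_pos (Real.rpow_pos_of_pos (Real.rpow_pos_of_pos hN (D : ℝ))
      (1 / q)) c).ne'
    generalize (N ^ (D : ℝ)) ^ e = t1 at *
    generalize (N ^ (D : ℝ)) ^ b = t2 at *
    generalize ((N ^ (D : ℝ)) ^ (1 / q)) ^ c = t4 at *
    generalize (N ^ (D : ℝ)) ^ c = t3 at *
    field_simp
  rw [mul_assoc C, key]
  have hR : 0 ≤ (∑ x ∈ box D m, a x) ^ e * (∑ x ∈ box D m, A x) ^ b *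
          ((2 * (m : ℝ) + 1) ^ (2 - D / q - D + D * σ) *
            (invSum ω q l m ^ (1 / q) * energySum ω l m w)) ^ c := by
    have := Real.rpow_nonneg hsa e
    have := Real.rpow_nonneg hsA b
    positivity
  calc _ = C ^ c * ((∑ x ∈ box D m, a x) ^ e * (∑ x ∈ box D m, A x) ^ b *
          ((2 * (m : ℝ) + 1) ^ (2 - D / q - D + D * σ) *
            (invSum ω q l m ^ (1 / q) * energySum ω l m w)) ^ c) := by ring
    _ ≤ _ := mul_le_mul_of_nonneg_right hCc hR

/-! ### Summation by parts and the Caccioppoli inequality -/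

section Energy

variable {d : ℕ} {ω : Bond d → ℝ}

/-- Summation by parts for functions vanishing at the boundary of the box. -/
theorem sum_mul_generator {m : ℕ} {ψ : Vertex d → ℝ}
    (h₁ : ∀ x ∈ box d m, ∀ i, x + unitVec i ∉ box d m → ψ x = 0)
    (h₂ : ∀ x ∈ box d m, ∀ i, x - unitVec i ∉ box d m → ψ x = 0) (f : Vertex d → ℝ) :
    ∑ x ∈ box d m, ψ x * generator ω f x = -∑ b ∈ boxBonds d m, ω b * (grad ψ b * grad f b) := by
  have e1 : ∑ x ∈ box d m, ∑ i, ψ x * (ω (x, i) * (f (x + unitVec i) - f x))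
      = ∑ b ∈ boxBonds d m, ψ b.1 * (ω b * grad f b) := by
    rw [sum_boxBonds]
    refine Finset.sum_congr rfl fun x hx => Finset.sum_congr rfl fun i _ => ?_
    split_ifs with h
    · rfl
    · rw [h₁ x hx i h, zero_mul]
  have e2 : ∑ x ∈ box d m, ∑ i, ψ x * (ω (x - unitVec i, i) * (f (x - unitVec i) - f x))
      = -∑ b ∈ boxBonds d m, ψ (b.1 + unitVec b.2) * (ω b * grad f b) := by
    rw [sum_boxBonds, Finset.sum_comm, Finset.sum_comm (s := box d m), ← Finset.sum_neg_distrib]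
    refine Finset.sum_congr rfl fun i _ => ?_
    rw [← Finset.sum_filter]
    -- Terms whose lower neighbour leaves the box vanish with `ψ`; the rest are reindexed by the
    -- lower endpoint of the bond.
    have : ∑ x ∈ box d m, ψ x * (ω (x - unitVec i, i) * (f (x - unitVec i) - f x))
        = ∑ x ∈ (box d m).filter (fun x => x - unitVec i ∈ box d m),
          ψ x * (ω (x - unitVec i, i) * (f (x - unitVec i) - f x)) := by
      rw [Finset.sum_filter]
      refine Finset.sum_congr rfl fun x hx => ?_
      split_ifs with h
      · rfl
      · rw [h₂ x hx i h, zero_mul]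
    rw [this, ← Finset.sum_neg_distrib]
    refine Finset.sum_nbij' (fun x => x - unitVec i) (fun x => x + unitVec i) ?_ ?_ ?_ ?_ ?_
    · intro x hx
      rw [Finset.mem_filter] at *
      exact ⟨hx.2, by simpa using hx.1⟩
    · intro x hx
      rw [Finset.mem_filter] at *
      exact ⟨hx.2, by simpa using hx.1⟩
    · intro x _; simp
    · intro x _; simp
    · intro x _
      simp only [grad, Bond.upper, Bond.lower, sub_add_cancel]
      ring
  simp only [generator, Finset.mul_sum, mul_add, Finset.sum_add_distrib]
  rw [e1, e2, ← sub_eq_add_neg, ← Finset.sum_sub_distrib, ← Finset.sum_neg_distrib]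
  refine Finset.sum_congr rfl fun b _ => ?_
  simp only [grad, Bond.upper, Bond.lower]
  ring

/-- Summation by parts against `η² f^(2α-1)`, then the pairing inequality on each bond. Boundary
terms are absent because `η` vanishes on the outer layer of the box. -/
theorem sum_cutoff_generator_le (hω : ∀ b, 0 < ω b) {m : ℕ} {η f : Vertex d → ℝ} {α : ℝ}
    (hα : 1 ≤ α) (hf : ∀ x ∈ box d m, 0 ≤ f x)
    (h₁ : ∀ x ∈ box d m, ∀ i, x + unitVec i ∉ box d m → η x = 0)
    (h₂ : ∀ x ∈ box d m, ∀ i, x - unitVec i ∉ box d m → η x = 0) :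
    2 * α * ∑ x ∈ box d m, η x ^ 2 * f x ^ (2 * α - 1) * generator ω f x
      ≤ 4 * α ^ 2 * (∑ b ∈ boxBonds d m, ω b * (grad η b ^ 2
          * ((f b.1 ^ α) ^ 2 + (f (b.1 + unitVec b.2) ^ α) ^ 2)))
        - ∑ b ∈ boxBonds d m, ω b * ((η b.1 ^ 2 + η (b.1 + unitVec b.2) ^ 2)
          * grad (fun x => f x ^ α) b ^ 2 / 2) := by
  rw [sum_mul_generator (ψ := fun x => η x ^ 2 * f x ^ (2 * α - 1))
    (fun x hx i h => by rw [h₁ x hx i h]; ring) (fun x hx i h => by rw [h₂ x hx i h]; ring),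
    mul_neg, Finset.mul_sum, Finset.mul_sum, ← Finset.sum_neg_distrib, ← Finset.sum_sub_distrib]
  refine Finset.sum_le_sum fun b hb => ?_
  rw [mem_boxBonds] at hb
  have h := cutoff_pairing_ge (η := η (b.1 + unitVec b.2)) (ξ := η b.1) hα
    (hf _ hb.2) (hf _ hb.1)
  have h' := mul_le_mul_of_nonneg_left h (hω b).le
  simp only [grad, Bond.upper, Bond.lower]
  linarith

variable {n m : ℕ} {s₁ s₂ : ℝ} {u : ℝ → Vertex d → ℝ}

theorem continuousOn_of_isSubcaloric {I : Set ℝ} {V : Finset (Vertex d)}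
    (h : IsSubcaloric ω u I V) {x : Vertex d} (hx : x ∈ V) : ContinuousOn (fun t => u t x) I :=
  fun t ht => (h x hx t ht).1.continuousWithinAt

theorem box_mono (h : n ≤ m) : box d n ⊆ box d m := fun x hx => by
  rw [mem_box] at *
  have : (n : ℤ) ≤ m := by exact_mod_cast h
  exact fun i => ⟨by linarith [(hx i).1], by linarith [(hx i).2]⟩

theorem boxBonds_mono (h : n ≤ m) : boxBonds d n ⊆ boxBonds d m := fun x hx => by
  rw [mem_boxBonds] at *
  exact ⟨box_mono h hx.1, box_mono h hx.2⟩

/-- The time derivative of the localised energy of a subsolution. -/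
theorem energy_sub_le (hω : ∀ b, 0 < ω b)
    (hu : ∀ t ∈ Set.Icc (-s₂) 0, ∀ x ∈ box d m, 0 ≤ u t x)
    (hsub : IsSubcaloric ω u (Set.Icc (-s₂) 0) (box d m)) {α : ℝ} (hα : 1 ≤ α)
    {η : Vertex d → ℝ}
    (h₁ : ∀ x ∈ box d m, ∀ i, x + unitVec i ∉ box d m → η x = 0)
    (h₂ : ∀ x ∈ box d m, ∀ i, x - unitVec i ∉ box d m → η x = 0)
    {τ t : ℝ} (hτ : -s₂ ≤ τ) (hτt : τ ≤ t) (ht : t ≤ 0) {φ : ℝ → ℝ}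
    (hφ : ContinuousOn φ (Set.Icc (-s₂) 0))
    (hle : ∀ s ∈ Set.Icc (-s₂) 0, 4 * α ^ 2 * (∑ b ∈ boxBonds d m, ω b * (grad η b ^ 2
          * ((u s b.1 ^ α) ^ 2 + (u s (b.1 + unitVec b.2) ^ α) ^ 2)))
        - ∑ b ∈ boxBonds d m, ω b * ((η b.1 ^ 2 + η (b.1 + unitVec b.2) ^ 2)
          * grad (fun x => u s x ^ α) b ^ 2 / 2) ≤ φ s) :
    (∑ x ∈ box d m, η x ^ 2 * (u t x ^ α) ^ 2) - (∑ x ∈ box d m, η x ^ 2 * (u τ x ^ α) ^ 2)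
      ≤ ∫ s in τ..t, φ s := by
  have hsubset : Set.Icc τ t ⊆ Set.Icc (-s₂) 0 := Set.Icc_subset_Icc hτ ht
  have e : ∀ s ∈ Set.Icc (-s₂) 0, ∑ x ∈ box d m, η x ^ 2 * (u s x ^ α) ^ 2
      = ∑ x ∈ box d m, η x ^ 2 * u s x ^ (2 * α) := fun s hs =>
    Finset.sum_congr rfl fun x hx => by
      rw [← Real.rpow_natCast (u s x ^ α), ← Real.rpow_mul (hu s hs x hx)]; congr 2; push_cast; ring
  rw [e t ⟨hτ.trans hτt, ht⟩, e τ ⟨hτ, hτt.trans ht⟩]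
  refine intervalIntegral.sub_le_integral_of_hasDeriv_right_of_le
    (g := fun s => ∑ x ∈ box d m, η x ^ 2 * u s x ^ (2 * α))
    (g' := fun s => ∑ x ∈ box d m, η x ^ 2 *
      (derivWithin (fun r => u r x) (Set.Icc (-s₂) 0) s * (2 * α) * u s x ^ (2 * α - 1)))
    hτt ?_ ?_ ((hφ.mono hsubset).integrableOn_Icc) ?_
  · refine continuousOn_finsetSum _ fun x hx => ContinuousOn.mul continuousOn_const ?_
    exact ((continuousOn_of_isSubcaloric hsub hx).mono hsubset).rpow_const fun s _ => Or.inr (by linarith)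
  · intro s hs
    -- In the open interval the derivative within `[-s₂, 0]` is a genuine two-sided derivative.
    have hnhds : Set.Icc (-s₂) 0 ∈ nhds s :=
      Icc_mem_nhds (lt_of_le_of_lt hτ hs.1) (lt_of_lt_of_le hs.2 ht)
    have hs' : s ∈ Set.Icc (-s₂) 0 := hsubset (Set.Ioo_subset_Icc_self hs)
    refine HasDerivAt.hasDerivWithinAt ?_
    refine HasDerivAt.fun_sum fun x hx => HasDerivAt.const_mul _ ?_
    -- The chain rule for `u^(2α)` holds even where `u = 0`, since `2α ≥ 1`.
    exact ((hsub x hx s hs').1.hasDerivWithinAt.hasDerivAt hnhds).rpow_const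
      (Or.inr (by linarith))
  · intro s hs
    have hs' : s ∈ Set.Icc (-s₂) 0 := hsubset (Set.Ioo_subset_Icc_self hs)
    refine le_trans ?_ ((sum_cutoff_generator_le hω hα (hu s hs') h₁ h₂).trans (hle s hs'))
    rw [Finset.mul_sum]
    refine Finset.sum_le_sum fun x hx => ?_
    have h := (hsub x hx s hs').2
    have h0 : 0 ≤ 2 * α * (η x ^ 2 * u s x ^ (2 * α - 1)) :=
      mul_nonneg (by linarith) (mul_nonneg (sq_nonneg _) (Real.rpow_nonneg (hu s hs' x hx) _))
    have := mul_le_mul_of_nonneg_left (sub_nonpos.1 h) h0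
    linarith

/-- The parabolic Caccioppoli inequality. -/
theorem caccioppoli (hω : ∀ b, 0 < ω b) (hnm : n ≤ m) (hs₁ : 0 < s₁) (hs : s₁ < s₂)
    (hu : ∀ t ∈ Set.Icc (-s₂) 0, ∀ x ∈ box d m, 0 ≤ u t x)
    (hsub : IsSubcaloric ω u (Set.Icc (-s₂) 0) (box d m)) {α : ℝ} (hα : 1 ≤ α)
    {η : Vertex d → ℝ} (hη0 : ∀ x, 0 ≤ η x) (hη1 : ∀ x, η x ≤ 1) (hηn : ∀ x ∈ box d n, η x = 1)
    (h₁ : ∀ x ∈ box d m, ∀ i, x + unitVec i ∉ box d m → η x = 0)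
    (h₂ : ∀ x ∈ box d m, ∀ i, x - unitVec i ∉ box d m → η x = 0) {R : ℝ}
    (hR : (s₂ - s₁)⁻¹ * (∫ t in Set.Icc (-s₂) 0, ∑ x ∈ box d m, (u t x ^ α) ^ 2)
      + 4 * α ^ 2 * (∫ t in Set.Icc (-s₂) 0, ∑ b ∈ boxBonds d m, ω b * (grad η b ^ 2
          * ((u t b.1 ^ α) ^ 2 + (u t (b.1 + unitVec b.2) ^ α) ^ 2))) ≤ R) :
    (∀ t ∈ Set.Icc (-s₁) 0, ∑ x ∈ box d n, (u t x ^ α) ^ 2 ≤ R) ∧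
    ∫ t in Set.Icc (-s₁) 0, ∑ b ∈ boxBonds d n, ω b * grad (fun x => u t x ^ α) b ^ 2 ≤ R := by
  have hvc : ∀ x ∈ box d m, ContinuousOn (fun t => u t x ^ α) (Set.Icc (-s₂) 0) := fun x hx =>
    (continuousOn_of_isSubcaloric hsub hx).rpow_const fun s _ => Or.inr (by linarith)
  set F : ℝ → ℝ := fun t => ∑ b ∈ boxBonds d m, ω b * (grad η b ^ 2
          * ((u t b.1 ^ α) ^ 2 + (u t (b.1 + unitVec b.2) ^ α) ^ 2)) with hF
  set G : ℝ → ℝ := fun t => ∑ b ∈ boxBonds d n, ω b * grad (fun x => u t x ^ α) b ^ 2 with hG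
  set V : ℝ → ℝ := fun t => ∑ x ∈ box d m, (u t x ^ α) ^ 2 with hV
  set y : ℝ → ℝ := fun t => ∑ x ∈ box d m, η x ^ 2 * (u t x ^ α) ^ 2 with hy
  have hFc : ContinuousOn F (Set.Icc (-s₂) 0) := by
    refine continuousOn_finsetSum _ fun b hb => ?_
    rw [mem_boxBonds] at hb
    exact continuousOn_const.mul (continuousOn_const.mul
      (((hvc _ hb.1).pow 2).add ((hvc _ hb.2).pow 2)))
  have hGc : ContinuousOn G (Set.Icc (-s₂) 0) := by
    refine continuousOn_finsetSum _ fun b hb => ?_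
    have hb := mem_boxBonds.1 (boxBonds_mono hnm hb)
    exact continuousOn_const.mul (((hvc _ hb.2).sub (hvc _ hb.1)).pow 2)
  have hVc : ContinuousOn V (Set.Icc (-s₂) 0) :=
    continuousOn_finsetSum _ fun x hx => (hvc _ hx).pow 2
  have hyc : ContinuousOn y (Set.Icc (-s₂) 0) :=
    continuousOn_finsetSum _ fun x hx => continuousOn_const.mul ((hvc _ hx).pow 2)
  have hF0 : ∀ t, 0 ≤ F t := fun t => Finset.sum_nonneg fun b _ =>
    mul_nonneg (hω b).le (by positivity)
  have hG0 : ∀ t, 0 ≤ G t := fun t => Finset.sum_nonneg fun b _ =>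
    mul_nonneg (hω b).le (sq_nonneg _)
  have hV0 : ∀ t, 0 ≤ V t := fun t => Finset.sum_nonneg fun b _ => sq_nonneg _
  have hy0 : ∀ t, 0 ≤ y t := fun t => Finset.sum_nonneg fun b _ => by positivity
  have hyV : ∀ t, y t ≤ V t := fun t => Finset.sum_le_sum fun x _ => by
    have : η x ^ 2 ≤ 1 := pow_le_one₀ (hη0 x) (hη1 x)
    nlinarith [sq_nonneg (u t x ^ α)]
  have hny : ∀ t, ∑ x ∈ box d n, (u t x ^ α) ^ 2 ≤ y t := fun t => by
    calc _ = ∑ x ∈ box d n, η x ^ 2 * (u t x ^ α) ^ 2 :=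
          Finset.sum_congr rfl fun x hx => by rw [hηn x hx]; ring
      _ ≤ _ := Finset.sum_le_sum_of_subset_of_nonneg (box_mono hnm) fun x _ _ => by positivity
  have hGle : ∀ t, G t ≤ ∑ b ∈ boxBonds d m, ω b * ((η b.1 ^ 2 + η (b.1 + unitVec b.2) ^ 2)
          * grad (fun x => u t x ^ α) b ^ 2 / 2) := fun t => by
    calc _ = ∑ b ∈ boxBonds d n, ω b * ((η b.1 ^ 2 + η (b.1 + unitVec b.2) ^ 2)
          * grad (fun x => u t x ^ α) b ^ 2 / 2) :=
          Finset.sum_congr rfl fun b hb => by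
            rw [mem_boxBonds] at hb
            rw [hηn _ hb.1, hηn _ hb.2]; ring
      _ ≤ _ := Finset.sum_le_sum_of_subset_of_nonneg (boxBonds_mono hnm) fun b _ _ =>
          mul_nonneg (hω b).le (by positivity)
  have ii : ∀ {g : ℝ → ℝ}, ContinuousOn g (Set.Icc (-s₂) 0) → ∀ {a b : ℝ}, -s₂ ≤ a → a ≤ b →
      b ≤ 0 → IntervalIntegrable g volume a b := fun hg a b ha hab hb =>
    (hg.mono (by rw [Set.uIcc_of_le hab]; exact Set.Icc_subset_Icc ha hb)).intervalIntegrable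
  have toIcc : ∀ (g : ℝ → ℝ) {a b : ℝ}, a ≤ b → ∫ t in Set.Icc a b, g t = ∫ t in a..b, g t :=
    fun g a b hab => by rw [intervalIntegral.integral_of_le hab, integral_Icc_eq_integral_Ioc]
  rw [toIcc V (by linarith), toIcc F (by linarith)] at hR
  -- The energy inequality from time `τ` to `t`. The dissipation before `-s₁` is dropped and the
  -- cutoff term is extended to the whole interval, so that only `y τ` still depends on `τ`.
  have step : ∀ t ∈ Set.Icc (-s₁) 0, ∀ τ ∈ Set.Icc (-s₂) (-s₁),
      y t + ∫ s in (-s₁)..t, G s ≤ y τ + 4 * α ^ 2 * ∫ s in (-s₂)..0, F s := by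
    intro t ht τ hτ
    have hτt : τ ≤ t := hτ.2.trans ht.1
    have h := energy_sub_le hω hu hsub hα h₁ h₂ hτ.1 hτt ht.2
      (φ := fun s => 4 * α ^ 2 * F s - G s)
      ((continuousOn_const.mul hFc).sub hGc) (fun s _ => sub_le_sub_left (hGle s) _)
    rw [intervalIntegral.integral_sub ((ii hFc hτ.1 hτt ht.2).const_mul _) (ii hGc hτ.1 hτt ht.2),
      intervalIntegral.integral_const_mul] at h
    have hFle : ∫ s in τ..t, F s ≤ ∫ s in (-s₂)..0, F s :=
      intervalIntegral.integral_mono_interval hτ.1 hτt ht.2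
        (Filter.Eventually.of_forall hF0) (ii hFc le_rfl (by linarith) le_rfl)
    have hGle' : ∫ s in (-s₁)..t, G s ≤ ∫ s in τ..t, G s :=
      intervalIntegral.integral_mono_interval hτ.2 ht.1 le_rfl
        (Filter.Eventually.of_forall hG0) (ii hGc hτ.1 hτt ht.2)
    have := mul_le_mul_of_nonneg_left hFle (by positivity : 0 ≤ 4 * α ^ 2)
    linarith
  have fin : ∀ t ∈ Set.Icc (-s₁) 0, y t + ∫ s in (-s₁)..t, G s ≤ R := by
    intro t ht
    refine le_trans ?_ hR
    -- Averaging over `τ` in `[-s₂, -s₁]` replaces a cutoff in time and produces the factor `(s₂ -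
    -- s₁)⁻¹`.
    have h := intervalIntegral.integral_mono_on (a := -s₂) (b := -s₁) (by linarith)
      (f := fun _ => y t + ∫ s in (-s₁)..t, G s)
      (g := fun τ => y τ + 4 * α ^ 2 * ∫ s in (-s₂)..0, F s) (by simp)
      ((ii hyc le_rfl (by linarith) (by linarith)).add (by simp)) (fun τ hτ => step t ht τ hτ)
    rw [intervalIntegral.integral_add (ii hyc le_rfl (by linarith) (by linarith)) (by simp),
      intervalIntegral.integral_const, intervalIntegral.integral_const, smul_eq_mul,
      smul_eq_mul] at h
    have h3 : ∫ τ in (-s₂)..(-s₁), y τ ≤ ∫ τ in (-s₂)..0, V τ := by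
      refine le_trans (intervalIntegral.integral_mono_on (by linarith)
        (ii hyc le_rfl (by linarith) (by linarith)) (ii hVc le_rfl (by linarith) (by linarith))
        fun τ _ => hyV τ) ?_
      exact intervalIntegral.integral_mono_interval le_rfl (by linarith) (by linarith)
        (Filter.Eventually.of_forall hV0) (ii hVc le_rfl (by linarith) le_rfl)
    have hpos : 0 < s₂ - s₁ := by linarith
    rw [inv_mul_eq_div, ← sub_le_iff_le_add, le_div_iff₀ hpos]
    linarith
  refine ⟨fun t ht => (hny t).trans ?_, ?_⟩
  · have : 0 ≤ ∫ s in (-s₁)..t, G s :=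
      intervalIntegral.integral_nonneg ht.1 fun s _ => hG0 s
    linarith [fin t ht]
  · rw [toIcc G (by linarith)]
    linarith [fin 0 ⟨by linarith, le_rfl⟩, hy0 0]

end Energy

/-! ### Scale-invariant Sobolev estimates integrated in time -/

section SobolevMean

variable {D : ℕ} {q σ : ℝ}

/-- Jensen's inequality for averages. It absorbs the slack when the Hölder weights add up to less
than one. -/
theorem sum_rpow_div_card_rpow_le {ι : Type*} (S : Finset ι) {f : ι → ℝ} {e r M : ℝ}
    (hf : ∀ i ∈ S, 0 ≤ f i) (he : 0 < e) (hr : 0 ≤ r) (hM : 0 < M) (hcard : (S.card : ℝ) = M) :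
    ((∑ i ∈ S, f i ^ (e / (e + r))) / M) ^ (e + r) ≤ ((∑ i ∈ S, f i) / M) ^ e := by
  have her : 0 < e + r := by linarith
  have hF := Finset.sum_nonneg hf
  have h := sum_rpow_mul_rpow_le S hf (g := fun _ => (1 : ℝ)) (fun _ _ => zero_le_one)
    (a := e / (e + r)) (b := r / (e + r)) (by positivity) (by positivity) (by field_simp)
  simp only [Real.one_rpow, mul_one, Finset.sum_const, nsmul_eq_mul, hcard] at h
  have h0 : 0 ≤ ∑ i ∈ S, f i ^ (e / (e + r)) :=
    Finset.sum_nonneg fun i hi => Real.rpow_nonneg (hf i hi) _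
  have h2 : (∑ i ∈ S, f i ^ (e / (e + r))) / M ≤ ((∑ i ∈ S, f i) / M) ^ (e / (e + r)) := by
    rw [div_le_iff₀ hM, Real.div_rpow hF hM.le]
    refine h.trans (le_of_eq ?_)
    have : M ^ (r / (e + r)) = M / M ^ (e / (e + r)) := by
      nth_rewrite 2 [← Real.rpow_one M]
      rw [← Real.rpow_sub hM]; congr 1; field_simp; ring
    rw [this]; ring
  refine (Real.rpow_le_rpow (by positivity) h2 her.le).trans (le_of_eq ?_)
  rw [← Real.rpow_mul (by positivity), div_mul_cancel₀ _ her.ne']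

/-- Scale invariant combination of Jensen's, Hölder's and Sobolev's inequalities on a box. -/
theorem exists_mean_rpow_le_of_sobolev_of_le (hσ : IsSobolevExponent D q σ)
    (hq : 1 < q) :
    ∃ C : ℝ, 1 ≤ C ∧ ∀ (ω : Bond D → ℝ) (l : ℝ) (m : ℕ) (a A w : Vertex D → ℝ) (e b c : ℝ),
      (∀ b, 0 < ω b) → 0 < l → (∀ x ∈ box D m, 0 ≤ a x) → (∀ x ∈ box D m, 0 ≤ A x) →
      0 < e → 0 ≤ b → 0 ≤ c → c ≤ 1 → e + b + σ * c ≤ 1 →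
      (∑ x ∈ box D m, a x ^ e * A x ^ b * (w x ^ 2) ^ c) / (2 * (m : ℝ) + 1) ^ D
        ≤ C * (((∑ x ∈ box D m, a x) / (2 * (m : ℝ) + 1) ^ D) ^ e
          * ((∑ x ∈ box D m, A x) / (2 * (m : ℝ) + 1) ^ D) ^ b *
          ((2 * (m : ℝ) + 1) ^ 2 * ((invSum ω q l m / (2 * (m : ℝ) + 1) ^ D) ^ (1 / q)
            * (energySum ω l m w / (2 * (m : ℝ) + 1) ^ D))) ^ c) := by
  obtain ⟨C, hC, H⟩ := exists_mean_rpow_le_of_sobolev hσ hq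
  refine ⟨C, hC, fun ω l m a A w e b c hω hl ha hA he hb hc hc1 hsum => ?_⟩
  have hZ := invSum_nonneg (q := q) hω hl m
  have hE := energySum_nonneg hω hl m w
  have hN : (0 : ℝ) < (2 * (m : ℝ) + 1) ^ D := by positivity
  -- The slack `r` is added to the weight of `a`: replacing `a` by `a^(e/(e+r))` leaves the
  -- integrand unchanged and makes the weights add up to one.
  obtain ⟨r, hr, hr1⟩ : ∃ r : ℝ, 0 ≤ r ∧ e + r + b + σ * c = 1 :=
    ⟨1 - (e + b + σ * c), by linarith, by ring⟩
  have her : 0 < e + r := by linarith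
  have h := H ω l m (fun x => a x ^ (e / (e + r))) A w (e + r) b c hω hl
    (fun x hx => Real.rpow_nonneg (ha x hx) _) hA her.le hb hc hc1 hr1
  have e1 : ∑ x ∈ box D m, (a x ^ (e / (e + r))) ^ (e + r) * A x ^ b * (w x ^ 2) ^ c
      = ∑ x ∈ box D m, a x ^ e * A x ^ b * (w x ^ 2) ^ c :=
    Finset.sum_congr rfl fun x hx => by
      rw [← Real.rpow_mul (ha x hx), div_mul_cancel₀ _ her.ne']
  rw [e1] at h
  refine h.trans ?_
  have hA0 : 0 ≤ (∑ x ∈ box D m, A x) / (2 * (m : ℝ) + 1) ^ D :=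
    div_nonneg (Finset.sum_nonneg hA) hN.le
  have := sum_rpow_div_card_rpow_le (box D m) ha he hr hN (by rw [card_box]; push_cast; rfl)
  have hAb := Real.rpow_nonneg hA0 b
  gcongr

/-- The previous inequality integrated in time. -/
theorem exists_integral_mean_rpow_le_of_sobolev (hσ : IsSobolevExponent D q σ) (hq : 1 < q) :
    ∃ C : ℝ, 1 ≤ C ∧ ∀ (ω : Bond D → ℝ) (l : ℝ) (m : ℕ) (s : ℝ) (a : Vertex D → ℝ)
      (A w : ℝ → Vertex D → ℝ) (e b c a₀ A₀ Z₀ E₀ : ℝ),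
      (∀ b, 0 < ω b) → 0 < l → (∀ x ∈ box D m, 0 ≤ a x) →
      (∀ t ∈ Set.Icc (-s) 0, ∀ x ∈ box D m, 0 ≤ A t x) →
      (∀ x ∈ box D m, ContinuousOn (fun t => A t x) (Set.Icc (-s) 0)) →
      (∀ x ∈ box D m, ContinuousOn (fun t => w t x) (Set.Icc (-s) 0)) →
      0 < e → 0 ≤ b → 0 < c → b + c = 1 → e + b + σ * c ≤ 1 →
      (∑ x ∈ box D m, a x) / (2 * (m : ℝ) + 1) ^ D ≤ a₀ →
      (∫ t in Set.Icc (-s) 0, ∑ x ∈ box D m, A t x) / (2 * (m : ℝ) + 1) ^ D ≤ A₀ →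
      invSum ω q l m / (2 * (m : ℝ) + 1) ^ D ≤ Z₀ →
      (∫ t in Set.Icc (-s) 0, energySum ω l m (w t)) / (2 * (m : ℝ) + 1) ^ D ≤ E₀ →
      (∫ t in Set.Icc (-s) 0, ∑ x ∈ box D m, a x ^ e * A t x ^ b * (w t x ^ 2) ^ c)
          / (2 * (m : ℝ) + 1) ^ D
        ≤ C * (a₀ ^ e * A₀ ^ b * ((2 * (m : ℝ) + 1) ^ 2 * (Z₀ ^ (1 / q) * E₀)) ^ c) := by
  obtain ⟨C, hC, H⟩ := exists_mean_rpow_le_of_sobolev_of_le hσ hq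
  refine ⟨C, hC, ?_⟩
  intro ω l m s a A w e b c a₀ A₀ Z₀ E₀ hω hl ha hA hAc hwc he hb hc hbc hsum ha0 hA0 hZ0 hE0
  have hq0 : 0 < q := by linarith
  have hZ := invSum_nonneg (q := q) hω hl m
  have hE := fun t => energySum_nonneg hω hl m (w t)
  have hM : (0 : ℝ) < (2 * (m : ℝ) + 1) ^ D := by positivity
  set M := (2 * (m : ℝ) + 1) ^ D
  set I := Set.Icc (-s) (0 : ℝ)
  have hAsum : ContinuousOn (fun t => ∑ x ∈ box D m, A t x) I := continuousOn_finsetSum _ hAc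
  have hEsum : ContinuousOn (fun t => energySum ω l m (w t)) I := by
    refine ContinuousOn.add (continuousOn_finsetSum _ fun b hb => ?_)
      (continuousOn_const.mul (continuousOn_finsetSum _ fun x hx => (hwc x hx).pow 2))
    rw [mem_boxBonds] at hb
    exact continuousOn_const.mul (((hwc _ hb.2).sub (hwc _ hb.1)).pow 2)
  have hsum_a := div_nonneg (Finset.sum_nonneg ha) hM.le
  have hint_A : 0 ≤ (∫ t in I, ∑ x ∈ box D m, A t x) / M :=
    div_nonneg (setIntegral_nonneg measurableSet_Icc fun t ht => Finset.sum_nonneg (hA t ht)) hM.le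
  have hint_E : 0 ≤ (∫ t in I, energySum ω l m (w t)) / M :=
    div_nonneg (setIntegral_nonneg measurableSet_Icc fun t _ => hE t) hM.le
  have hAi : IntegrableOn (fun t => (∑ x ∈ box D m, A t x) / M) I :=
    (hAsum.div_const _).integrableOn_Icc
  have hEi : IntegrableOn (fun t => energySum ω l m (w t) / M) I :=
    (hEsum.div_const _).integrableOn_Icc
  have hA0' : ∀ t ∈ I, 0 ≤ (∑ x ∈ box D m, A t x) / M :=
    fun t ht => div_nonneg (Finset.sum_nonneg (hA t ht)) hM.le
  have hE0' : ∀ t, 0 ≤ energySum ω l m (w t) / M := fun t => div_nonneg (hE t) hM.le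
  have holder : ∫ t in I, ((∑ x ∈ box D m, A t x) / M) ^ b * (energySum ω l m (w t) / M) ^ c
      ≤ A₀ ^ b * E₀ ^ c := by
    have h1 : ∫ t in I, ((∑ x ∈ box D m, A t x) / M) ^ b * (energySum ω l m (w t) / M) ^ c
        ≤ (∫ t in I, (∑ x ∈ box D m, A t x) / M) ^ b
          * (∫ t in I, energySum ω l m (w t) / M) ^ c := by
      rcases hb.eq_or_lt with rfl | hb
      · have : c = 1 := by linarith
        subst this; simp
      · exact integral_rpow_mul_rpow_le hAi hEi
          ((ae_restrict_iff' measurableSet_Icc).2 (Filter.Eventually.of_forall hA0'))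
          (Filter.Eventually.of_forall hE0') hb hc hbc
    refine h1.trans ?_
    rw [integral_div, integral_div]
    exact mul_le_mul (Real.rpow_le_rpow hint_A hA0 hb) (Real.rpow_le_rpow hint_E hE0 hc.le)
      (Real.rpow_nonneg hint_E _) (Real.rpow_nonneg (hint_A.trans hA0) _)
  set K := C * (a₀ ^ e * ((2 * (m : ℝ) + 1) ^ 2 * Z₀ ^ (1 / q)) ^ c)
  have ha0' : 0 ≤ a₀ := hsum_a.trans ha0
  have hZ0' : 0 ≤ Z₀ := (div_nonneg hZ hM.le).trans hZ0
  have hK : 0 ≤ K := by positivity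
  rw [← integral_div]
  calc ∫ t in I, (∑ x ∈ box D m, a x ^ e * A t x ^ b * (w t x ^ 2) ^ c) / M
      ≤ ∫ t in I, K * (((∑ x ∈ box D m, A t x) / M) ^ b * (energySum ω l m (w t) / M) ^ c) := by
        refine setIntegral_mono_on ?_ ?_ measurableSet_Icc fun t ht => ?_
        · refine ContinuousOn.integrableOn_Icc (ContinuousOn.div_const
            (continuousOn_finsetSum _ fun x hx => ?_) _)
          exact (continuousOn_const.mul ((hAc x hx).rpow_const fun _ _ => Or.inr hb)).mul
            (((hwc x hx).pow 2).rpow_const fun _ _ => Or.inr hc.le)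
        · exact ContinuousOn.integrableOn_Icc (continuousOn_const.mul
            (((hAsum.div_const _).rpow_const fun _ _ => Or.inr hb).mul
            ((hEsum.div_const _).rpow_const fun _ _ => Or.inr hc.le)))
        · refine (H ω l m a (A t) (w t) e b c hω hl ha (hA t ht) he hb hc.le (by linarith)
            hsum).trans ?_
          have hA' := Real.rpow_nonneg (hA0' t ht) b
          have hE' := hE0' t
          calc _ ≤ C * (a₀ ^ e * ((∑ x ∈ box D m, A t x) / M) ^ b *
                ((2 * (m : ℝ) + 1) ^ 2 * (Z₀ ^ (1 / q) * (energySum ω l m (w t) / M))) ^ c) := by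
                gcongr
            _ = _ := by
                rw [← mul_assoc ((2 * (m : ℝ) + 1) ^ 2), Real.mul_rpow (by positivity) hE']
                ring
    _ = K * ∫ t in I, ((∑ x ∈ box D m, A t x) / M) ^ b * (energySum ω l m (w t) / M) ^ c :=
        integral_const_mul _ _
    _ ≤ K * (A₀ ^ b * E₀ ^ c) := mul_le_mul_of_nonneg_left holder hK
    _ = _ := by
        rw [← mul_assoc ((2 * (m : ℝ) + 1) ^ 2), Real.mul_rpow (by positivity) (hint_E.trans hE0)]
        ring

end SobolevMean

/-! ### Product cutoffs with jumps at prescribed radii -/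

section Cutoff

/-- The profile which decreases from `1` to `0` with equal jumps at the radii in `G`. -/
noncomputable def cutProfile (G : Finset ℕ) (k : ℕ) : ℝ :=
  ((G.filter fun j => k ≤ j).card : ℝ) / G.card

/-- The product cutoff function on `ℤ^d` with a given profile. -/
noncomputable def cutoff {d : ℕ} (G : Finset ℕ) (x : Vertex d) : ℝ :=
  ∏ i, cutProfile G (x i).natAbs

/-- The smaller of the absolute values of the endpoints of `[k, k+1]`. -/
def edgeRadius (k : ℤ) : ℕ := if 0 ≤ k then k.natAbs else (k + 1).natAbs

variable {d n m : ℕ} {G : Finset ℕ}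

theorem cutProfile_nonneg (G : Finset ℕ) (k : ℕ) : 0 ≤ cutProfile G k := by
  unfold cutProfile; positivity

theorem cutProfile_le_one (G : Finset ℕ) (k : ℕ) : cutProfile G k ≤ 1 :=
  div_le_one_of_le₀ (by exact_mod_cast Finset.card_filter_le _ _) (Nat.cast_nonneg _)

theorem cutProfile_eq_one (hG : G ⊆ Finset.Ico n m) (hne : G.Nonempty) {k : ℕ} (hk : k ≤ n) :
    cutProfile G k = 1 := by
  unfold cutProfile
  rw [Finset.filter_true_of_mem fun j hj => hk.trans (Finset.mem_Ico.1 (hG hj)).1]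
  exact div_self (by exact_mod_cast hne.card_pos.ne')

theorem cutProfile_eq_zero (hG : G ⊆ Finset.Ico n m) {k : ℕ} (hk : m ≤ k) :
    cutProfile G k = 0 := by
  unfold cutProfile
  rw [Finset.filter_false_of_mem fun j hj => by
    have := (Finset.mem_Ico.1 (hG hj)).2; omega]
  simp

theorem cutProfile_sub_succ (G : Finset ℕ) (k : ℕ) :
    cutProfile G k - cutProfile G (k + 1) = if k ∈ G then (G.card : ℝ)⁻¹ else 0 := by
  unfold cutProfile
  rw [← sub_div]
  have : G.filter (fun j => k ≤ j) = G.filter (fun j => k + 1 ≤ j) ∪ G.filter (fun j => j = k) := by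
    ext j; simp only [Finset.mem_filter, Finset.mem_union]; constructor
    · rintro ⟨h, h2⟩
      rcases h2.eq_or_lt with h3 | h3
      · exact Or.inr ⟨h, h3.symm⟩
      · exact Or.inl ⟨h, h3⟩
    · rintro (⟨h, h2⟩ | ⟨h, h2⟩)
      · exact ⟨h, by omega⟩
      · exact ⟨h, h2.ge⟩
  rw [this, Finset.card_union_of_disjoint, Finset.filter_eq']
  · split_ifs with h <;> simp [div_eq_mul_inv]
  · rw [Finset.disjoint_left]
    intro j h1 h2
    simp only [Finset.mem_filter] at h1 h2
    omega

/-- On the nonnegative side the jump across `[k, k+1]` occurs at radius `k`, on the negative side at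
radius `|k+1|`: always the endpoint nearer to the origin. -/
theorem abs_cutProfile_sub (G : Finset ℕ) (k : ℤ) :
    |cutProfile G (k + 1).natAbs - cutProfile G k.natAbs|
      = if edgeRadius k ∈ G then (G.card : ℝ)⁻¹ else 0 := by
  have hc : (0 : ℝ) ≤ (G.card : ℝ)⁻¹ := by positivity
  unfold edgeRadius
  by_cases hk : 0 ≤ k
  · have : (k + 1).natAbs = k.natAbs + 1 := by omega
    rw [if_pos hk, this, abs_sub_comm, cutProfile_sub_succ]
    split_ifs <;> simp
  · have : k.natAbs = (k + 1).natAbs + 1 := by omega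
    rw [if_neg hk, this, cutProfile_sub_succ]
    split_ifs <;> simp

theorem cutoff_nonneg (G : Finset ℕ) (x : Vertex d) : 0 ≤ cutoff G x :=
  Finset.prod_nonneg fun _ _ => cutProfile_nonneg _ _

theorem cutoff_le_one (G : Finset ℕ) (x : Vertex d) : cutoff G x ≤ 1 :=
  Finset.prod_le_one (fun _ _ => cutProfile_nonneg _ _) fun _ _ => cutProfile_le_one _ _

theorem cutoff_eq_one (hG : G ⊆ Finset.Ico n m) (hne : G.Nonempty) {x : Vertex d}
    (hx : x ∈ box d n) : cutoff G x = 1 := by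
  refine Finset.prod_eq_one fun i _ => cutProfile_eq_one hG hne ?_
  have := mem_box.1 hx i
  omega

theorem cutoff_eq_zero (hG : G ⊆ Finset.Ico n m) {x : Vertex d} {i : Fin d}
    (hi : m ≤ (x i).natAbs) : cutoff G x = 0 :=
  Finset.prod_eq_zero (Finset.mem_univ i) (cutProfile_eq_zero hG hi)

/-- A vertex of `B(m)` with a neighbour outside in direction `i` has `|x_i| = m`, and all jumps lie
strictly below `m`. This is the boundary condition needed for summation by parts. -/
theorem cutoff_eq_zero_of_add (hG : G ⊆ Finset.Ico n m) {x : Vertex d} (hx : x ∈ box d m)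
    {i : Fin d} (hi : x + unitVec i ∉ box d m) : cutoff G x = 0 := by
  refine cutoff_eq_zero (i := i) hG ?_
  by_contra h
  refine hi (mem_box.2 fun j => ?_)
  have h1 := mem_box.1 hx j
  have h2 := mem_box.1 hx i
  rcases eq_or_ne j i with rfl | hj
  · simp only [unitVec, Pi.add_apply, Pi.single_eq_same]; omega
  · simp only [unitVec, Pi.add_apply, Pi.single_eq_of_ne hj]; omega

theorem cutoff_eq_zero_of_sub (hG : G ⊆ Finset.Ico n m) {x : Vertex d} (hx : x ∈ box d m)
    {i : Fin d} (hi : x - unitVec i ∉ box d m) : cutoff G x = 0 := by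
  refine cutoff_eq_zero (i := i) hG ?_
  by_contra h
  refine hi (mem_box.2 fun j => ?_)
  have h1 := mem_box.1 hx j
  have h2 := mem_box.1 hx i
  rcases eq_or_ne j i with rfl | hj
  · simp only [unitVec, Pi.sub_apply, Pi.single_eq_same]; omega
  · simp only [unitVec, Pi.sub_apply, Pi.single_eq_of_ne hj]; omega

/-- Along direction `i` only the `i`-th factor of the product changes, and the other factors are at
most one. -/
theorem sq_grad_cutoff_le (G : Finset ℕ) (x : Vertex d) (i : Fin d) :
    grad (cutoff G) (x, i) ^ 2 ≤ if edgeRadius (x i) ∈ G then ((G.card : ℝ)⁻¹) ^ 2 else 0 := by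
  have h : |grad (cutoff G) (x, i)| ≤ if edgeRadius (x i) ∈ G then (G.card : ℝ)⁻¹ else 0 := by
    rw [← abs_cutProfile_sub]
    simp only [grad, cutoff, Bond.upper, Bond.lower]
    rw [← Finset.mul_prod_erase _ _ (Finset.mem_univ i),
      ← Finset.mul_prod_erase Finset.univ (fun j => cutProfile G (x j).natAbs) (Finset.mem_univ i)]
    have e : ∏ j ∈ Finset.univ.erase i, cutProfile G ((x + unitVec i) j).natAbs
        = ∏ j ∈ Finset.univ.erase i, cutProfile G (x j).natAbs :=
      Finset.prod_congr rfl fun j hj => by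
        simp [unitVec, Pi.single_eq_of_ne (Finset.ne_of_mem_erase hj)]
    rw [e, ← sub_mul, abs_mul]
    have e2 : (x + unitVec i) i = x i + 1 := by simp [unitVec]
    rw [e2]
    refine mul_le_of_le_one_right (abs_nonneg _) ?_
    rw [abs_of_nonneg (Finset.prod_nonneg fun _ _ => cutProfile_nonneg _ _)]
    exact Finset.prod_le_one (fun _ _ => cutProfile_nonneg _ _) fun _ _ => cutProfile_le_one _ _
  rw [← sq_abs]
  refine (pow_le_pow_left₀ (abs_nonneg _) h 2).trans (le_of_eq ?_)
  split_ifs <;> simp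

end Cutoff

/-! ### Hyperplane slices and good radii -/

section Slices

variable {D m : ℕ}

/-- The point `y` of the slice `{x | x i = k}`. -/
def slicePt (i : Fin (D + 1)) (k : ℤ) (y : Vertex D) : Vertex (D + 1) := i.insertNth k y

/-- The bond `b` of the slice `{x | x i = k}`. -/
def sliceBond (i : Fin (D + 1)) (k : ℤ) (b : Bond D) : Bond (D + 1) :=
  (slicePt i k b.1, i.succAbove b.2)

@[simp] theorem slicePt_same (i : Fin (D + 1)) (k : ℤ) (y : Vertex D) : slicePt i k y i = k := by
  simp [slicePt]

@[simp] theorem slicePt_succAbove (i : Fin (D + 1)) (k : ℤ) (y : Vertex D) (l : Fin D) :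
    slicePt i k y (i.succAbove l) = y l := by
  simp [slicePt]

theorem slicePt_mem_box {i : Fin (D + 1)} {k : ℤ} {y : Vertex D} :
    slicePt i k y ∈ box (D + 1) m ↔ k ∈ Finset.Icc (-(m : ℤ)) m ∧ y ∈ box D m := by
  rw [mem_box, Fin.forall_iff_succAbove i, mem_box, Finset.mem_Icc]
  simp

theorem slicePt_add_unitVec_succAbove (i : Fin (D + 1)) (k : ℤ) (y : Vertex D) (l : Fin D) :
    slicePt i k y + unitVec (i.succAbove l) = slicePt i k (y + unitVec l) := by
  funext j
  refine Fin.succAboveCases i ?_ (fun j => ?_) j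
  · simp [unitVec, (Fin.succAbove_ne i l).symm]
  · simp [unitVec, Pi.single_apply]

theorem slicePt_add_unitVec_same (i : Fin (D + 1)) (k : ℤ) (y : Vertex D) :
    slicePt i k y + unitVec i = slicePt i (k + 1) y := by
  funext j
  refine Fin.succAboveCases i ?_ (fun j => ?_) j
  · simp [unitVec]
  · simp [unitVec, Fin.succAbove_ne]

theorem slicePt_inj {i : Fin (D + 1)} {k k' : ℤ} {y y' : Vertex D} :
    slicePt i k y = slicePt i k' y' ↔ k = k' ∧ y = y' := by
  simp [slicePt]

theorem sum_box_slices (i : Fin (D + 1)) (F : Vertex (D + 1) → ℝ) :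
    ∑ x ∈ box (D + 1) m, F x
      = ∑ k ∈ Finset.Icc (-(m : ℤ)) m, ∑ y ∈ box D m, F (slicePt i k y) := by
  rw [← Finset.sum_product']
  refine (Finset.sum_nbij' (fun p : ℤ × Vertex D => slicePt i p.1 p.2)
    (fun x => (x i, fun l => x (i.succAbove l))) ?_ ?_ ?_ ?_ ?_).symm
  · intro p hp
    exact slicePt_mem_box.2 (Finset.mem_product.1 hp)
  · intro x hx
    rw [mem_box] at hx
    exact Finset.mem_product.2 ⟨Finset.mem_Icc.2 (hx i), mem_box.2 fun l => hx _⟩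
  · rintro ⟨k, y⟩ _
    simp
  · intro x _
    exact Fin.insertNth_self_removeNth i x
  · intro p _; rfl

theorem sliceBond_mem_boxBonds {i : Fin (D + 1)} {k : ℤ} {b : Bond D} :
    sliceBond i k b ∈ boxBonds (D + 1) m ↔ k ∈ Finset.Icc (-(m : ℤ)) m ∧ b ∈ boxBonds D m := by
  rw [mem_boxBonds, mem_boxBonds, sliceBond, slicePt_add_unitVec_succAbove, slicePt_mem_box,
    slicePt_mem_box]
  tauto

/-- Bonds inside parallel slices are distinct bonds of the full box; those normal to the slices are
dropped. -/
theorem sum_slices_boxBonds_le (i : Fin (D + 1)) {F : Bond (D + 1) → ℝ} (hF : ∀ b, 0 ≤ F b) :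
    ∑ k ∈ Finset.Icc (-(m : ℤ)) m, ∑ b ∈ boxBonds D m, F (sliceBond i k b)
      ≤ ∑ b ∈ boxBonds (D + 1) m, F b := by
  rw [← Finset.sum_product']
  rw [← Finset.sum_image (g := fun p : ℤ × Bond D => sliceBond i p.1 p.2) (f := F)]
  · refine Finset.sum_le_sum_of_subset_of_nonneg ?_ fun b _ _ => hF b
    intro b hb
    obtain ⟨p, hp, rfl⟩ := Finset.mem_image.1 hb
    exact sliceBond_mem_boxBonds.2 (Finset.mem_product.1 hp)
  · rintro ⟨k, y, l⟩ _ ⟨k', y', l'⟩ _ h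
    simp only [sliceBond, Prod.mk.injEq, slicePt_inj, Fin.succAbove_right_inj] at h
    simp only [Prod.mk.injEq]
    tauto

theorem grad_sliceBond (w : Vertex (D + 1) → ℝ) (i : Fin (D + 1)) (k : ℤ) (b : Bond D) :
    grad w (sliceBond i k b) = grad (fun y => w (slicePt i k y)) b := by
  simp only [grad, Bond.upper, Bond.lower, sliceBond, slicePt_add_unitVec_succAbove]

/-- The complementary family: the bonds joining the slice at `k` to that at `k + 1`, whence `k < m`.
-/
theorem sum_normal_bonds_le (i : Fin (D + 1)) {F : Bond (D + 1) → ℝ} (hF : ∀ b, 0 ≤ F b) :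
    ∑ k ∈ Finset.Ico (-(m : ℤ)) m, ∑ y ∈ box D m, F (slicePt i k y, i)
      ≤ ∑ b ∈ boxBonds (D + 1) m, F b := by
  rw [← Finset.sum_product']
  rw [← Finset.sum_image (g := fun p : ℤ × Vertex D => ((slicePt i p.1 p.2, i) : Bond (D + 1)))
    (f := F)]
  · refine Finset.sum_le_sum_of_subset_of_nonneg ?_ fun b _ _ => hF b
    intro b hb
    obtain ⟨p, hp, rfl⟩ := Finset.mem_image.1 hb
    obtain ⟨h1, h2⟩ := Finset.mem_product.1 hp
    rw [Finset.mem_Ico] at h1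
    rw [mem_boxBonds, slicePt_add_unitVec_same, slicePt_mem_box, slicePt_mem_box, Finset.mem_Icc,
      Finset.mem_Icc]
    exact ⟨⟨⟨h1.1, h1.2.le⟩, h2⟩, ⟨by omega, h1.2⟩, h2⟩
  · rintro ⟨k, y⟩ _ ⟨k', y'⟩ _ h
    simp only [Prod.mk.injEq, slicePt_inj] at h
    simp only [Prod.mk.injEq]
    tauto

/-- In direction `i` the gradient of the cutoff lives on two layers of normal bonds for each `j` in
`G`, from `j` to `j + 1` and from `-j-1` to `-j`, and has size at most `1/|G|` there. -/
theorem sum_mul_sq_grad_cutoff_le {G : Finset ℕ} {F : Bond (D + 1) → ℝ} (hF : ∀ b, 0 ≤ F b) :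
    ∑ b ∈ boxBonds (D + 1) m, F b * grad (cutoff G) b ^ 2
      ≤ ((G.card : ℝ)⁻¹) ^ 2 * ∑ i, ∑ j ∈ G, (∑ y ∈ box D m, F (slicePt i j y, i)
        + ∑ y ∈ box D m, F (slicePt i (-(j : ℤ) - 1) y, i)) := by
  set κ := ((G.card : ℝ)⁻¹) ^ 2
  have hκ : 0 ≤ κ := sq_nonneg _
  rw [sum_boxBonds, Finset.sum_comm, Finset.mul_sum]
  refine Finset.sum_le_sum fun i _ => ?_
  set f : ℤ → ℝ := fun k => ∑ y ∈ box D m, F (slicePt i k y, i) with hf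
  have hf0 : ∀ k, 0 ≤ f k := fun k => Finset.sum_nonneg fun y _ => hF _
  calc _ ≤ ∑ k ∈ Finset.Icc (-(m : ℤ)) m, if edgeRadius k ∈ G then κ * f k else 0 := by
        rw [sum_box_slices i]
        refine Finset.sum_le_sum fun k _ => ?_
        calc _ ≤ ∑ y ∈ box D m, if edgeRadius k ∈ G then κ * F (slicePt i k y, i) else 0 := by
              refine Finset.sum_le_sum fun y _ => ?_
              have h := sq_grad_cutoff_le G (slicePt i k y) i
              rw [slicePt_same] at h
              have h' := mul_le_mul_of_nonneg_left h (hF (slicePt i k y, i))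
              have h0 : 0 ≤ F (slicePt i k y, i) * grad (cutoff G) (slicePt i k y, i) ^ 2 :=
                mul_nonneg (hF _) (sq_nonneg _)
              split_ifs at * with h2 h3 h3
              · linarith
              · linarith
              · exact mul_nonneg hκ (hF _)
              · exact le_rfl
          _ = _ := by
              split_ifs
              · rw [hf, Finset.mul_sum]
              · simp
    _ ≤ ∑ k ∈ Finset.Icc (-(m : ℤ)) m, ∑ j ∈ G,
          ((if k = (j : ℤ) then κ * f k else 0) + (if k = -(j : ℤ) - 1 then κ * f k else 0)) := by
        refine Finset.sum_le_sum fun k _ => ?_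
        have hnn : ∀ j ∈ G, 0 ≤ (if k = (j : ℤ) then κ * f k else 0)
            + (if k = -(j : ℤ) - 1 then κ * f k else 0) := fun j _ => by
          have := mul_nonneg hκ (hf0 k)
          split_ifs <;> linarith
        split_ifs with h
        · refine le_trans ?_ (Finset.single_le_sum hnn h)
          have hpos := mul_nonneg hκ (hf0 k)
          unfold edgeRadius
          by_cases hk : 0 ≤ k
          · have : k = (k.natAbs : ℤ) := by omega
            rw [if_pos hk, if_pos this]
            split_ifs <;> linarith
          · have h2 : k = -((k + 1).natAbs : ℤ) - 1 := by omega
            rw [if_neg hk, if_pos h2]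
            split_ifs <;> linarith
        · exact Finset.sum_nonneg hnn
    _ ≤ κ * ∑ j ∈ G, (f j + f (-(j : ℤ) - 1)) := by
        rw [Finset.sum_comm, Finset.mul_sum]
        refine Finset.sum_le_sum fun j _ => ?_
        rw [Finset.sum_add_distrib, Finset.sum_ite_eq', Finset.sum_ite_eq', mul_add]
        have h1 := mul_nonneg hκ (hf0 j)
        have h2 := mul_nonneg hκ (hf0 (-(j : ℤ) - 1))
        split_ifs <;> linarith

/-- Each of the four index maps is injective with values in `[-m, m]`; `j < m` is what keeps `j + 1`
and `-j-1` inside. -/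
theorem sum_adjacent_slices_le {n : ℕ} {g : ℤ → ℝ} (hg : ∀ k, 0 ≤ g k) :
    ∑ j ∈ Finset.Ico n m, (g j + g (j + 1) + g (-(j : ℤ)) + g (-(j : ℤ) - 1))
      ≤ 4 * ∑ k ∈ Finset.Icc (-(m : ℤ)) m, g k := by
  have key : ∀ e : ℕ → ℤ, Function.Injective e → (∀ j ∈ Finset.Ico n m,
      e j ∈ Finset.Icc (-(m : ℤ)) m) →
      ∑ j ∈ Finset.Ico n m, g (e j) ≤ ∑ k ∈ Finset.Icc (-(m : ℤ)) m, g k := fun e he hm => by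
    rw [← Finset.sum_image (f := g) (g := e) he.injOn]
    refine Finset.sum_le_sum_of_subset_of_nonneg ?_ fun k _ _ => hg k
    intro k hk
    obtain ⟨j, hj, rfl⟩ := Finset.mem_image.1 hk
    exact hm j hj
  have h1 := key (fun j => (j : ℤ)) (fun a b h => by simpa using h)
    (fun j hj => by simp only [Finset.mem_Ico, Finset.mem_Icc] at *; omega)
  have h2 := key (fun j => (j : ℤ) + 1) (fun a b h => by simpa using h)
    (fun j hj => by simp only [Finset.mem_Ico, Finset.mem_Icc] at *; omega)
  have h3 := key (fun j => -(j : ℤ)) (fun a b h => by simpa using h)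
    (fun j hj => by simp only [Finset.mem_Ico, Finset.mem_Icc] at *; omega)
  have h4 := key (fun j => -(j : ℤ) - 1) (fun a b h => by simpa using h)
    (fun j hj => by simp only [Finset.mem_Ico, Finset.mem_Icc] at *; omega)
  simp only [Finset.sum_add_distrib]
  linarith

/-- Among the radii in `[n, m)`, at least half are good for finitely many nonnegative functions. -/
theorem exists_good_radii {κ : Type*} [Fintype κ] {n : ℕ} (T : κ → ℕ → ℝ) (S : κ → ℝ)
    (hT : ∀ k j, 0 ≤ T k j) (hS : ∀ k, ∑ j ∈ Finset.Ico n m, T k j ≤ S k) :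
    ∃ G ⊆ Finset.Ico n m, ((m - n : ℕ) : ℝ) ≤ 2 * G.card ∧
      ∀ j ∈ G, ∀ k, T k j * ((m - n : ℕ) : ℝ) ≤ 2 * Fintype.card κ * S k := by
  classical
  set L : ℝ := ((m - n : ℕ) : ℝ) with hL
  set K : ℝ := (Fintype.card κ : ℝ) with hK
  set bad : κ → Finset ℕ := fun k => (Finset.Ico n m).filter fun j => 2 * K * S k < T k j * L
    with hbad
  have hL0 : 0 ≤ L := Nat.cast_nonneg _
  -- Markov's inequality: each function spoils at most a fraction `1/(2K)` of the radii, so all `K`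
  -- together spoil at most half.
  have hcard : ∀ k, 2 * K * ((bad k).card : ℝ) ≤ L := fun k => by
    have hS0 : 0 ≤ S k := (Finset.sum_nonneg fun j _ => hT k j).trans (hS k)
    have h1 : ((bad k).card : ℝ) * (2 * K * S k) ≤ L * S k := by
      calc ((bad k).card : ℝ) * (2 * K * S k) = ∑ j ∈ bad k, 2 * K * S k := by simp
        _ ≤ ∑ j ∈ bad k, T k j * L :=
            Finset.sum_le_sum fun j hj => (Finset.mem_filter.1 hj).2.le
        _ ≤ ∑ j ∈ Finset.Ico n m, T k j * L :=
            Finset.sum_le_sum_of_subset_of_nonneg (Finset.filter_subset _ _)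
              fun j _ _ => mul_nonneg (hT k j) hL0
        _ ≤ L * S k := by
            rw [← Finset.sum_mul, mul_comm]
            exact mul_le_mul_of_nonneg_left (hS k) hL0
    -- When `S k = 0` one cannot divide, but then `T k` vanishes at every radius and none is bad.
    rcases hS0.eq_or_lt with h0 | h0
    · have : bad k = ∅ := by
        refine Finset.filter_false_of_mem fun j hj => ?_
        have h2 := Finset.single_le_sum (f := fun j => T k j) (fun j _ => hT k j) hj
        have h3 : T k j = 0 := le_antisymm (by linarith [hS k]) (hT k j)
        rw [h3, ← h0]; simp
      rw [this]; simpa using hL0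
    · nlinarith
  refine ⟨(Finset.Ico n m) \ Finset.univ.biUnion bad, Finset.sdiff_subset, ?_, ?_⟩
  · have h1 : ((Finset.univ.biUnion bad).card : ℝ) ≤ ∑ k, ((bad k).card : ℝ) := by
      exact_mod_cast Finset.card_biUnion_le
    have h2 : 2 * ∑ k, ((bad k).card : ℝ) ≤ L := by
      rcases isEmpty_or_nonempty κ with h | h
      · simpa using hL0
      · have hK0 : 0 < K := by rw [hK]; exact_mod_cast Fintype.card_pos
        have h3 := Finset.sum_le_sum fun k (_ : k ∈ Finset.univ) => hcard k
        rw [← Finset.mul_sum, Finset.sum_const, nsmul_eq_mul, Finset.card_univ, ← hK] at h3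
        nlinarith
    have h3 : L ≤ (((Finset.Ico n m) \ Finset.univ.biUnion bad).card : ℝ)
        + ((Finset.univ.biUnion bad).card : ℝ) := by
      rw [hL, ← Nat.card_Ico]
      have := Finset.le_card_sdiff (Finset.univ.biUnion bad) (Finset.Ico n m)
      have : (Finset.Ico n m).card ≤ ((Finset.Ico n m) \ Finset.univ.biUnion bad).card
        + (Finset.univ.biUnion bad).card := by omega
      exact_mod_cast this
    linarith
  · intro j hj k
    rw [Finset.mem_sdiff, Finset.mem_biUnion] at hj
    by_contra h
    exact hj.2 ⟨k, Finset.mem_univ _, Finset.mem_filter.2 ⟨hj.1, not_le.1 h⟩⟩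

end Slices

/-! ### The optimised cutoff -/

/-- Counts the powers of the loss `y` incurred by passing to a good slice: `e` from the weight, `b +
c = 1` from the density and the energy together, and `c/q` from `ω^(-q)`. -/
theorem scaling_identity {y P A l E N b c e q : ℝ} (hy : 0 < y) (hP : 0 ≤ P) (hA : 0 ≤ A)
    (hl : 0 < l) (hE : 0 ≤ E) (hN : 0 < N) (hq : 0 < q) (hbc : b + c = 1) :
    (y * P) ^ e * (y * A) ^ b * (N ^ 2 * ((y * l ^ q) ^ (1 / q) * (y * E))) ^ c
      = y ^ (1 + e + c / q) * (P ^ e * A ^ b * (N ^ 2 * (l * E)) ^ c) := by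
  have h1 : (y * l ^ q) ^ (1 / q) = y ^ (1 / q) * l := by
    rw [Real.mul_rpow hy.le (by positivity), ← Real.rpow_mul hl.le, mul_one_div_cancel hq.ne',
      Real.rpow_one]
  have h2 : N ^ 2 * ((y * l ^ q) ^ (1 / q) * (y * E))
      = (y ^ (1 / q) * y) * (N ^ 2 * (l * E)) := by rw [h1]; ring
  have h3 : (y ^ (1 / q) * y) ^ c = y ^ (c / q) * y ^ c := by
    rw [Real.mul_rpow (by positivity) hy.le, ← Real.rpow_mul hy.le]; congr 2; ring
  have h4 : y ^ (1 + e + c / q) = y ^ e * y ^ b * (y ^ (c / q) * y ^ c) := by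
    rw [← Real.rpow_add hy, ← Real.rpow_add hy, ← Real.rpow_add hy]; congr 1; linarith
  rw [h2, Real.mul_rpow hy.le hP, Real.mul_rpow hy.le hA, Real.mul_rpow (by positivity)
    (by positivity), h3, h4]
  ring

theorem continuousOn_energySum {D : ℕ} {ω : Bond D → ℝ} {l : ℝ} {m : ℕ} {I : Set ℝ}
    {w : ℝ → Vertex D → ℝ} (hw : ∀ x ∈ box D m, ContinuousOn (fun t => w t x) I) :
    ContinuousOn (fun t => energySum ω l m (w t)) I := by
  refine ContinuousOn.add (continuousOn_finsetSum _ fun b hb => ?_)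
    (continuousOn_const.mul (continuousOn_finsetSum _ fun x hx => (hw x hx).pow 2))
  rw [mem_boxBonds] at hb
  exact continuousOn_const.mul (((hw _ hb.2).sub (hw _ hb.1)).pow 2)

/-- The coefficient of the zeroth-order term depends only on `m` and `l`, not on the dimension, so
it is the same on slices as on the full box. -/
theorem sum_slices_energySum_le {D : ℕ} {ω : Bond (D + 1) → ℝ} (hω : ∀ b, 0 < ω b) (l : ℝ)
    (m : ℕ) (w : Vertex (D + 1) → ℝ) (i : Fin (D + 1)) :
    ∑ k ∈ Finset.Icc (-(m : ℤ)) m,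
        energySum (fun b => ω (sliceBond i k b)) l m (fun y => w (slicePt i k y))
      ≤ energySum ω l m w := by
  unfold energySum
  rw [Finset.sum_add_distrib, ← Finset.mul_sum, ← sum_box_slices i (fun x => w x ^ 2)]
  refine add_le_add_left (le_trans (le_of_eq ?_) (sum_slices_boxBonds_le (m := m) i
    (F := fun b => ω b * grad w b ^ 2) fun b => mul_nonneg (hω b).le (sq_nonneg _))) _
  refine Finset.sum_congr rfl fun k _ => Finset.sum_congr rfl fun b _ => ?_
  rw [grad_sliceBond]

set_option maxHeartbeats 2000000 in
/-- The optimised cutoff function: on well chosen slices the one dimension lower Sobolev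
inequality controls the energy of the cutoff. -/
theorem exists_cutoff_integral_le {D : ℕ} {p q σ b c : ℝ} (hσ : IsSobolevExponent D q σ)
    (hp : 1 < p) (hq : 1 < q) (hb : 0 ≤ b) (hc : 0 < c) (hbc : b + c = 1)
    (hsum : 1 / p + b + σ * c ≤ 1) :
    ∃ C : ℝ, 1 ≤ C ∧ ∀ (ω : Bond (D + 1) → ℝ) (n m : ℕ) (s l : ℝ)
      (A v w : ℝ → Vertex (D + 1) → ℝ), (∀ b, 0 < ω b) → n < m → 0 < l →
      ∑ b ∈ boxBonds (D + 1) m, (ω b)⁻¹ ^ q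
        ≤ ((D : ℝ) + 1) * ((2 * (m : ℝ) + 1) ^ (D + 1) * l ^ q) →
      (∀ t ∈ Set.Icc (-s) 0, ∀ x ∈ box (D + 1) m, 0 ≤ A t x) →
      (∀ x ∈ box (D + 1) m, ContinuousOn (fun t => A t x) (Set.Icc (-s) 0)) →
      (∀ x ∈ box (D + 1) m, ContinuousOn (fun t => v t x) (Set.Icc (-s) 0)) →
      (∀ x ∈ box (D + 1) m, ContinuousOn (fun t => w t x) (Set.Icc (-s) 0)) →
      (∀ t ∈ Set.Icc (-s) 0, ∀ x ∈ box (D + 1) m, v t x ^ 2 = A t x ^ b * (w t x ^ 2) ^ c) →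
      ∃ G ⊆ Finset.Ico n m, G.Nonempty ∧
        ∫ t in Set.Icc (-s) 0, ∑ b ∈ boxBonds (D + 1) m, ω b * (grad (cutoff G) b ^ 2
            * (v t b.1 ^ 2 + v t (b.1 + unitVec b.2) ^ 2))
          ≤ C * ((2 * (m : ℝ) + 1) ^ (D + 1) / (2 * (m : ℝ) + 1) ^ 2
            * ((1 - (n : ℝ) / m) ^ (2 + 1 / p + c / q))⁻¹
            * (((∑ b ∈ boxBonds (D + 1) m, ω b ^ p) / (2 * (m : ℝ) + 1) ^ (D + 1)) ^ (1 / p)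
            * ((∫ t in Set.Icc (-s) 0, ∑ x ∈ box (D + 1) m, A t x)
                / (2 * (m : ℝ) + 1) ^ (D + 1)) ^ b
            * ((2 * (m : ℝ) + 1) ^ 2 * (l * ((∫ t in Set.Icc (-s) 0, energySum ω l m (w t))
                / (2 * (m : ℝ) + 1) ^ (D + 1)))) ^ c)) := by
  obtain ⟨C, hC, H⟩ := exists_integral_mean_rpow_le_of_sobolev hσ hq
  set d : ℝ := (D : ℝ) + 1 with hd
  have hd1 : 1 ≤ d := by rw [hd]; linarith [(Nat.cast_nonneg D : (0 : ℝ) ≤ D)]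
  -- A good slice loses `96 d / x`, where `96 = 2 · 4 · 4 · 3`: Markov with four quantities, four
  -- slices for each radius, and `N x ≤ 3 L`. The hypothesis on `ω^(-q)` costs another `d`, and the
  -- term `l^q` in `invSum` adds `1`.
  set C₀ : ℝ := 96 * d ^ 2 + 1 with hC₀
  have hC₀1 : 1 ≤ C₀ := by rw [hC₀]; nlinarith
  have hdC₀ : 96 * d ≤ C₀ := by rw [hC₀]; nlinarith
  have hp0 : 0 < p := by linarith
  have hq0 : 0 < q := by linarith
  have hexp0 : 0 ≤ 1 + 1 / p + c / q := by positivity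
  refine ⟨24 * d * C * C₀ ^ (1 + 1 / p + c / q), ?_, ?_⟩
  · have h1 := Real.one_le_rpow hC₀1 hexp0
    have h2 : 1 ≤ 24 * d * C := by nlinarith
    nlinarith
  intro ω n m s l A v w hω hnm hl hQ hA hAc hvc hwc hv
  set I := Set.Icc (-s) (0 : ℝ)
  set N : ℝ := 2 * (m : ℝ) + 1 with hN
  have hm0 : (0 : ℝ) < m := by exact_mod_cast (Nat.zero_le n).trans_lt hnm
  have hm1 : (1 : ℝ) ≤ m := by exact_mod_cast (Nat.zero_le n).trans_lt hnm
  have hN0 : 0 < N := by positivity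
  set x : ℝ := 1 - (n : ℝ) / m with hx
  have hx0 : 0 < x := by
    rw [hx, sub_pos, div_lt_one hm0]; exact_mod_cast hnm
  have hx1 : x ≤ 1 := by
    have : 0 ≤ (n : ℝ) / m := by positivity
    rw [hx]; linarith
  set L : ℝ := ((m - n : ℕ) : ℝ) with hL
  have hLx : L = m * x := by rw [hL, Nat.cast_sub hnm.le, hx]; field_simp
  have hL0 : 0 < L := by rw [hLx]; positivity
  have hNL : N * x ≤ 3 * L := by rw [hLx, hN]; nlinarith
  set M : ℝ := N ^ D with hM
  have hM0 : 0 < M := by positivity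
  have hMN : N ^ (D + 1) = M * N := pow_succ _ _
  set P := ∑ b ∈ boxBonds (D + 1) m, ω b ^ p with hP
  set Q := ∑ b ∈ boxBonds (D + 1) m, (ω b)⁻¹ ^ q with hQdef
  set EE := ∫ t in I, energySum ω l m (w t) with hEE
  set AA := ∫ t in I, ∑ x ∈ box (D + 1) m, A t x with hAA
  have hP0 : 0 ≤ P := Finset.sum_nonneg fun b _ => Real.rpow_nonneg (hω b).le _
  have hEE0 : 0 ≤ EE := integral_nonneg fun t => energySum_nonneg hω hl m _
  have hAA0 : 0 ≤ AA :=
    setIntegral_nonneg measurableSet_Icc fun t ht => Finset.sum_nonneg (hA t ht)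
  have hpt : ∀ {i : Fin (D + 1)} {k : ℤ} {y : Vertex D}, k ∈ Finset.Icc (-(m : ℤ)) m →
      y ∈ box D m → slicePt i k y ∈ box (D + 1) m := fun hk hy => slicePt_mem_box.2 ⟨hk, hy⟩
  have hEc : ∀ i : Fin (D + 1), ∀ k ∈ Finset.Icc (-(m : ℤ)) m, ContinuousOn (fun t =>
      energySum (fun b => ω (sliceBond i k b)) l m (fun y => w t (slicePt i k y))) I :=
    fun i k hk => continuousOn_energySum (w := fun t y => w t (slicePt i k y))
      fun y hy => hwc _ (hpt hk hy)
  -- the four families of slice quantities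
  set g₀ : Fin (D + 1) → ℤ → ℝ := fun i k => if k ∈ Finset.Ico (-(m : ℤ)) m then
    ∑ y ∈ box D m, ω (slicePt i k y, i) ^ p else 0 with hg₀
  set g₁ : Fin (D + 1) → ℤ → ℝ := fun i k =>
    ∑ b ∈ boxBonds D m, (ω (sliceBond i k b))⁻¹ ^ q with hg₁
  set g₂ : Fin (D + 1) → ℤ → ℝ := fun i k => ∫ t in I,
    energySum (fun b => ω (sliceBond i k b)) l m (fun y => w t (slicePt i k y)) with hg₂
  set g₃ : Fin (D + 1) → ℤ → ℝ := fun i k => if k ∈ Finset.Icc (-(m : ℤ)) m then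
    ∫ t in I, ∑ y ∈ box D m, A t (slicePt i k y) else 0 with hg₃
  have hg₀0 : ∀ i k, 0 ≤ g₀ i k := fun i k => by
    simp only [hg₀]; split_ifs
    · exact Finset.sum_nonneg fun y _ => Real.rpow_nonneg (hω _).le _
    · exact le_rfl
  have hg₁0 : ∀ i k, 0 ≤ g₁ i k := fun i k =>
    Finset.sum_nonneg fun b _ => Real.rpow_nonneg (inv_nonneg.2 (hω _).le) _
  have hg₂0 : ∀ i k, 0 ≤ g₂ i k := fun i k =>
    integral_nonneg fun t => energySum_nonneg (fun b => hω _) hl m _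
  have hg₃0 : ∀ i k, 0 ≤ g₃ i k := fun i k => by
    simp only [hg₃]; split_ifs with hk
    · exact setIntegral_nonneg measurableSet_Icc fun t ht =>
        Finset.sum_nonneg fun y hy => hA t ht _ (hpt hk hy)
    · exact le_rfl
  have hs₀ : ∀ i, ∑ k ∈ Finset.Icc (-(m : ℤ)) m, g₀ i k ≤ P := fun i => by
    simp only [hg₀]
    rw [← Finset.sum_filter]
    refine le_trans (le_of_eq (Finset.sum_congr ?_ fun _ _ => rfl)) (sum_normal_bonds_le i
      (F := fun b => ω b ^ p) fun b => Real.rpow_nonneg (hω b).le _)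
    ext k
    simp only [Finset.mem_filter, Finset.mem_Icc, Finset.mem_Ico]
    omega
  have hs₁ : ∀ i, ∑ k ∈ Finset.Icc (-(m : ℤ)) m, g₁ i k ≤ Q := fun i =>
    sum_slices_boxBonds_le i (F := fun b => (ω b)⁻¹ ^ q)
      fun b => Real.rpow_nonneg (inv_nonneg.2 (hω _).le) _
  have hs₂ : ∀ i, ∑ k ∈ Finset.Icc (-(m : ℤ)) m, g₂ i k ≤ EE := fun i => by
    simp only [hg₂]
    rw [← integral_finsetSum _ fun k hk => (hEc i k hk).integrableOn_Icc]
    refine setIntegral_mono_on ?_ (continuousOn_energySum hwc).integrableOn_Icc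
      measurableSet_Icc fun t _ => sum_slices_energySum_le hω l m (w t) i
    exact (continuousOn_finsetSum _ fun k hk => hEc i k hk).integrableOn_Icc
  have hs₃ : ∀ i, ∑ k ∈ Finset.Icc (-(m : ℤ)) m, g₃ i k ≤ AA := fun i => by
    have : ∑ k ∈ Finset.Icc (-(m : ℤ)) m, g₃ i k = ∑ k ∈ Finset.Icc (-(m : ℤ)) m,
        ∫ t in I, ∑ y ∈ box D m, A t (slicePt i k y) :=
      Finset.sum_congr rfl fun k hk => if_pos hk
    rw [this, ← integral_finsetSum _ fun k hk => ContinuousOn.integrableOn_Icc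
      (continuousOn_finsetSum _ fun y hy => hAc _ (hpt hk hy))]
    simp only [← sum_box_slices]
    exact le_rfl
  -- All directions and all four adjacent slices are summed, so a radius is good for all of them at
  -- once. Both ends of each crossed layer are needed because `v` is evaluated at both endpoints of
  -- a bond.
  set T : Fin 4 → ℕ → ℝ := fun r j => ∑ i, ((![g₀, g₁, g₂, g₃] r) i j
    + (![g₀, g₁, g₂, g₃] r) i (j + 1) + (![g₀, g₁, g₂, g₃] r) i (-(j : ℤ))
    + (![g₀, g₁, g₂, g₃] r) i (-(j : ℤ) - 1)) with hT
  have hgen0 : ∀ r i k, 0 ≤ (![g₀, g₁, g₂, g₃] r) i k := by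
    intro r i k
    fin_cases r
    · exact hg₀0 i k
    · exact hg₁0 i k
    · exact hg₂0 i k
    · exact hg₃0 i k
  have hgens : ∀ r i, ∑ k ∈ Finset.Icc (-(m : ℤ)) m, (![g₀, g₁, g₂, g₃] r) i k
      ≤ (![P, Q, EE, AA] r) := by
    intro r i
    fin_cases r
    · exact hs₀ i
    · exact hs₁ i
    · exact hs₂ i
    · exact hs₃ i
  obtain ⟨G, hGsub, hGcard, hG⟩ := exists_good_radii (n := n) (m := m) T
    (fun r => 4 * d * (![P, Q, EE, AA] r))
    (fun r j => Finset.sum_nonneg fun i _ => by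
      have h1 := hgen0 r i j
      have h2 := hgen0 r i (j + 1)
      have h3 := hgen0 r i (-(j : ℤ))
      have h4 := hgen0 r i (-(j : ℤ) - 1)
      linarith)
    (fun r => by
      simp only [hT]
      rw [Finset.sum_comm]
      calc _ ≤ ∑ i : Fin (D + 1), 4 * (![P, Q, EE, AA] r) := Finset.sum_le_sum fun i _ =>
            (sum_adjacent_slices_le (hgen0 r i)).trans
              (mul_le_mul_of_nonneg_left (hgens r i) (by norm_num))
        _ = _ := by
            rw [Finset.sum_const, Finset.card_univ, Fintype.card_fin, nsmul_eq_mul, hd]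
            push_cast; ring)
  have hGpos : 0 < (G.card : ℝ) := by
    have := hL0.trans_le hGcard; linarith
  have hGne : G.Nonempty := Finset.card_pos.1 (by exact_mod_cast hGpos)
  refine ⟨G, hGsub, hGne, ?_⟩
  -- slice quantities at good radii
  have good : ∀ r, ∀ j ∈ G, ∀ i, ∀ k : ℤ, (k = j ∨ k = j + 1 ∨ k = -(j : ℤ) ∨ k = -(j : ℤ) - 1) →
      (![g₀, g₁, g₂, g₃] r) i k / M ≤ C₀ / x * ((![P, Q, EE, AA] r) / (M * N)) ∧
      (![g₀, g₁, g₂, g₃] r) i k / M ≤ 96 * d / x * ((![P, Q, EE, AA] r) / (M * N)) := by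
    intro r j hj i k hk
    have h1 : (![g₀, g₁, g₂, g₃] r) i k ≤ T r j := by
      have h := Finset.single_le_sum (f := fun i => (![g₀, g₁, g₂, g₃] r) i j
        + (![g₀, g₁, g₂, g₃] r) i (j + 1) + (![g₀, g₁, g₂, g₃] r) i (-(j : ℤ))
        + (![g₀, g₁, g₂, g₃] r) i (-(j : ℤ) - 1)) (fun i _ => by
          have h1 := hgen0 r i j
          have h2 := hgen0 r i (j + 1)
          have h3 := hgen0 r i (-(j : ℤ))
          have h4 := hgen0 r i (-(j : ℤ) - 1)
          linarith) (Finset.mem_univ i)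
      refine le_trans ?_ h
      have h1 := hgen0 r i j
      have h2 := hgen0 r i (j + 1)
      have h3 := hgen0 r i (-(j : ℤ))
      have h4 := hgen0 r i (-(j : ℤ) - 1)
      rcases hk with rfl | rfl | rfl | rfl <;> linarith
    have h2 := hG j hj r
    rw [Fintype.card_fin] at h2
    push_cast at h2
    have hS0 : 0 ≤ (![P, Q, EE, AA] r) := le_trans
      (Finset.sum_nonneg fun k _ => hgen0 r i k) (hgens r i)
    have h3 : (![g₀, g₁, g₂, g₃] r) i k * (N * x) ≤ 96 * d * (![P, Q, EE, AA] r) := by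
      have h4 := mul_le_mul_of_nonneg_left hNL (hgen0 r i k)
      have h5 := mul_le_mul_of_nonneg_right h1 hL0.le
      linarith
    have h6 : (![g₀, g₁, g₂, g₃] r) i k / M ≤ 96 * d / x * ((![P, Q, EE, AA] r) / (M * N)) := by
      rw [div_mul_div_comm, div_le_div_iff₀ hM0 (by positivity)]
      have := mul_le_mul_of_nonneg_right h3 hM0.le
      linarith
    exact ⟨h6.trans (by gcongr), h6⟩
  have hy0 : 0 < C₀ / x := by positivity
  set y := C₀ / x with hy
  set P' := P / (M * N) with hP'
  set A' := AA / (M * N) with hA'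
  set E' := EE / (M * N) with hE'
  have hP'0 : 0 ≤ P' := by positivity
  have hA'0 : 0 ≤ A' := by positivity
  have hE'0 : 0 ≤ E' := by positivity
  set B := C * (y ^ (1 + 1 / p + c / q) * (P' ^ (1 / p) * A' ^ b * (N ^ 2 * (l * E')) ^ c)) with hB
  have hB0 : 0 ≤ B := by positivity
  have term : ∀ j ∈ G, ∀ i, ∀ k k' : ℤ, (k = j ∨ k = -(j : ℤ) - 1) →
      (k' = j ∨ k' = j + 1 ∨ k' = -(j : ℤ) ∨ k' = -(j : ℤ) - 1) →
      ∫ t in I, ∑ z ∈ box D m, ω (slicePt i k z, i) * v t (slicePt i k' z) ^ 2 ≤ M * B := by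
    intro j hj i k k' hk hk'
    have hjm := Finset.mem_Ico.1 (hGsub hj)
    have hkIco : k ∈ Finset.Ico (-(m : ℤ)) m := by rw [Finset.mem_Ico]; omega
    have hk'Icc : k' ∈ Finset.Icc (-(m : ℤ)) m := by rw [Finset.mem_Icc]; omega
    have q0 := (good 0 j hj i k (by tauto)).1
    -- The sharper bound is used here to leave room in `C₀` for the factor `d` and for the term
    -- `l^q`.
    have q1 := (good 1 j hj i k' hk').2
    have q2 := (good 2 j hj i k' hk').1
    have q3 := (good 3 j hj i k' hk').1
    have E0 : (![g₀, g₁, g₂, g₃] 0) = g₀ := rfl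
    have E1 : (![g₀, g₁, g₂, g₃] 1) = g₁ := rfl
    have E2 : (![g₀, g₁, g₂, g₃] 2) = g₂ := rfl
    have E3 : (![g₀, g₁, g₂, g₃] 3) = g₃ := rfl
    have F0 : (![P, Q, EE, AA] 0) = P := rfl
    have F1 : (![P, Q, EE, AA] 1) = Q := rfl
    have F2 : (![P, Q, EE, AA] 2) = EE := rfl
    have F3 : (![P, Q, EE, AA] 3) = AA := rfl
    rw [E0, F0] at q0
    rw [E1, F1] at q1
    rw [E2, F2] at q2
    rw [E3, F3] at q3
    simp only [hg₀, if_pos hkIco] at q0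
    simp only [hg₃, if_pos hk'Icc] at q3
    have hZ : invSum (fun b => ω (sliceBond i k' b)) q l m / M ≤ y * l ^ q := by
      have hlq : 0 < l ^ q := Real.rpow_pos_of_pos hl _
      have hQ' : Q / (M * N) ≤ d * l ^ q := by
        rw [div_le_iff₀ (by positivity), ← hMN]; linarith
      have h1 : (∑ b ∈ boxBonds D m, (ω (sliceBond i k' b))⁻¹ ^ q) / M
          ≤ 96 * d / x * (d * l ^ q) := q1.trans (by gcongr)
      have h2 : ((box D m).card : ℝ) = M := by rw [card_box]; push_cast; rfl
      rw [invSum, h2, add_div, mul_div_cancel_left₀ _ hM0.ne']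
      have h3 : l ^ q ≤ l ^ q / x := by rw [le_div_iff₀ hx0]; nlinarith
      calc _ ≤ 96 * d / x * (d * l ^ q) + l ^ q / x := add_le_add h1 h3
        _ = _ := by rw [hy, hC₀]; ring
    -- The weight `a` is `ω^p` on the normal bonds based at slice `k`, while the Sobolev inequality
    -- is used on the possibly different slice `k'` containing the values of `v`.
    have h := H (fun b => ω (sliceBond i k' b)) l m s (fun z => ω (slicePt i k z, i) ^ p)
      (fun t z => A t (slicePt i k' z)) (fun t z => w t (slicePt i k' z)) (1 / p) b c
      (y * P') (y * A') (y * l ^ q) (y * E') (fun b => hω _) hl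
      (fun z _ => Real.rpow_nonneg (hω _).le _) (fun t ht z hz => hA t ht _ (hpt hk'Icc hz))
      (fun z hz => hAc _ (hpt hk'Icc hz)) (fun z hz => hwc _ (hpt hk'Icc hz)) (by positivity)
      hb hc hbc hsum q0 q3 hZ q2
    rw [scaling_identity hy0 hP'0 hA'0 hl hE'0 hN0 hq0 hbc, div_le_iff₀ hM0] at h
    refine le_trans (le_of_eq ?_) (h.trans (le_of_eq (mul_comm _ _)))
    refine setIntegral_congr_fun measurableSet_Icc fun t ht => Finset.sum_congr rfl fun z hz => ?_
    rw [← Real.rpow_mul (hω _).le, mul_one_div_cancel hp0.ne', Real.rpow_one,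
      hv t ht _ (hpt hk'Icc hz), mul_assoc]
  set F : ℝ → Bond (D + 1) → ℝ := fun t b => ω b * (v t b.1 ^ 2 + v t (b.1 + unitVec b.2) ^ 2)
    with hF
  have hF0 : ∀ t b, 0 ≤ F t b := fun t b => mul_nonneg (hω b).le (by positivity)
  have hvs : ∀ (i : Fin (D + 1)) (k k' : ℤ), k' ∈ Finset.Icc (-(m : ℤ)) m →
      ContinuousOn (fun t => ∑ z ∈ box D m, ω (slicePt i k z, i) * v t (slicePt i k' z) ^ 2) I :=
    fun i k k' hk' => continuousOn_finsetSum _ fun z hz =>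
      continuousOn_const.mul ((hvc _ (hpt hk' hz)).pow 2)
  have hFeq : ∀ (i : Fin (D + 1)) (k : ℤ) (t : ℝ), ∑ z ∈ box D m, F t (slicePt i k z, i)
      = ∑ z ∈ box D m, ω (slicePt i k z, i) * v t (slicePt i k z) ^ 2
        + ∑ z ∈ box D m, ω (slicePt i k z, i) * v t (slicePt i (k + 1) z) ^ 2 := fun i k t => by
    simp only [hF, slicePt_add_unitVec_same, mul_add, Finset.sum_add_distrib]
  have hFs : ∀ (i : Fin (D + 1)) (k : ℤ), k ∈ Finset.Ico (-(m : ℤ)) m →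
      IntegrableOn (fun t => ∑ z ∈ box D m, F t (slicePt i k z, i)) I := fun i k hk => by
    simp only [hFeq]
    rw [Finset.mem_Ico] at hk
    exact ((hvs i k k (Finset.mem_Icc.2 ⟨hk.1, hk.2.le⟩)).add
      (hvs i k (k + 1) (Finset.mem_Icc.2 ⟨by omega, hk.2⟩))).integrableOn_Icc
  have hFle : ∀ j ∈ G, ∀ i, ∀ k : ℤ, (k = j ∨ k = -(j : ℤ) - 1) →
      ∫ t in I, ∑ z ∈ box D m, F t (slicePt i k z, i) ≤ 2 * (M * B) := by
    intro j hj i k hk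
    have hjm := Finset.mem_Ico.1 (hGsub hj)
    simp only [hFeq]
    rw [integral_add (hvs i k k (by rw [Finset.mem_Icc]; omega)).integrableOn_Icc
      (hvs i k (k + 1) (by rw [Finset.mem_Icc]; omega)).integrableOn_Icc]
    have h1 := term j hj i k k hk (by tauto)
    have h2 := term j hj i k (k + 1) hk (by
      rcases hk with h | h
      · right; left; rw [h]
      · right; right; left; omega)
    linarith
  have hI1 : ∀ j ∈ G, ∀ i : Fin (D + 1),
      IntegrableOn (fun t => ∑ z ∈ box D m, F t (slicePt i j z, i)) I := fun j hj i => by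
    have hjm := Finset.mem_Ico.1 (hGsub hj)
    exact hFs i _ (by rw [Finset.mem_Ico]; omega)
  have hI2 : ∀ j ∈ G, ∀ i : Fin (D + 1),
      IntegrableOn (fun t => ∑ z ∈ box D m, F t (slicePt i (-(j : ℤ) - 1) z, i)) I :=
    fun j hj i => by
      have hjm := Finset.mem_Ico.1 (hGsub hj)
      exact hFs i _ (by rw [Finset.mem_Ico]; omega)
  have hI12 : ∀ j ∈ G, ∀ i : Fin (D + 1), IntegrableOn (fun t =>
      ∑ z ∈ box D m, F t (slicePt i j z, i)
        + ∑ z ∈ box D m, F t (slicePt i (-(j : ℤ) - 1) z, i)) I :=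
    fun j hj i => Integrable.add (hI1 j hj i) (hI2 j hj i)
  have hintSum : IntegrableOn (fun t => ∑ i, ∑ j ∈ G, (∑ z ∈ box D m, F t (slicePt i j z, i)
        + ∑ z ∈ box D m, F t (slicePt i (-(j : ℤ) - 1) z, i))) I :=
    integrable_finsetSum _ fun i _ => integrable_finsetSum _ fun j hj => hI12 j hj i
  calc ∫ t in I, ∑ b ∈ boxBonds (D + 1) m, ω b * (grad (cutoff G) b ^ 2
            * (v t b.1 ^ 2 + v t (b.1 + unitVec b.2) ^ 2))
      ≤ ∫ t in I, ((G.card : ℝ)⁻¹) ^ 2 * ∑ i, ∑ j ∈ G, (∑ z ∈ box D m, F t (slicePt i j z, i)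
        + ∑ z ∈ box D m, F t (slicePt i (-(j : ℤ) - 1) z, i)) := by
        refine integral_mono_of_nonneg (Filter.Eventually.of_forall fun t =>
          Finset.sum_nonneg fun b _ => mul_nonneg (hω b).le (by positivity))
          (hintSum.const_mul _) (Filter.Eventually.of_forall fun t => ?_)
        refine le_trans (le_of_eq (Finset.sum_congr rfl fun b _ => ?_))
          (sum_mul_sq_grad_cutoff_le (G := G) (m := m) (hF0 t))
        simp only [hF]; ring
    _ = ((G.card : ℝ)⁻¹) ^ 2 * ∑ i, ∑ j ∈ G, ((∫ t in I, ∑ z ∈ box D m, F t (slicePt i j z, i))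
        + ∫ t in I, ∑ z ∈ box D m, F t (slicePt i (-(j : ℤ) - 1) z, i)) := by
        rw [integral_const_mul, integral_finsetSum _ fun i _ => integrable_finsetSum _
          fun j hj => hI12 j hj i]
        congr 1
        refine Finset.sum_congr rfl fun i _ => ?_
        rw [integral_finsetSum _ fun j hj => hI12 j hj i]
        exact Finset.sum_congr rfl fun j hj => integral_add (hI1 j hj i) (hI2 j hj i)
    -- Four comes from two layers times two endpoints. Summing over `G` turns `|G|⁻²` into `|G|⁻¹`.
    _ ≤ ((G.card : ℝ)⁻¹) ^ 2 * ∑ i : Fin (D + 1), ∑ j ∈ G, (4 * (M * B)) := by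
        refine mul_le_mul_of_nonneg_left (Finset.sum_le_sum fun i _ => Finset.sum_le_sum
          fun j hj => ?_) (sq_nonneg _)
        linarith [hFle j hj i j (Or.inl rfl), hFle j hj i (-(j : ℤ) - 1) (Or.inr rfl)]
    _ = (G.card : ℝ)⁻¹ * (4 * d * (M * B)) := by
        simp only [Finset.sum_const, Finset.card_univ, Fintype.card_fin, nsmul_eq_mul]
        rw [hd]; push_cast; field_simp
    -- Since `L ≤ 2 |G|` and `N x ≤ 3 L`; this is the last factor `1/x` in the exponent.
    _ ≤ 6 / (N * x) * (4 * d * (M * B)) := by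
        refine mul_le_mul_of_nonneg_right ?_ (by positivity)
        rw [inv_eq_one_div, div_le_div_iff₀ hGpos (by positivity)]
        linarith
    _ = _ := by
        have e1 : y ^ (1 + 1 / p + c / q) = C₀ ^ (1 + 1 / p + c / q) / x ^ (1 + 1 / p + c / q) := by
          rw [hy, Real.div_rpow (by linarith) hx0.le]
        have e2 : x ^ (2 + 1 / p + c / q) = x * x ^ (1 + 1 / p + c / q) := by
          nth_rewrite 2 [← Real.rpow_one x]
          rw [← Real.rpow_add hx0]; congr 1; ring
        rw [hB, e1, e2, hMN, ← hP', ← hA', ← hE']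
        have := (Real.rpow_pos_of_pos hx0 (1 + 1 / p + c / q)).ne'
        field_simp
        ring

/-! ### Normalised norms and comparison of boxes -/

section Norms

theorem avgNorm_two_sq {ι : Type} (S : Finset ι) (f : ι → ℝ) :
    avgNorm 2 S f ^ 2 = (S.card : ℝ)⁻¹ * ∑ i ∈ S, f i ^ 2 := by
  have h : ∑ i ∈ S, |f i| ^ (2 : ℝ) = ∑ i ∈ S, f i ^ 2 := Finset.sum_congr rfl fun i _ => by
    rw [Real.rpow_two, sq_abs]
  rw [avgNorm, h, ← Real.sqrt_eq_rpow, Real.sq_sqrt]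
  exact mul_nonneg (by positivity) (Finset.sum_nonneg fun i _ => sq_nonneg _)

theorem mean_abs_rpow_nonneg {ι : Type} (r : ℝ) (S : Finset ι) (f : ι → ℝ) :
    0 ≤ (S.card : ℝ)⁻¹ * ∑ i ∈ S, |f i| ^ r :=
  mul_nonneg (by positivity) (Finset.sum_nonneg fun i _ => Real.rpow_nonneg (abs_nonneg _) _)

theorem avgNorm_nonneg {ι : Type} (r : ℝ) (S : Finset ι) (f : ι → ℝ) : 0 ≤ avgNorm r S f :=
  Real.rpow_nonneg (mean_abs_rpow_nonneg r S f) _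

theorem sum_rpow_eq_card_mul_avgNorm {ι : Type} {r : ℝ} (hr : 0 < r) {S : Finset ι}
    (hS : S.Nonempty) {f : ι → ℝ} (hf : ∀ i ∈ S, 0 ≤ f i) :
    ∑ i ∈ S, f i ^ r = S.card * avgNorm r S f ^ r := by
  have hc : (S.card : ℝ) ≠ 0 := by exact_mod_cast hS.card_pos.ne'
  have h : ∑ i ∈ S, |f i| ^ r = ∑ i ∈ S, f i ^ r := Finset.sum_congr rfl fun i hi => by
    rw [abs_of_nonneg (hf i hi)]
  rw [avgNorm, ← Real.rpow_mul (mean_abs_rpow_nonneg r S f), one_div_mul_cancel hr.ne',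
    Real.rpow_one, h, mul_inv_cancel_left₀ hc]

theorem avgNorm_pos {ι : Type} {r : ℝ} {S : Finset ι}
    (hS : S.Nonempty) {f : ι → ℝ} (hf : ∀ i ∈ S, 0 < f i) : 0 < avgNorm r S f := by
  refine Real.rpow_pos_of_pos (mul_pos (by simpa using hS) (Finset.sum_pos (fun i hi => ?_) hS)) _
  exact Real.rpow_pos_of_pos (abs_pos.2 (hf i hi).ne') _

/-- Hölder's inequality for `1 = f^(1/2) f^(-1/2)`. The halves make the exponents `1/(2p)` and
`1/(2q)` add up to less than one for all `p, q > 1`, and the constant function takes the remaining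
weight. -/
theorem inv_avgNorm_inv_le {ι : Type} {p q : ℝ} (hp : 1 < p) (hq : 1 < q) {S : Finset ι}
    (hS : S.Nonempty) {f : ι → ℝ} (hf : ∀ i, 0 < f i) :
    (avgNorm q S fun i => (f i)⁻¹)⁻¹ ≤ avgNorm p S f := by
  have hp0 : 0 < p := by linarith
  have hq0 : 0 < q := by linarith
  have hc : (0 : ℝ) < S.card := by exact_mod_cast hS.card_pos
  have hi : ∀ i, 0 < (f i)⁻¹ := fun i => inv_pos.2 (hf i)
  have hP := avgNorm_pos (r := p) hS fun i _ => hf i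
  have hQ := avgNorm_pos (r := q) hS fun i _ => hi i
  have ip : 1 / p < 1 := by rw [div_lt_one hp0]; exact hp
  have iq : 1 / q < 1 := by rw [div_lt_one hq0]; exact hq
  have ip2 : 1 / (2 * p) = 1 / p / 2 := by rw [div_div, mul_comm]
  have iq2 : 1 / (2 * q) = 1 / q / 2 := by rw [div_div, mul_comm]
  have h := sum_rpow_mul_rpow_mul_rpow_le S (f := fun i => f i ^ p) (g := fun i => (f i)⁻¹ ^ q)
    (h := fun _ => (1 : ℝ)) (a := 1 / (2 * p)) (b := 1 / (2 * q)) (c := 1 - 1 / (2 * p) - 1 / (2 * q))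
    (fun i _ => Real.rpow_nonneg (hf i).le _) (fun i _ => Real.rpow_nonneg (hi i).le _)
    (fun _ _ => zero_le_one) (by positivity) (by positivity) (by rw [ip2, iq2]; linarith) (by ring)
  have e1 : ∑ i ∈ S, (f i ^ p) ^ (1 / (2 * p)) * ((f i)⁻¹ ^ q) ^ (1 / (2 * q))
      * (1 : ℝ) ^ (1 - 1 / (2 * p) - 1 / (2 * q)) = S.card := by
    rw [Finset.card_eq_sum_ones, Nat.cast_sum]
    refine Finset.sum_congr rfl fun i _ => ?_
    rw [Real.one_rpow, mul_one, ← Real.rpow_mul (hf i).le, ← Real.rpow_mul (hi i).le]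
    have h1 : p * (1 / (2 * p)) = 1 / 2 := by field_simp
    have h2 : q * (1 / (2 * q)) = 1 / 2 := by field_simp
    rw [h1, h2, ← Real.mul_rpow (hf i).le (hi i).le, mul_inv_cancel₀ (hf i).ne', Real.one_rpow]
    simp
  rw [e1, sum_rpow_eq_card_mul_avgNorm hp0 hS fun i _ => (hf i).le,
    sum_rpow_eq_card_mul_avgNorm hq0 hS fun i _ => (hi i).le] at h
  set P := avgNorm p S f
  set Q := avgNorm q S fun i => (f i)⁻¹
  simp only [Finset.sum_const, nsmul_eq_mul, mul_one] at h
  have e2 : ((S.card : ℝ) * P ^ p) ^ (1 / (2 * p)) * ((S.card : ℝ) * Q ^ q) ^ (1 / (2 * q))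
      * (S.card : ℝ) ^ (1 - 1 / (2 * p) - 1 / (2 * q)) = S.card * (P * Q) ^ (1 / 2 : ℝ) := by
    rw [Real.mul_rpow hc.le (by positivity), Real.mul_rpow hc.le (by positivity),
      ← Real.rpow_mul hP.le, ← Real.rpow_mul hQ.le, Real.mul_rpow hP.le hQ.le]
    have h1 : p * (1 / (2 * p)) = 1 / 2 := by field_simp
    have h2 : q * (1 / (2 * q)) = 1 / 2 := by field_simp
    rw [h1, h2]
    have : (S.card : ℝ) ^ (1 / (2 * p)) * (S.card : ℝ) ^ (1 / (2 * q))
        * (S.card : ℝ) ^ (1 - 1 / (2 * p) - 1 / (2 * q)) = S.card := by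
      rw [← Real.rpow_add hc, ← Real.rpow_add hc]
      nth_rewrite 2 [← Real.rpow_one (S.card : ℝ)]
      congr 1; ring
    nth_rewrite 4 [← this]
    ring
  rw [e2] at h
  have h3 : 1 ≤ (P * Q) ^ (1 / 2 : ℝ) := by
    by_contra hlt
    have := mul_lt_mul_of_pos_left (not_le.1 hlt) hc
    linarith
  have h4 : 1 ≤ P * Q := by
    by_contra hlt
    have := Real.rpow_lt_one (by positivity) (not_le.1 hlt) (by norm_num : (0 : ℝ) < 1 / 2)
    linarith
  rw [inv_eq_one_div, div_le_iff₀ hQ]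
  exact h4

theorem setAverage_Icc_neg_zero {s : ℝ} (hs : 0 < s) (f : ℝ → ℝ) :
    ⨍ t in Set.Icc (-s) 0, f t = s⁻¹ * ∫ t in Set.Icc (-s) 0, f t := by
  rw [setAverage_eq, smul_eq_mul, Real.volume_real_Icc_of_le (by linarith)]
  simp

variable {d : ℕ} {ω : Bond d → ℝ}

theorem gradNormSq_eq (hω : ∀ b, 0 < ω b) {s : ℝ} (hs : 0 < s) (m : ℕ)
    (v : ℝ → Vertex d → ℝ) :
    gradNormSq ω (Set.Icc (-s) 0) m v = s⁻¹ * (((boxBonds d m).card : ℝ)⁻¹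
      * ∫ t in Set.Icc (-s) 0, ∑ b ∈ boxBonds d m, ω b * grad (v t) b ^ 2) := by
  rw [gradNormSq, setAverage_Icc_neg_zero hs, ← integral_const_mul ((boxBonds d m).card : ℝ)⁻¹]
  congr 2
  funext t
  rw [avgNorm_two_sq]
  congr 1
  refine Finset.sum_congr rfl fun b _ => ?_
  rw [mul_pow, Real.sq_sqrt (hω b).le]

theorem integral_avgNorm_two_sq_eq {s : ℝ} (hs : 0 < s) (m : ℕ) (v : ℝ → Vertex d → ℝ) :
    ⨍ t in Set.Icc (-s) 0, avgNorm 2 (box d m) (v t) ^ 2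
      = s⁻¹ * (((2 * (m : ℝ) + 1) ^ d)⁻¹
        * ∫ t in Set.Icc (-s) 0, ∑ x ∈ box d m, v t x ^ 2) := by
  rw [setAverage_Icc_neg_zero hs, ← integral_const_mul ((2 * (m : ℝ) + 1) ^ d)⁻¹]
  congr 2
  funext t
  rw [avgNorm_two_sq, card_box]
  push_cast; rfl

theorem card_box_rpow [NeZero d] (m : ℕ) :
    ((box d m).card : ℝ) ^ (-2 / (d : ℝ)) = ((2 * (m : ℝ) + 1) ^ 2)⁻¹ := by
  have hd : (d : ℝ) ≠ 0 := by exact_mod_cast NeZero.ne d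
  have hN : (0 : ℝ) < 2 * m + 1 := by positivity
  rw [card_box]
  push_cast
  rw [← Real.rpow_natCast _ d, ← Real.rpow_mul hN.le, mul_div_cancel₀ _ hd, Real.rpow_neg hN.le,
    Real.rpow_two]

theorem card_boxBonds_le (d m : ℕ) :
    ((boxBonds d m).card : ℝ) ≤ d * (2 * (m : ℝ) + 1) ^ d := by
  have h : (boxBonds d m).card ≤ (box d m ×ˢ (Finset.univ : Finset (Fin d))).card :=
    Finset.card_filter_le _ _
  rw [Finset.card_product, card_box, Finset.card_univ, Fintype.card_fin] at h
  calc ((boxBonds d m).card : ℝ) ≤ (((2 * m + 1) ^ d * d : ℕ) : ℝ) := by exact_mod_cast h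
    _ = _ := by push_cast; ring

theorem le_card_boxBonds (D n : ℕ) :
    2 * (n : ℝ) * (2 * (n : ℝ) + 1) ^ D ≤ ((boxBonds (D + 1) n).card : ℝ) := by
  have h := sum_normal_bonds_le (m := n) (0 : Fin (D + 1)) (F := fun _ => (1 : ℝ))
    fun _ => zero_le_one
  simp only [Finset.sum_const, nsmul_eq_mul, mul_one, card_box, Int.card_Ico] at h
  have e : ((n : ℤ) - -(n : ℤ)).toNat = 2 * n := by omega
  rw [e] at h
  push_cast at h
  exact h

/-- The hypotheses force `n ≥ 1`, hence `2m+1 ≤ 4n+1 ≤ 6n`. This makes averages over the two boxes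
comparable, for vertices and for bonds. -/
theorem le_three_pow_mul_card {D n m : ℕ} (hnm : n < m) (hm : m ≤ 2 * n) :
    (2 * (m : ℝ) + 1) ^ (D + 1) ≤ 3 ^ (D + 1) * ((boxBonds (D + 1) n).card : ℝ) ∧
    (2 * (m : ℝ) + 1) ^ (D + 1) ≤ 3 ^ (D + 1) * (2 * (n : ℝ) + 1) ^ (D + 1) := by
  have hn : (1 : ℝ) ≤ n := by exact_mod_cast (by omega : 1 ≤ n)
  have hmn : (m : ℝ) ≤ 2 * n := by exact_mod_cast hm
  constructor
  · calc (2 * (m : ℝ) + 1) ^ (D + 1) = (2 * (m : ℝ) + 1) ^ D * (2 * (m : ℝ) + 1) := pow_succ _ _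
      _ ≤ (3 * (2 * (n : ℝ) + 1)) ^ D * (3 * (2 * (n : ℝ))) := by
          gcongr
          · linarith
          · linarith
      _ = 3 ^ (D + 1) * (2 * (n : ℝ) * (2 * (n : ℝ) + 1) ^ D) := by
          rw [mul_pow, pow_succ]; ring
      _ ≤ _ := mul_le_mul_of_nonneg_left (le_card_boxBonds D n) (by positivity)
  · rw [← mul_pow]
    gcongr
    linarith

theorem hOneNormSq_eq [NeZero d] (hω : ∀ b, 0 < ω b) (q : ℝ) {s : ℝ} (hs : 0 < s) (m : ℕ)
    (v : ℝ → Vertex d → ℝ) :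
    hOneNormSq ω q (Set.Icc (-s) 0) m v
      = ((2 * (m : ℝ) + 1) ^ 2)⁻¹ * (avgNorm q (boxBonds d m) fun b => (ω b)⁻¹)⁻¹
        * (s⁻¹ * (((2 * (m : ℝ) + 1) ^ d)⁻¹
          * ∫ t in Set.Icc (-s) 0, ∑ x ∈ box d m, v t x ^ 2))
        + s⁻¹ * (((boxBonds d m).card : ℝ)⁻¹
          * ∫ t in Set.Icc (-s) 0, ∑ b ∈ boxBonds d m, ω b * grad (v t) b ^ 2) := by
  rw [hOneNormSq, card_box_rpow, integral_avgNorm_two_sq_eq hs, gradNormSq_eq hω hs]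

/-- The integrated energy is controlled by the `H¹` norm. -/
theorem integral_energySum_le [NeZero d] (hω : ∀ b, 0 < ω b) (q : ℝ) {s : ℝ} (hs : 0 < s)
    {m : ℕ} (hne : (boxBonds d m).Nonempty) {w : ℝ → Vertex d → ℝ}
    (hw : ∀ x ∈ box d m, ContinuousOn (fun t => w t x) (Set.Icc (-s) 0)) :
    (∫ t in Set.Icc (-s) 0,
        energySum ω (avgNorm q (boxBonds d m) fun b => (ω b)⁻¹) m (w t)) / (2 * (m : ℝ) + 1) ^ d
      ≤ d * s * hOneNormSq ω q (Set.Icc (-s) 0) m w := by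
  have hl : 0 < avgNorm q (boxBonds d m) fun b => (ω b)⁻¹ :=
    avgNorm_pos hne fun b _ => inv_pos.2 (hω b)
  rw [hOneNormSq_eq hω q hs]
  set l := avgNorm q (boxBonds d m) fun b => (ω b)⁻¹
  have hb : (0 : ℝ) < (boxBonds d m).card := by exact_mod_cast hne.card_pos
  have hcard := card_boxBonds_le d m
  have hd : (1 : ℝ) ≤ d := by exact_mod_cast NeZero.one_le
  have hM : (0 : ℝ) < (2 * (m : ℝ) + 1) ^ d := by positivity
  set M := (2 * (m : ℝ) + 1) ^ d
  have c1 : ContinuousOn (fun t => ∑ b ∈ boxBonds d m, ω b * grad (w t) b ^ 2)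
      (Set.Icc (-s) 0) := by
    refine continuousOn_finsetSum _ fun b hb => ?_
    rw [mem_boxBonds] at hb
    exact continuousOn_const.mul (((hw _ hb.2).sub (hw _ hb.1)).pow 2)
  have c2 : ContinuousOn (fun t => ∑ x ∈ box d m, w t x ^ 2) (Set.Icc (-s) 0) :=
    continuousOn_finsetSum _ fun x hx => (hw x hx).pow 2
  unfold energySum
  rw [integral_add c1.integrableOn_Icc (c2.integrableOn_Icc.const_mul _), integral_const_mul]
  have h1 : 0 ≤ ∫ t in Set.Icc (-s) 0, ∑ b ∈ boxBonds d m, ω b * grad (w t) b ^ 2 :=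
    integral_nonneg fun t => Finset.sum_nonneg fun b _ => mul_nonneg (hω b).le (sq_nonneg _)
  have h2 : 0 ≤ ∫ t in Set.Icc (-s) 0, ∑ x ∈ box d m, w t x ^ 2 :=
    integral_nonneg fun t => Finset.sum_nonneg fun b _ => sq_nonneg _
  set J1 := ∫ t in Set.Icc (-s) 0, ∑ b ∈ boxBonds d m, ω b * grad (w t) b ^ 2
  set J2 := ∫ t in Set.Icc (-s) 0, ∑ x ∈ box d m, w t x ^ 2
  rw [add_div, add_comm, mul_add]
  refine add_le_add ?_ ?_
  · calc ((2 * (m : ℝ) + 1) ^ 2 * l)⁻¹ * J2 / M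
        = 1 * (((2 * (m : ℝ) + 1) ^ 2 * l)⁻¹ * J2 / M) := by ring
      _ ≤ d * (((2 * (m : ℝ) + 1) ^ 2 * l)⁻¹ * J2 / M) := by gcongr
      _ = _ := by field_simp
  · have e : d * s * (s⁻¹ * (((boxBonds d m).card : ℝ)⁻¹ * J1)) = d * J1 / (boxBonds d m).card := by
      field_simp
    rw [e, div_le_div_iff₀ hM hb]
    have := mul_le_mul_of_nonneg_left hcard h1
    linarith

end Norms

/-! ### The exponents -/

section Parameters

variable {d : ℕ} {p q : ℝ}

theorem one_lt_of_half_lt (hd : 2 ≤ d) (hq : (d : ℝ) / 2 < q) : 1 < q := by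
  have : (2 : ℝ) ≤ d := by exact_mod_cast hd
  linarith

theorem deltaOne_pos (hpq : 1 / p + 1 / q < 2 / ((d : ℝ) - 1)) : 0 < deltaOne d p q := by
  unfold deltaOne; linarith

theorem deltaTwo_pos (hd : 2 ≤ d) (hq : (d : ℝ) / 2 < q) : 0 < deltaTwo d q := by
  have : (2 : ℝ) ≤ d := by exact_mod_cast hd
  have h : 1 / q < 2 / (d : ℝ) := by
    rw [div_lt_div_iff₀ (by linarith) (by linarith)]; linarith
  unfold deltaTwo; linarith

theorem deltaTwo_lt_one (hd : 2 ≤ d) (hq : (d : ℝ) / 2 < q) : deltaTwo d q < 1 := by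
  have h2 : (2 : ℝ) ≤ d := by exact_mod_cast hd
  have h : 2 / (d : ℝ) ≤ 1 := by rw [div_le_one (by linarith)]; exact h2
  have : 0 < 1 / q := by have : 0 < q := by linarith
                         positivity
  unfold deltaTwo; linarith

theorem one_lt_theta (hp : 1 < p) (hpq : 1 / p + 1 / q < 2 / ((d : ℝ) - 1)) :
    1 < theta d p q := by
  unfold theta
  split_ifs
  · exact hp
  · have := mul_pos (by linarith : 0 < p) (deltaOne_pos hpq); linarith

theorem nu_mem_Ioo (hd : 2 ≤ d) (hp : 1 < p) (hq : (d : ℝ) / 2 < q)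
    (hpq : 1 / p + 1 / q < 2 / ((d : ℝ) - 1)) : nu d p q ∈ Set.Ioo (0 : ℝ) 1 := by
  have h1 := deltaTwo_pos hd hq
  have h2 := deltaTwo_lt_one hd hq
  have h3 := one_lt_theta hp hpq
  have h4 : 1 / theta d p q < 1 := by rw [div_lt_one (by linarith)]; exact h3
  have h5 : 0 < 1 / theta d p q := by have : 0 < theta d p q := by linarith
                                      positivity
  unfold nu
  constructor <;> nlinarith

theorem two_lt_gam (hp : 1 < p) (hq : 1 < q) (hpq : 1 / p + 1 / q < 2 / ((d : ℝ) - 1)) :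
    2 < gam d p q := by
  have h3 : 0 < theta d p q := by linarith [one_lt_theta hp hpq]
  have h1 : 0 < 1 / p := by have : 0 < p := by linarith
                            positivity
  have h2 : 0 < 1 / (theta d p q * q) := by have : 0 < q := by linarith
                                            positivity
  unfold gam; linarith

/-- The Sobolev exponent on slices, and the exponent relations it satisfies. -/
theorem exists_slice_exponent {D : ℕ} (hD : 1 ≤ D) (hp : 1 < p)
    (hpq : 1 / p + 1 / q < 2 / (((D + 1 : ℕ) : ℝ) - 1)) :
    ∃ σ, IsSobolevExponent D q σ ∧ 1 / p + 0 + σ * 1 ≤ 1 ∧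
      1 / p + (1 - 1 / theta (D + 1) p q) + σ * (1 / theta (D + 1) p q) ≤ 1 := by
  have hp0 : 0 < p := by linarith
  have hp1 : 1 / p < 1 := by rw [div_lt_one hp0]; exact hp
  have hθ := one_lt_theta hp hpq
  rcases hD.eq_or_lt with rfl | hD2
  · refine ⟨0, Or.inl ⟨rfl, rfl⟩, by linarith, ?_⟩
    have : theta (1 + 1) p q = p := by simp [theta]
    rw [this]; linarith
  · refine ⟨1 + 1 / q - 2 / D, Or.inr ⟨hD2, rfl⟩, ?_, ?_⟩
    · push_cast at hpq; rw [add_sub_cancel_right] at hpq; linarith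
    · have hth : theta (D + 1) p q = 1 + p * (2 / (D : ℝ) - 1 / p - 1 / q) := by
        have : ¬ (D + 1 = 2) := by omega
        rw [theta, if_neg this, deltaOne]; push_cast; rw [add_sub_cancel_right]
      -- Equivalently `σ = 1 - θ/p`, and then `1/p + (1 - 1/θ) + σ/θ` is exactly one. This is how
      -- `θ` is determined.
      have h1 : 2 / (D : ℝ) - 1 / q = theta (D + 1) p q / p := by
        rw [hth]; field_simp; ring
      have h2 : 1 + 1 / q - 2 / (D : ℝ) = 1 - theta (D + 1) p q / p := by linarith
      rw [h2]
      have : theta (D + 1) p q ≠ 0 := by linarith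
      have h3 : (1 - theta (D + 1) p q / p) * (1 / theta (D + 1) p q)
          = 1 / theta (D + 1) p q - 1 / p := by field_simp
      rw [h3]; linarith

end Parameters

/-! ### Normalised Caccioppoli inequality and estimate (ii) -/

section Estimates

variable {D : ℕ} {ω : Bond (D + 1) → ℝ} {n m : ℕ} {s₁ s₂ : ℝ} {u : ℝ → Vertex (D + 1) → ℝ}

theorem hOneNormSq_nonneg (hω : ∀ b, 0 < ω b) (q : ℝ) {s : ℝ} (hs : 0 < s) (m : ℕ)
    (v : ℝ → Vertex (D + 1) → ℝ) : 0 ≤ hOneNormSq ω q (Set.Icc (-s) 0) m v := by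
  rw [hOneNormSq_eq hω q hs]
  have h1 : 0 ≤ ∫ t in Set.Icc (-s) 0, ∑ b ∈ boxBonds (D + 1) m, ω b * grad (v t) b ^ 2 :=
    integral_nonneg fun t => Finset.sum_nonneg fun b _ => mul_nonneg (hω b).le (sq_nonneg _)
  have h2 : 0 ≤ ∫ t in Set.Icc (-s) 0, ∑ x ∈ box (D + 1) m, v t x ^ 2 :=
    integral_nonneg fun t => Finset.sum_nonneg fun b _ => sq_nonneg _
  have h3 := avgNorm_nonneg q (boxBonds (D + 1) m) fun b => (ω b)⁻¹
  positivity

theorem boxBonds_nonempty (hm : 0 < m) : (boxBonds (D + 1) m).Nonempty := by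
  have h := le_card_boxBonds D m
  have hm' : (0 : ℝ) < m := by exact_mod_cast hm
  have : (0 : ℝ) < (boxBonds (D + 1) m).card := lt_of_lt_of_le (by positivity) h
  exact Finset.card_pos.1 (by exact_mod_cast this)

/-- The Caccioppoli inequality with normalised norms. -/
theorem sup_le_and_gradNormSq_le (hω : ∀ b, 0 < ω b) (hnm : n < m) (hm : m ≤ 2 * n)
    (hs₁ : 0 < s₁) (hs : s₁ < s₂)
    (hu : ∀ t ∈ Set.Icc (-s₂) 0, ∀ x ∈ box (D + 1) m, 0 ≤ u t x)
    (hsub : IsSubcaloric ω u (Set.Icc (-s₂) 0) (box (D + 1) m)) {α : ℝ} (hα : 1 ≤ α)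
    {G : Finset ℕ} (hG : G ⊆ Finset.Ico n m) (hne : G.Nonempty) {R : ℝ}
    (hR : (s₂ - s₁)⁻¹ * (∫ t in Set.Icc (-s₂) 0, ∑ x ∈ box (D + 1) m, (u t x ^ α) ^ 2)
      + 4 * α ^ 2 * (∫ t in Set.Icc (-s₂) 0, ∑ b ∈ boxBonds (D + 1) m,
          ω b * (grad (cutoff G) b ^ 2
          * ((u t b.1 ^ α) ^ 2 + (u t (b.1 + unitVec b.2) ^ α) ^ 2))) ≤ R) :
    (⨆ t : Set.Icc (-s₁) 0, s₁⁻¹ * avgNorm 2 (box (D + 1) n) (fun x => u t x ^ α) ^ 2)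
        ≤ s₁⁻¹ * (3 ^ (D + 1) * (R / (2 * (m : ℝ) + 1) ^ (D + 1))) ∧
      gradNormSq ω (Set.Icc (-s₁) 0) n (fun t x => u t x ^ α)
        ≤ s₁⁻¹ * (3 ^ (D + 1) * (R / (2 * (m : ℝ) + 1) ^ (D + 1))) := by
  obtain ⟨h1, h2⟩ := caccioppoli hω hnm.le hs₁ hs hu hsub hα (cutoff_nonneg G) (cutoff_le_one G)
    (fun x hx => cutoff_eq_one hG hne hx) (fun x hx i hi => cutoff_eq_zero_of_add hG hx hi)
    (fun x hx i hi => cutoff_eq_zero_of_sub hG hx hi) hR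
  obtain ⟨c1, c2⟩ := le_three_pow_mul_card (D := D) hnm hm
  have hR0 : 0 ≤ R := le_trans (Finset.sum_nonneg fun x _ => sq_nonneg _)
    (h1 0 ⟨by linarith, le_rfl⟩)
  have hM : (0 : ℝ) < (2 * (m : ℝ) + 1) ^ (D + 1) := by positivity
  have hn : 0 < n := by omega
  have hb : (0 : ℝ) < (boxBonds (D + 1) n).card := by
    exact_mod_cast (boxBonds_nonempty hn).card_pos
  have key : ∀ c : ℝ, 0 < c → (2 * (m : ℝ) + 1) ^ (D + 1) ≤ 3 ^ (D + 1) * c →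
      c⁻¹ * R ≤ 3 ^ (D + 1) * (R / (2 * (m : ℝ) + 1) ^ (D + 1)) := fun c hc h => by
    rw [inv_mul_eq_div, mul_div_assoc', div_le_div_iff₀ hc hM]
    nlinarith
  have : Nonempty (Set.Icc (-s₁) (0 : ℝ)) := ⟨⟨0, by linarith, le_rfl⟩⟩
  constructor
  · refine ciSup_le fun t => mul_le_mul_of_nonneg_left ?_ (by positivity)
    rw [avgNorm_two_sq, card_box]
    push_cast
    exact (mul_le_mul_of_nonneg_left (h1 t t.2) (by positivity)).trans
      (key _ (by positivity) c2)
  · rw [gradNormSq_eq hω hs₁]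
    refine mul_le_mul_of_nonneg_left ?_ (by positivity)
    exact (mul_le_mul_of_nonneg_left h2 (by positivity)).trans (key _ hb c1)

theorem one_sub_div_pos (hnm : n < m) : 0 < 1 - (n : ℝ) / m := by
  have hm0 : (0 : ℝ) < m := by exact_mod_cast (Nat.zero_le n).trans_lt hnm
  rw [sub_pos, div_lt_one hm0]; exact_mod_cast hnm

theorem one_sub_div_le_one : 1 - (n : ℝ) / m ≤ 1 := by
  have : 0 ≤ (n : ℝ) / m := by positivity
  linarith

/-- Hölder's inequality for the sum of squares over a box. -/
theorem sum_sq_le_avgNorm {p : ℝ} (hp : 1 < p) (f : Vertex (D + 1) → ℝ) :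
    ∑ x ∈ box (D + 1) m, f x ^ 2
      ≤ (2 * (m : ℝ) + 1) ^ (D + 1) * avgNorm (2 * p / (p - 1)) (box (D + 1) m) f ^ 2 ∧
    ∀ e : Bond (D + 1) → Vertex (D + 1), (∀ g : Vertex (D + 1) → ℝ, (∀ x, 0 ≤ g x) →
        ∑ b ∈ boxBonds (D + 1) m, g (e b) ≤ (D + 1 : ℕ) * ∑ x ∈ box (D + 1) m, g x) →
      (∀ b, 0 < ω b) → (boxBonds (D + 1) m).Nonempty →
      ∑ b ∈ boxBonds (D + 1) m, ω b * f (e b) ^ 2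
        ≤ (D + 1 : ℕ) * (2 * (m : ℝ) + 1) ^ (D + 1) * avgNorm p (boxBonds (D + 1) m) ω
          * avgNorm (2 * p / (p - 1)) (box (D + 1) m) f ^ 2 := by
  have hp0 : 0 < p := by linarith
  have hp1 : 0 < p - 1 := by linarith
  set r := 2 * p / (p - 1) with hr
  have hr0 : 0 < r := by positivity
  have hM : (0 : ℝ) < (2 * (m : ℝ) + 1) ^ (D + 1) := by positivity
  have hcard : ((box (D + 1) m).card : ℝ) = (2 * (m : ℝ) + 1) ^ (D + 1) := by
    rw [card_box]; push_cast; rfl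
  set M := (2 * (m : ℝ) + 1) ^ (D + 1)
  set X := ∑ x ∈ box (D + 1) m, |f x| ^ r with hX
  have hX0 : 0 ≤ X := Finset.sum_nonneg fun x _ => Real.rpow_nonneg (abs_nonneg _) _
  have hY : avgNorm r (box (D + 1) m) f ^ 2 = (M⁻¹ * X) ^ ((p - 1) / p) := by
    rw [avgNorm, hcard, ← Real.rpow_natCast, ← Real.rpow_mul (by positivity)]
    congr 1
    rw [hr]; push_cast; field_simp
  have hpt : ∀ y : ℝ, (|y| ^ r) ^ ((p - 1) / p) = y ^ 2 := fun y => by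
    rw [← Real.rpow_mul (abs_nonneg _)]
    have : r * ((p - 1) / p) = (2 : ℕ) := by rw [hr]; push_cast; field_simp
    rw [this, Real.rpow_natCast, sq_abs]
  have hMs : ∀ c : ℝ, 0 ≤ c → c ^ (1 / p) * c ^ ((p - 1) / p) = c := fun c hc => by
    rw [← Real.rpow_add_of_nonneg hc (by positivity) (by positivity)]
    have : 1 / p + (p - 1) / p = 1 := by field_simp; ring
    rw [this, Real.rpow_one]
  have hXM : X = M * (M⁻¹ * X) := by field_simp
  refine ⟨?_, fun e he hω hne => ?_⟩
  · have h := sum_rpow_mul_rpow_le (box (D + 1) m) (f := fun _ => (1 : ℝ))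
      (g := fun x => |f x| ^ r) (a := 1 / p) (b := (p - 1) / p)
      (fun _ _ => zero_le_one) (fun x _ => Real.rpow_nonneg (abs_nonneg _) _)
      (by positivity) (by positivity) (by field_simp; ring)
    simp only [Real.one_rpow, one_mul, hpt, Finset.sum_const, nsmul_eq_mul, mul_one, hcard] at h
    refine h.trans (le_of_eq ?_)
    rw [← hX, hY]
    nth_rewrite 1 [hXM]
    rw [Real.mul_rpow hM.le (by positivity), ← mul_assoc, hMs _ hM.le]
  · have h := sum_rpow_mul_rpow_le (boxBonds (D + 1) m) (f := fun b => ω b ^ p)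
      (g := fun b => |f (e b)| ^ r) (a := 1 / p) (b := (p - 1) / p)
      (fun b _ => Real.rpow_nonneg (hω b).le _) (fun x _ => Real.rpow_nonneg (abs_nonneg _) _)
      (by positivity) (by positivity) (by field_simp; ring)
    have e1 : ∀ b, (ω b ^ p) ^ (1 / p) = ω b := fun b => by
      rw [← Real.rpow_mul (hω b).le, mul_one_div_cancel hp0.ne', Real.rpow_one]
    simp only [e1, hpt] at h
    have hΩ := avgNorm_nonneg p (boxBonds (D + 1) m) ω
    rw [sum_rpow_eq_card_mul_avgNorm hp0 hne fun b _ => (hω b).le,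
      Real.mul_rpow (by positivity) (by positivity), ← Real.rpow_mul hΩ,
      mul_one_div_cancel hp0.ne', Real.rpow_one] at h
    refine h.trans ?_
    have he' := he (fun x => |f x| ^ r) fun _ => Real.rpow_nonneg (abs_nonneg _) _
    have h0 : 0 ≤ ∑ b ∈ boxBonds (D + 1) m, |f (e b)| ^ r :=
      Finset.sum_nonneg fun x _ => Real.rpow_nonneg (abs_nonneg _) _
    have hdM : 0 ≤ ((D + 1 : ℕ) : ℝ) * M := by positivity
    calc _ ≤ (((D + 1 : ℕ) : ℝ) * M) ^ (1 / p) * avgNorm p (boxBonds (D + 1) m) ω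
          * (((D + 1 : ℕ) : ℝ) * X) ^ ((p - 1) / p) := by
          refine mul_le_mul (mul_le_mul_of_nonneg_right (Real.rpow_le_rpow (Nat.cast_nonneg _)
            (card_boxBonds_le _ _) (by positivity)) hΩ) (Real.rpow_le_rpow h0 he'
            (by positivity)) (Real.rpow_nonneg h0 _) (mul_nonneg (Real.rpow_nonneg hdM _) hΩ)
      _ = _ := by
          rw [hY]
          nth_rewrite 1 [hXM]
          rw [← mul_assoc, Real.mul_rpow hdM (by positivity)]
          calc _ = (((D + 1 : ℕ) : ℝ) * M) ^ (1 / p) * (((D + 1 : ℕ) : ℝ) * M) ^ ((p - 1) / p)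
                * avgNorm p (boxBonds (D + 1) m) ω * (M⁻¹ * X) ^ ((p - 1) / p) := by ring
            _ = _ := by rw [hMs _ hdM]

/-- The energy estimate without optimisation of the cutoff. -/
theorem energy_estimate {p : ℝ} (hp : 1 < p) (hω : ∀ b, 0 < ω b) (hnm : n < m) (hm : m ≤ 2 * n)
    (hs₁ : 0 < s₁) (hs : s₁ < s₂)
    (hu : ∀ t ∈ Set.Icc (-s₂) 0, ∀ x ∈ box (D + 1) m, 0 ≤ u t x)
    (hsub : IsSubcaloric ω u (Set.Icc (-s₂) 0) (box (D + 1) m)) {α : ℝ} (hα : 1 ≤ α) {X : ℝ}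
    (hX : X = α ^ 2 / (m : ℝ) ^ 2
            * (avgNorm p (boxBonds (D + 1) m) ω / (1 - (n : ℝ) / m) ^ 2
                + (m : ℝ) ^ 2 / (s₂ - s₁))
            * (s₂ / s₁)
            * ⨍ t in Set.Icc (-s₂) 0,
                avgNorm (2 * p / (p - 1)) (box (D + 1) m) (fun x => u t x ^ α) ^ 2) :
    0 ≤ X ∧ (⨆ t : Set.Icc (-s₁) 0, s₁⁻¹ * avgNorm 2 (box (D + 1) n) (fun x => u t x ^ α) ^ 2)
        + gradNormSq ω (Set.Icc (-s₁) 0) n (fun t x => u t x ^ α)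
      ≤ 16 * ((D + 1 : ℕ) : ℝ) * 3 ^ (D + 1) * X := by
  have hs₂ : 0 < s₂ := hs₁.trans hs
  have hm0 : 0 < m := by omega
  have hmR : (0 : ℝ) < m := by exact_mod_cast hm0
  have hne := boxBonds_nonempty (D := D) hm0
  have hx0 := one_sub_div_pos hnm
  set x := 1 - (n : ℝ) / m with hx
  have hΩ := avgNorm_nonneg p (boxBonds (D + 1) m) ω
  have hM : (0 : ℝ) < (2 * (m : ℝ) + 1) ^ (D + 1) := by positivity
  rw [setAverage_Icc_neg_zero hs₂] at hX
  set Ω := avgNorm p (boxBonds (D + 1) m) ω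
  set M := (2 * (m : ℝ) + 1) ^ (D + 1)
  set r := 2 * p / (p - 1) with hr
  have hr0 : 0 < r := div_pos (by linarith) (by linarith)
  set Y : ℝ → ℝ := fun t => avgNorm r (box (D + 1) m) (fun x => u t x ^ α) ^ 2 with hYdef
  set J := ∫ t in Set.Icc (-s₂) 0, Y t with hJ
  have hJ0 : 0 ≤ J := integral_nonneg fun t => sq_nonneg _
  have hss : 0 < s₂ - s₁ := by linarith
  have hX0 : 0 ≤ X := by rw [hX]; positivity
  have hvc : ∀ x ∈ box (D + 1) m, ContinuousOn (fun t => u t x ^ α) (Set.Icc (-s₂) 0) :=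
    fun x hx => (continuousOn_of_isSubcaloric hsub hx).rpow_const fun s _ => Or.inr (by linarith)
  have hYc : ContinuousOn Y (Set.Icc (-s₂) 0) := by
    refine ContinuousOn.pow (ContinuousOn.rpow_const (continuousOn_const.mul
      (continuousOn_finsetSum _ fun x hx => ?_)) fun _ _ => Or.inr (by positivity)) 2
    exact (hvc x hx).abs.rpow_const fun _ _ => Or.inr hr0.le
  have hYi : IntegrableOn Y (Set.Icc (-s₂) 0) := hYc.integrableOn_Icc
  set d : ℝ := ((D + 1 : ℕ) : ℝ) with hd
  have hd1 : 1 ≤ d := by rw [hd]; exact_mod_cast (by omega : 1 ≤ D + 1)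
  have hV : ∫ t in Set.Icc (-s₂) 0, ∑ x ∈ box (D + 1) m, (u t x ^ α) ^ 2 ≤ M * J := by
    rw [hJ, ← integral_const_mul]
    exact integral_mono_of_nonneg (Filter.Eventually.of_forall fun t =>
      Finset.sum_nonneg fun x _ => sq_nonneg _) (hYi.const_mul _)
      (Filter.Eventually.of_forall fun t => (sum_sq_le_avgNorm (ω := ω) hp _).1)
  have hcardG : ((Finset.Ico n m).card : ℝ) = m * x := by
    rw [Nat.card_Ico, Nat.cast_sub hnm.le, hx]; field_simp
  have hF : ∫ t in Set.Icc (-s₂) 0, ∑ b ∈ boxBonds (D + 1) m,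
          ω b * (grad (cutoff (Finset.Ico n m)) b ^ 2
          * ((u t b.1 ^ α) ^ 2 + (u t (b.1 + unitVec b.2) ^ α) ^ 2))
      ≤ ((m * x)⁻¹) ^ 2 * (2 * (d * M * Ω)) * J := by
    rw [hJ, ← integral_const_mul]
    refine integral_mono_of_nonneg (Filter.Eventually.of_forall fun t =>
      Finset.sum_nonneg fun b _ => mul_nonneg (hω b).le (by positivity)) (hYi.const_mul _)
      (Filter.Eventually.of_forall fun t => ?_)
    -- The two endpoints of the bonds are treated by the same Hölder estimate, each with
    -- multiplicity at most the dimension.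
    have h1 := (sum_sq_le_avgNorm (ω := ω) (m := m) hp (fun x => u t x ^ α)).2
      (fun b => b.1) (fun g hg => sum_boxBonds_lower_le hg) hω hne
    have h2 := (sum_sq_le_avgNorm (ω := ω) (m := m) hp (fun x => u t x ^ α)).2
      (fun b => b.1 + unitVec b.2) (fun g hg => sum_boxBonds_upper_le hg) hω hne
    calc _ ≤ ∑ b ∈ boxBonds (D + 1) m, ((m * x)⁻¹) ^ 2 * (ω b * (u t b.1 ^ α) ^ 2
            + ω b * (u t (b.1 + unitVec b.2) ^ α) ^ 2) := by
          refine Finset.sum_le_sum fun b _ => ?_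
          have hgr : grad (cutoff (Finset.Ico n m)) b ^ 2 ≤ ((m * x)⁻¹) ^ 2 := by
            have h := sq_grad_cutoff_le (Finset.Ico n m) b.1 b.2
            refine h.trans ?_
            rw [hcardG]
            split_ifs
            · exact le_rfl
            · exact sq_nonneg _
          have h0 : 0 ≤ ω b * ((u t b.1 ^ α) ^ 2 + (u t (b.1 + unitVec b.2) ^ α) ^ 2) :=
            mul_nonneg (hω b).le (by positivity)
          have := mul_le_mul_of_nonneg_right hgr h0
          linarith
      _ ≤ _ := by
          change _ ≤ ((m * x)⁻¹) ^ 2 * (2 * (d * M * Ω)) * Y t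
          rw [← Finset.mul_sum, Finset.sum_add_distrib, mul_assoc (((m : ℝ) * x)⁻¹ ^ 2)]
          refine mul_le_mul_of_nonneg_left ?_ (sq_nonneg _)
          linarith
  have hR := add_le_add (mul_le_mul_of_nonneg_left hV (inv_nonneg.2 hss.le))
    (mul_le_mul_of_nonneg_left hF (by positivity : 0 ≤ 4 * α ^ 2))
  -- With every radius of `[n, m)` allowed, the profile is linear with slope `1/(m - n)`.
  obtain ⟨k1, k2⟩ := sup_le_and_gradNormSq_le hω hnm hm hs₁ hs hu hsub hα (Finset.Subset.refl _)
    (Finset.nonempty_Ico.2 hnm) hR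
  refine ⟨hX0, (add_le_add k1 k2).trans ?_⟩
  have e : s₁⁻¹ * (3 ^ (D + 1) * (((s₂ - s₁)⁻¹ * (M * J) + 4 * α ^ 2 *
      (((m * x)⁻¹) ^ 2 * (2 * (d * M * Ω)) * J)) / M))
      = s₁⁻¹ * 3 ^ (D + 1) * J * ((s₂ - s₁)⁻¹ + 8 * d * α ^ 2 * (Ω / (m ^ 2 * x ^ 2))) := by
    field_simp
    ring
  have e2 : 16 * d * 3 ^ (D + 1) * X = 2 * (s₁⁻¹ * 3 ^ (D + 1) * J * (8 * d * α ^ 2 * (s₂ - s₁)⁻¹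
      + 8 * d * α ^ 2 * (Ω / (m ^ 2 * x ^ 2)))) := by
    rw [hX]; field_simp; ring
  rw [e, e2, ← two_mul]
  have h1 : (1 : ℝ) ≤ α ^ 2 := one_le_pow₀ hα
  have h2 : 1 ≤ 8 * d * α ^ 2 := by nlinarith
  have h3 : (s₂ - s₁)⁻¹ ≤ 8 * d * α ^ 2 * (s₂ - s₁)⁻¹ :=
    le_mul_of_one_le_left (by positivity) h2
  gcongr

end Estimates

/-! ### Full-dimensional interpolation and estimate (iii) -/

section Optimised

variable {D : ℕ} {ω : Bond (D + 1) → ℝ} {n m : ℕ} {s₁ s₂ : ℝ} {u : ℝ → Vertex (D + 1) → ℝ}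

theorem rpow_inv_le_self {c p : ℝ} (hc : 1 ≤ c) (hp : 1 < p) : c ^ (1 / p) ≤ c := by
  have hp1 : 1 / p ≤ 1 := by rw [div_le_one (by linarith)]; exact hp.le
  calc c ^ (1 / p) ≤ c ^ (1 : ℝ) := Real.rpow_le_rpow_of_exponent_le hc hp1
    _ = c := Real.rpow_one _

theorem mean_rpow_le_avgNorm {p : ℝ} (hp : 1 < p) (hω : ∀ b, 0 < ω b) (hm : 0 < m) :
    ((∑ b ∈ boxBonds (D + 1) m, ω b ^ p) / (2 * (m : ℝ) + 1) ^ (D + 1)) ^ (1 / p)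
      ≤ ((D + 1 : ℕ) : ℝ) * avgNorm p (boxBonds (D + 1) m) ω := by
  have hp0 : 0 < p := by linarith
  have hne := boxBonds_nonempty (D := D) hm
  have hΩ := avgNorm_nonneg p (boxBonds (D + 1) m) ω
  have hM : (0 : ℝ) < (2 * (m : ℝ) + 1) ^ (D + 1) := by positivity
  have hd1 : (1 : ℝ) ≤ ((D + 1 : ℕ) : ℝ) := by exact_mod_cast (by omega : 1 ≤ D + 1)
  have h0 : 0 ≤ ∑ b ∈ boxBonds (D + 1) m, ω b ^ p :=
    Finset.sum_nonneg fun b _ => Real.rpow_nonneg (hω b).le _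
  have h : (∑ b ∈ boxBonds (D + 1) m, ω b ^ p) / (2 * (m : ℝ) + 1) ^ (D + 1)
      ≤ ((D + 1 : ℕ) : ℝ) * avgNorm p (boxBonds (D + 1) m) ω ^ p := by
    rw [div_le_iff₀ hM, sum_rpow_eq_card_mul_avgNorm hp0 hne fun b _ => (hω b).le]
    have := mul_le_mul_of_nonneg_right (card_boxBonds_le (D + 1) m) (Real.rpow_nonneg hΩ p)
    linarith
  refine (Real.rpow_le_rpow (div_nonneg h0 hM.le) h (by positivity)).trans ?_
  rw [Real.mul_rpow (Nat.cast_nonneg _) (Real.rpow_nonneg hΩ _), ← Real.rpow_mul hΩ,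
    mul_one_div_cancel hp0.ne', Real.rpow_one]
  exact mul_le_mul_of_nonneg_right (rpow_inv_le_self hd1 hp) hΩ

/-- The sum of `ω^p` grows with the box while the numbers of bonds are comparable; this moves the
conductance from `B(n)` to `B(m)` in the zeroth-order term. -/
theorem avgNorm_le_of_le_two_mul {p : ℝ} (hp : 1 < p) (hω : ∀ b, 0 < ω b) (hnm : n < m)
    (hm : m ≤ 2 * n) :
    avgNorm p (boxBonds (D + 1) n) ω
      ≤ 3 ^ (D + 1) * ((D + 1 : ℕ) : ℝ) * avgNorm p (boxBonds (D + 1) m) ω := by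
  have hp0 : 0 < p := by linarith
  have hn : 0 < n := by omega
  have hne := boxBonds_nonempty (D := D) hn
  have hd1 : (1 : ℝ) ≤ 3 ^ (D + 1) := one_le_pow₀ (by norm_num)
  have hM : (0 : ℝ) < (2 * (m : ℝ) + 1) ^ (D + 1) := by positivity
  have hb : (0 : ℝ) < (boxBonds (D + 1) n).card := by exact_mod_cast hne.card_pos
  have hcard := (le_three_pow_mul_card (D := D) hnm hm).1
  have hP : 0 ≤ ∑ b ∈ boxBonds (D + 1) m, ω b ^ p :=
    Finset.sum_nonneg fun b _ => Real.rpow_nonneg (hω b).le _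
  have e : avgNorm p (boxBonds (D + 1) n) ω
      = (((boxBonds (D + 1) n).card : ℝ)⁻¹ * ∑ b ∈ boxBonds (D + 1) n, ω b ^ p) ^ (1 / p) := by
    rw [avgNorm]; congr 2
    exact Finset.sum_congr rfl fun b _ => by rw [abs_of_pos (hω b)]
  have hsum : ∑ b ∈ boxBonds (D + 1) n, ω b ^ p ≤ ∑ b ∈ boxBonds (D + 1) m, ω b ^ p :=
    Finset.sum_le_sum_of_subset_of_nonneg (boxBonds_mono hnm.le)
      fun b _ _ => Real.rpow_nonneg (hω b).le _
  have h : ((boxBonds (D + 1) n).card : ℝ)⁻¹ * ∑ b ∈ boxBonds (D + 1) n, ω b ^ p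
      ≤ 3 ^ (D + 1) * ((∑ b ∈ boxBonds (D + 1) m, ω b ^ p) / (2 * (m : ℝ) + 1) ^ (D + 1)) := by
    rw [inv_mul_eq_div, mul_div_assoc', div_le_div_iff₀ hb hM]
    calc _ ≤ (∑ b ∈ boxBonds (D + 1) m, ω b ^ p)
          * (3 ^ (D + 1) * ((boxBonds (D + 1) n).card : ℝ)) := by
          exact mul_le_mul hsum hcard hM.le hP
      _ = _ := by ring
  rw [e, mul_assoc]
  refine (Real.rpow_le_rpow (mul_nonneg (inv_nonneg.2 hb.le) (Finset.sum_nonneg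
    fun b _ => Real.rpow_nonneg (hω b).le _)) h (by positivity)).trans ?_
  rw [Real.mul_rpow (by positivity) (div_nonneg hP hM.le)]
  exact mul_le_mul (rpow_inv_le_self hd1 hp) (mean_rpow_le_avgNorm hp hω (hn.trans hnm))
    (Real.rpow_nonneg (div_nonneg hP hM.le) _) (by positivity)

/-- Interpolation between the `L^∞(L²)` norm and the Sobolev inequality in the full dimension. -/
theorem exists_integral_interpolation_le (hD : 1 ≤ D) {q : ℝ}
    (hq : ((D + 1 : ℕ) : ℝ) / 2 < q) :
    ∃ C : ℝ, 1 ≤ C ∧ ∀ (ω : Bond (D + 1) → ℝ) (m : ℕ) (s l : ℝ) (v w : ℝ → Vertex (D + 1) → ℝ)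
      (b V : ℝ), (∀ b, 0 < ω b) → 0 < l →
      ∑ b ∈ boxBonds (D + 1) m, (ω b)⁻¹ ^ q
        ≤ ((D : ℝ) + 1) * ((2 * (m : ℝ) + 1) ^ (D + 1) * l ^ q) →
      (∀ x ∈ box (D + 1) m, ContinuousOn (fun t => w t x) (Set.Icc (-s) 0)) →
      0 ≤ b → b ≤ deltaTwo (D + 1) q →
      (∀ t ∈ Set.Icc (-s) 0,
        (∑ x ∈ box (D + 1) m, v t x ^ 2) / (2 * (m : ℝ) + 1) ^ (D + 1) ≤ V) →
      (∫ t in Set.Icc (-s) 0, ∑ x ∈ box (D + 1) m, (v t x ^ 2) ^ b * w t x ^ 2)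
          / (2 * (m : ℝ) + 1) ^ (D + 1)
        ≤ C * (V ^ b * ((2 * (m : ℝ) + 1) ^ 2 * (l * ((∫ t in Set.Icc (-s) 0,
          energySum ω l m (w t)) / (2 * (m : ℝ) + 1) ^ (D + 1))))) := by
  have hq1 : 1 < q := one_lt_of_half_lt (by omega) hq
  have hq0 : 0 < q := by linarith
  obtain ⟨C, hC, H⟩ := exists_mean_rpow_le_of_sobolev (D := D + 1) (q := q)
    (σ := 1 + 1 / q - 2 / ((D + 1 : ℕ) : ℝ)) (Or.inr ⟨by omega, rfl⟩) hq1
  refine ⟨C * ((D : ℝ) + 2), ?_, ?_⟩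
  · have : (0 : ℝ) ≤ D := Nat.cast_nonneg D
    nlinarith
  intro ω m s l v w b V hω hl hQ hw hb hbδ hV
  have hM : (0 : ℝ) < (2 * (m : ℝ) + 1) ^ (D + 1) := by positivity
  set M := (2 * (m : ℝ) + 1) ^ (D + 1) with hMdef
  have hE := fun t => energySum_nonneg hω hl m (w t)
  -- The `D + 1` bounds the bond sum and the additional `1` is the term `l^q` in `invSum`.
  have hZ : (invSum ω q l m / M) ^ (1 / q) ≤ ((D : ℝ) + 2) * l := by
    have hcard : ((box (D + 1) m).card : ℝ) = M := by rw [card_box]; push_cast; rfl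
    have h1 : invSum ω q l m / M ≤ ((D : ℝ) + 2) * l ^ q := by
      rw [div_le_iff₀ hM, invSum, hcard]; linarith
    refine (Real.rpow_le_rpow (div_nonneg (invSum_nonneg hω hl m) hM.le) h1
      (by positivity)).trans ?_
    rw [Real.mul_rpow (by positivity) (by positivity), ← Real.rpow_mul hl.le,
      mul_one_div_cancel hq0.ne', Real.rpow_one]
    refine mul_le_mul_of_nonneg_right (rpow_inv_le_self ?_ hq1) hl.le
    linarith [(Nat.cast_nonneg D : (0 : ℝ) ≤ D)]
  rw [← integral_div, ← integral_div]
  have hEi : IntegrableOn (fun t => energySum ω l m (w t) / M) (Set.Icc (-s) 0) :=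
    ((continuousOn_energySum hw).div_const _).integrableOn_Icc
  calc _ ≤ ∫ t in Set.Icc (-s) 0, C * ((D : ℝ) + 2) * (V ^ b * ((2 * (m : ℝ) + 1) ^ 2 * l))
        * (energySum ω l m (w t) / M) := by
        refine integral_mono_of_nonneg ?_ (hEi.const_mul _) ?_
        · exact Filter.Eventually.of_forall fun t => div_nonneg (Finset.sum_nonneg fun x _ =>
            mul_nonneg (Real.rpow_nonneg (sq_nonneg _) _) (sq_nonneg _)) hM.le
        · refine (ae_restrict_iff' measurableSet_Icc).2 (Filter.Eventually.of_forall
            fun t ht => ?_)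
          -- Hölder weights `δ₂ - b` for the constant function, `b` for `v²` and `σ` for `w²`; they
          -- add up to one because `σ = 1 - δ₂` in the full dimension.
          have h := H ω l m (fun _ => 1) (fun x => v t x ^ 2) (w t)
            (deltaTwo (D + 1) q - b) b 1 hω hl (fun _ _ => zero_le_one) (fun _ _ => sq_nonneg _)
            (by linarith) hb zero_le_one le_rfl (by unfold deltaTwo; ring)
          have hcard : ((box (D + 1) m).card : ℝ) = M := by rw [card_box]; push_cast; rfl
          have hZ0 := Real.rpow_nonneg (div_nonneg (invSum_nonneg (q := q) hω hl m) hM.le) (1 / q)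
          rw [← hMdef] at h
          simp only [Real.one_rpow, one_mul, Real.rpow_one, Finset.sum_const, nsmul_eq_mul,
            mul_one, hcard, div_self hM.ne'] at h
          refine h.trans ?_
          have hV0 : 0 ≤ (∑ x ∈ box (D + 1) m, v t x ^ 2) / M :=
            div_nonneg (Finset.sum_nonneg fun x _ => sq_nonneg _) hM.le
          have hVb := Real.rpow_le_rpow hV0 (hV t ht) hb
          have hVn := Real.rpow_nonneg (hV0.trans (hV t ht)) b
          have hEt := div_nonneg (hE t) hM.le
          calc _ ≤ C * (V ^ b * ((2 * (m : ℝ) + 1) ^ 2 * ((((D : ℝ) + 2) * l)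
                * (energySum ω l m (w t) / M)))) := by gcongr
            _ = _ := by ring
    _ = _ := by rw [integral_const_mul]; ring

/-- Conclusion of the Caccioppoli inequality from bounds on its right-hand side. -/
theorem sup_le_and_gradNormSq_le_of_bounds (hω : ∀ b, 0 < ω b) (hnm : n < m) (hm : m ≤ 2 * n)
    (hs₁ : 0 < s₁) (hs : s₁ < s₂)
    (hu : ∀ t ∈ Set.Icc (-s₂) 0, ∀ x ∈ box (D + 1) m, 0 ≤ u t x)
    (hsub : IsSubcaloric ω u (Set.Icc (-s₂) 0) (box (D + 1) m)) {α : ℝ} (hα : 1 ≤ α)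
    {G : Finset ℕ} (hG : G ⊆ Finset.Ico n m) (hne : G.Nonempty) {a a' Q Ω g Φ : ℝ}
    (ha : 0 ≤ a) (ha' : 0 ≤ a') (hΩ : 0 ≤ Ω) (hΦ : 0 ≤ Φ)
    (hQ : Q ≤ (2 * (m : ℝ) + 1) ^ 2 * (((D + 1 : ℕ) : ℝ) * s₂ * Φ))
    (hV : (∫ t in Set.Icc (-s₂) 0, ∑ x ∈ box (D + 1) m, (u t x ^ α) ^ 2)
      / (2 * (m : ℝ) + 1) ^ (D + 1) ≤ a * Q)
    (hF : (∫ t in Set.Icc (-s₂) 0, ∑ b ∈ boxBonds (D + 1) m,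
          ω b * (grad (cutoff G) b ^ 2
          * ((u t b.1 ^ α) ^ 2 + (u t (b.1 + unitVec b.2) ^ α) ^ 2)))
        / (2 * (m : ℝ) + 1) ^ (D + 1)
      ≤ a' * (((2 * (m : ℝ) + 1) ^ 2)⁻¹ * ((1 - (n : ℝ) / m) ^ g)⁻¹ * Ω * Q)) :
    (⨆ t : Set.Icc (-s₁) 0, s₁⁻¹ * avgNorm 2 (box (D + 1) n) (fun x => u t x ^ α) ^ 2)
        ≤ 3 ^ (D + 1) * (9 * a + 4 * a') * ((D + 1 : ℕ) : ℝ) *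
          (α ^ 2 * (Ω / (1 - (n : ℝ) / m) ^ g + (m : ℝ) ^ 2 / (s₂ - s₁)) * (s₂ / s₁) * Φ) ∧
      gradNormSq ω (Set.Icc (-s₁) 0) n (fun t x => u t x ^ α)
        ≤ 3 ^ (D + 1) * (9 * a + 4 * a') * ((D + 1 : ℕ) : ℝ) *
          (α ^ 2 * (Ω / (1 - (n : ℝ) / m) ^ g + (m : ℝ) ^ 2 / (s₂ - s₁)) * (s₂ / s₁) * Φ) := by
  have hs₂ : 0 < s₂ := hs₁.trans hs
  have hss : 0 < s₂ - s₁ := by linarith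
  have hm1 : (1 : ℝ) ≤ m := by exact_mod_cast (by omega : 1 ≤ m)
  have hx0 := one_sub_div_pos hnm
  have hxg : 0 < (1 - (n : ℝ) / m) ^ g := Real.rpow_pos_of_pos hx0 g
  set y := (1 - (n : ℝ) / m) ^ g
  set d : ℝ := ((D + 1 : ℕ) : ℝ) with hd
  have hd0 : 0 ≤ d := Nat.cast_nonneg _
  have hM : (0 : ℝ) < (2 * (m : ℝ) + 1) ^ (D + 1) := by positivity
  obtain ⟨k1, k2⟩ := sup_le_and_gradNormSq_le hω hnm hm hs₁ hs hu hsub hα hG hne le_rfl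
  set J1 := ∫ t in Set.Icc (-s₂) 0, ∑ x ∈ box (D + 1) m, (u t x ^ α) ^ 2
  set J2 := ∫ t in Set.Icc (-s₂) 0, ∑ b ∈ boxBonds (D + 1) m,
          ω b * (grad (cutoff G) b ^ 2
          * ((u t b.1 ^ α) ^ 2 + (u t (b.1 + unitVec b.2) ^ α) ^ 2))
  set M := (2 * (m : ℝ) + 1) ^ (D + 1)
  have hα2 : 1 ≤ α ^ 2 := one_le_pow₀ hα
  have hN9 : (2 * (m : ℝ) + 1) ^ 2 ≤ 9 * (m : ℝ) ^ 2 := by nlinarith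
  have b1 : (s₂ - s₁)⁻¹ * (J1 / M) ≤ 9 * a * d * s₂ * α ^ 2 * Φ * ((m : ℝ) ^ 2 / (s₂ - s₁)) := by
    calc (s₂ - s₁)⁻¹ * (J1 / M) ≤ (s₂ - s₁)⁻¹ * (a * (9 * (m : ℝ) ^ 2 * (d * s₂ * Φ))) := by
          have : a * Q ≤ a * (9 * (m : ℝ) ^ 2 * (d * s₂ * Φ)) :=
            mul_le_mul_of_nonneg_left (hQ.trans (by gcongr)) ha
          exact mul_le_mul_of_nonneg_left (hV.trans this) (by positivity)
      _ = 9 * a * d * s₂ * 1 * Φ * ((m : ℝ) ^ 2 / (s₂ - s₁)) := by ring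
      _ ≤ _ := by gcongr
  have b2 : 4 * α ^ 2 * (J2 / M) ≤ 4 * a' * d * s₂ * α ^ 2 * Φ * (Ω / y) := by
    have h1 : ((2 * (m : ℝ) + 1) ^ 2)⁻¹ * y⁻¹ * Ω * Q
        ≤ ((2 * (m : ℝ) + 1) ^ 2)⁻¹ * y⁻¹ * Ω * ((2 * (m : ℝ) + 1) ^ 2 * (d * s₂ * Φ)) :=
      mul_le_mul_of_nonneg_left hQ (by positivity)
    have h2 : ((2 * (m : ℝ) + 1) ^ 2)⁻¹ * y⁻¹ * Ω * ((2 * (m : ℝ) + 1) ^ 2 * (d * s₂ * Φ))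
        = d * s₂ * Φ * (Ω / y) := by field_simp
    rw [h2] at h1
    have h3 := mul_le_mul_of_nonneg_left (hF.trans (mul_le_mul_of_nonneg_left h1 ha'))
      (by positivity : 0 ≤ 4 * α ^ 2)
    linarith
  have b3 : ((s₂ - s₁)⁻¹ * J1 + 4 * α ^ 2 * J2) / M
      ≤ (9 * a + 4 * a') * d * s₂ * α ^ 2 * Φ * (Ω / y + (m : ℝ) ^ 2 / (s₂ - s₁)) := by
    have e : ((s₂ - s₁)⁻¹ * J1 + 4 * α ^ 2 * J2) / M
        = (s₂ - s₁)⁻¹ * (J1 / M) + 4 * α ^ 2 * (J2 / M) := by ring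
    have t1 : 0 ≤ 4 * a' * d * s₂ * α ^ 2 * Φ * ((m : ℝ) ^ 2 / (s₂ - s₁)) := by positivity
    have t2 : 0 ≤ 9 * a * d * s₂ * α ^ 2 * Φ * (Ω / y) := by positivity
    rw [e]
    linarith
  have fin : s₁⁻¹ * (3 ^ (D + 1) * (((s₂ - s₁)⁻¹ * J1 + 4 * α ^ 2 * J2) / M))
      ≤ 3 ^ (D + 1) * (9 * a + 4 * a') * d *
          (α ^ 2 * (Ω / y + (m : ℝ) ^ 2 / (s₂ - s₁)) * (s₂ / s₁) * Φ) := by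
    have h := mul_le_mul_of_nonneg_left b3 (by positivity : 0 ≤ s₁⁻¹ * 3 ^ (D + 1))
    calc _ = s₁⁻¹ * 3 ^ (D + 1) * (((s₂ - s₁)⁻¹ * J1 + 4 * α ^ 2 * J2) / M) := by ring
      _ ≤ _ := h
      _ = _ := by ring
  exact ⟨k1.trans fin, k2.trans fin⟩

theorem sum_inv_rpow_le {q : ℝ} (hq : 0 < q) (hω : ∀ b, 0 < ω b) (hm : 0 < m) :
    ∑ b ∈ boxBonds (D + 1) m, (ω b)⁻¹ ^ q ≤ ((D : ℝ) + 1) * ((2 * (m : ℝ) + 1) ^ (D + 1)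
      * (avgNorm q (boxBonds (D + 1) m) fun b => (ω b)⁻¹) ^ q) := by
  rw [sum_rpow_eq_card_mul_avgNorm hq (boxBonds_nonempty hm) fun b _ => inv_nonneg.2 (hω b).le,
    ← mul_assoc]
  refine mul_le_mul_of_nonneg_right ?_ (Real.rpow_nonneg (avgNorm_nonneg _ _ _) _)
  have := card_boxBonds_le (D + 1) m
  push_cast at this
  exact this

/-- The `L^∞(L²)` estimate with optimised cutoff. -/
theorem exists_sup_estimate (hD : 1 ≤ D) {p q : ℝ} (hp : 1 < p)
    (hq : ((D + 1 : ℕ) : ℝ) / 2 < q) (hpq : 1 / p + 1 / q < 2 / (((D + 1 : ℕ) : ℝ) - 1)) :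
    ∃ c : ℝ, 1 ≤ c ∧ ∀ ω : Bond (D + 1) → ℝ, (∀ b, 0 < ω b) → ∀ n m : ℕ, n < m → m ≤ 2 * n →
      ∀ s₁ s₂ : ℝ, 0 < s₁ → s₁ < s₂ → ∀ u : ℝ → Vertex (D + 1) → ℝ,
        (∀ t ∈ Set.Icc (-s₂) 0, ∀ x ∈ box (D + 1) m, 0 ≤ u t x) →
        IsSubcaloric ω u (Set.Icc (-s₂) 0) (box (D + 1) m) → ∀ α : ℝ, 1 ≤ α →
      ∀ X : ℝ, X = α ^ 2
          * (avgNorm p (boxBonds (D + 1) m) ω / (1 - (n : ℝ) / m) ^ (2 + 1 / p + 1 / q)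
                + (m : ℝ) ^ 2 / (s₂ - s₁))
          * (s₂ / s₁)
          * (avgNorm q (boxBonds (D + 1) m) (fun b => (ω b)⁻¹)
            * hOneNormSq ω q (Set.Icc (-s₂) 0) m (fun t x => u t x ^ α)) →
      0 ≤ X ∧
        (⨆ t : Set.Icc (-s₁) 0, s₁⁻¹ * avgNorm 2 (box (D + 1) n) (fun x => u t x ^ α) ^ 2)
          ≤ c * X := by
  have hq1 : 1 < q := one_lt_of_half_lt (by omega) hq
  have hq0 : 0 < q := by linarith
  obtain ⟨σ, hσ, hsum, -⟩ := exists_slice_exponent hD hp hpq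
  obtain ⟨C, hC, H⟩ := exists_cutoff_integral_le hσ hp hq1 le_rfl one_pos (zero_add 1) hsum
  set d : ℝ := ((D + 1 : ℕ) : ℝ) with hd
  have hd1 : 1 ≤ d := by rw [hd]; exact_mod_cast (by omega : 1 ≤ D + 1)
  have h3 : (1 : ℝ) ≤ 3 ^ (D + 1) := one_le_pow₀ (by norm_num)
  refine ⟨3 ^ (D + 1) * (9 * 1 + 4 * (C * d)) * d, ?_, ?_⟩
  · have h1 : 1 ≤ C * d := one_le_mul_of_one_le_of_one_le hC hd1
    refine one_le_mul_of_one_le_of_one_le (one_le_mul_of_one_le_of_one_le h3 (by linarith)) hd1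
  intro ω hω n m hnm hm s₁ s₂ hs₁ hs u hu hsub α hα X hX
  have hs₂ : 0 < s₂ := hs₁.trans hs
  have hss : 0 < s₂ - s₁ := by linarith
  have hm0 : 0 < m := by omega
  have hne := boxBonds_nonempty (D := D) hm0
  have hvc : ∀ x ∈ box (D + 1) m, ContinuousOn (fun t => u t x ^ α) (Set.Icc (-s₂) 0) :=
    fun x hx => (continuousOn_of_isSubcaloric hsub hx).rpow_const fun s _ => Or.inr (by linarith)
  have hl : 0 < avgNorm q (boxBonds (D + 1) m) fun b => (ω b)⁻¹ :=
    avgNorm_pos hne fun b _ => inv_pos.2 (hω b)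
  have hQ := sum_inv_rpow_le hq0 hω hm0
  have hΩ := avgNorm_nonneg p (boxBonds (D + 1) m) ω
  have hH := hOneNormSq_nonneg hω q hs₂ m (fun t x => u t x ^ α)
  have hE := integral_energySum_le hω q hs₂ hne hvc
  set l := avgNorm q (boxBonds (D + 1) m) fun b => (ω b)⁻¹ with hldef
  set Ω := avgNorm p (boxBonds (D + 1) m) ω
  set h1 := hOneNormSq ω q (Set.Icc (-s₂) 0) m (fun t x => u t x ^ α)
  have hx0 := one_sub_div_pos hnm
  -- The case `b = 0`, `c = 1`: no auxiliary density, and `w = v = u^α`.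
  obtain ⟨G, hG, hGne, hF⟩ := H ω n m s₂ l (fun _ _ => 1) (fun t x => u t x ^ α)
    (fun t x => u t x ^ α) hω hnm hl hQ (fun _ _ _ _ => zero_le_one)
    (fun _ _ => continuousOn_const) hvc hvc (fun t _ x _ => by simp)
  rw [Real.rpow_zero, mul_one, Real.rpow_one] at hF
  have hM : (0 : ℝ) < (2 * (m : ℝ) + 1) ^ (D + 1) := by positivity
  have hEn : 0 ≤ ∫ t in Set.Icc (-s₂) 0, energySum ω l m fun x => u t x ^ α :=
    integral_nonneg fun t => energySum_nonneg hω hl m _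
  set EE := (∫ t in Set.Icc (-s₂) 0, energySum ω l m fun x => u t x ^ α)
    / (2 * (m : ℝ) + 1) ^ (D + 1) with hEE
  have hEE0 : 0 ≤ EE := div_nonneg hEn hM.le
  have hQ' : (2 * (m : ℝ) + 1) ^ 2 * (l * EE) ≤ (2 * (m : ℝ) + 1) ^ 2 * (d * s₂ * (l * h1)) := by
    refine mul_le_mul_of_nonneg_left ?_ (by positivity)
    have := mul_le_mul_of_nonneg_left hE hl.le
    linarith
  -- The zeroth-order part of the energy alone controls the `L²` norm, with constant one after
  -- multiplication by `(2m+1)² l`.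
  have hV : (∫ t in Set.Icc (-s₂) 0, ∑ x ∈ box (D + 1) m, (u t x ^ α) ^ 2)
      / (2 * (m : ℝ) + 1) ^ (D + 1) ≤ 1 * ((2 * (m : ℝ) + 1) ^ 2 * (l * EE)) := by
    rw [one_mul, hEE, mul_div_assoc', mul_div_assoc']
    refine div_le_div_of_nonneg_right ?_ hM.le
    rw [← integral_const_mul, ← integral_const_mul]
    refine integral_mono_of_nonneg (Filter.Eventually.of_forall fun t =>
      Finset.sum_nonneg fun x _ => sq_nonneg _)
      ((((continuousOn_energySum hvc).integrableOn_Icc).const_mul _).const_mul _)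
      (Filter.Eventually.of_forall fun t => ?_)
    change _ ≤ (2 * (m : ℝ) + 1) ^ 2 * (l * energySum ω l m (fun x => u t x ^ α))
    have h0 : 0 ≤ ∑ b ∈ boxBonds (D + 1) m, ω b * grad (fun x => u t x ^ α) b ^ 2 :=
      Finset.sum_nonneg fun b _ => mul_nonneg (hω b).le (sq_nonneg _)
    rw [energySum, ← mul_assoc, mul_add]
    have e : (2 * (m : ℝ) + 1) ^ 2 * l * (((2 * (m : ℝ) + 1) ^ 2 * l)⁻¹
        * ∑ x ∈ box (D + 1) m, (u t x ^ α) ^ 2) = ∑ x ∈ box (D + 1) m, (u t x ^ α) ^ 2 := by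
      field_simp
    rw [e]
    exact le_add_of_nonneg_left (by positivity)
  have hF' : (∫ t in Set.Icc (-s₂) 0, ∑ b ∈ boxBonds (D + 1) m,
          ω b * (grad (cutoff G) b ^ 2
          * ((u t b.1 ^ α) ^ 2 + (u t (b.1 + unitVec b.2) ^ α) ^ 2)))
        / (2 * (m : ℝ) + 1) ^ (D + 1)
      ≤ C * d * (((2 * (m : ℝ) + 1) ^ 2)⁻¹ * ((1 - (n : ℝ) / m) ^ (2 + 1 / p + 1 / q))⁻¹ * Ω
        * ((2 * (m : ℝ) + 1) ^ 2 * (l * EE))) := by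
    rw [div_le_iff₀ hM]
    refine hF.trans ?_
    have hP := mean_rpow_le_avgNorm hp hω hm0
    have hxg : 0 < (1 - (n : ℝ) / m) ^ (2 + 1 / p + 1 / q) := Real.rpow_pos_of_pos hx0 _
    calc _ ≤ C * ((2 * (m : ℝ) + 1) ^ (D + 1) / (2 * (m : ℝ) + 1) ^ 2
            * ((1 - (n : ℝ) / m) ^ (2 + 1 / p + 1 / q))⁻¹
            * (d * Ω * ((2 * (m : ℝ) + 1) ^ 2 * (l * EE)))) := by gcongr
      _ = _ := by ring
  have key := (sup_le_and_gradNormSq_le_of_bounds hω hnm hm hs₁ hs hu hsub hα hG hGne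
    zero_le_one (by positivity) hΩ (mul_nonneg hl.le hH) hQ' hV hF').1
  refine ⟨?_, ?_⟩
  · rw [hX]
    have hxg : 0 < (1 - (n : ℝ) / m) ^ (2 + 1 / p + 1 / q) := Real.rpow_pos_of_pos hx0 _
    positivity
  · rw [hX]; exact key

end Optimised

/-! ### Interpolation and estimate (i) -/

section Interpolated

variable {D : ℕ} {ω : Bond (D + 1) → ℝ} {n m : ℕ} {s₁ s₂ : ℝ} {u : ℝ → Vertex (D + 1) → ℝ}

theorem mean_sq_le_mul_iSup {s : ℝ} (hs : 0 < s) {v : ℝ → Vertex (D + 1) → ℝ}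
    (hv : ∀ x ∈ box (D + 1) m, ContinuousOn (fun t => v t x) (Set.Icc (-s) 0)) {t : ℝ}
    (ht : t ∈ Set.Icc (-s) 0) :
    (∑ x ∈ box (D + 1) m, v t x ^ 2) / (2 * (m : ℝ) + 1) ^ (D + 1)
      ≤ s * ⨆ t : Set.Icc (-s) 0, s⁻¹ * avgNorm 2 (box (D + 1) m) (v t) ^ 2 := by
  have e : ∀ t, avgNorm 2 (box (D + 1) m) (v t) ^ 2
      = (∑ x ∈ box (D + 1) m, v t x ^ 2) / (2 * (m : ℝ) + 1) ^ (D + 1) := fun t => by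
    rw [avgNorm_two_sq, card_box, inv_mul_eq_div]; push_cast; rfl
  have hc : ContinuousOn (fun t => s⁻¹ * avgNorm 2 (box (D + 1) m) (v t) ^ 2)
      (Set.Icc (-s) 0) := by
    simp only [e]
    exact continuousOn_const.mul ((continuousOn_finsetSum _ fun x hx => (hv x hx).pow 2).div_const _)
  -- Boundedness, from continuity on a compact interval, is essential: an unbounded real supremum
  -- has the default value `0`.
  have hbdd : BddAbove (Set.range fun t : Set.Icc (-s) 0 =>
      s⁻¹ * avgNorm 2 (box (D + 1) m) (v t) ^ 2) := by
    have h := (isCompact_Icc.image_of_continuousOn hc).bddAbove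
    rwa [Set.image_eq_range] at h
  have h := le_ciSup hbdd ⟨t, ht⟩
  have h' := mul_le_mul_of_nonneg_left h hs.le
  rw [mul_inv_cancel_left₀ hs.ne', e] at h'
  exact h'

/-- The exponents `2α(1-ν)` and `2αν` add up to `2α`. At `U = 0` both sides vanish, which uses `αν >
0`. -/
theorem sq_rpow_eq {U α ν : ℝ} (hU : 0 ≤ U) (hα : 0 < α) (hν : 0 < ν) :
    (U ^ α) ^ 2 = ((U ^ α) ^ 2) ^ (1 - ν) * (U ^ (α * ν)) ^ 2 := by
  rcases hU.eq_or_lt with rfl | hU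
  · rw [Real.zero_rpow hα.ne', Real.zero_rpow (mul_pos hα hν).ne']; simp
  · simp only [← Real.rpow_natCast, ← Real.rpow_mul hU.le]
    rw [← Real.rpow_add hU]
    congr 1
    push_cast; ring

/-- With `κ = 1/θ` and `δ = δ₂` the resulting exponent `δ (1 - κ)` is `1 - ν`. It is used pointwise
to factor `u^(2α)`, and again for the integrated norms. -/
theorem rpow_mul_rpow_interpolation {a B δ κ : ℝ} (ha : 0 ≤ a) (hB : 0 ≤ B) (hκ : 0 ≤ κ)
    (hκ1 : κ ≤ 1) : (a ^ δ * B) ^ (1 - κ) * B ^ κ = a ^ (δ * (1 - κ)) * B := by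
  rw [Real.mul_rpow (Real.rpow_nonneg ha _) hB, ← Real.rpow_mul ha, mul_assoc,
    ← Real.rpow_add_of_nonneg hB (by linarith) hκ, sub_add_cancel, Real.rpow_one]

/-- The zeroth-order part of the `H¹` norm on a smaller cylinder. -/
theorem hOneNormSq_le_of_bounds {p q : ℝ} (hp : 1 < p) (hq : 1 < q) (hω : ∀ b, 0 < ω b)
    (hnm : n < m) (hm : m ≤ 2 * n) (hs₁ : 0 < s₁) (hs : s₁ < s₂) {v : ℝ → Vertex (D + 1) → ℝ}
    (hv : ∀ x ∈ box (D + 1) m, ContinuousOn (fun t => v t x) (Set.Icc (-s₂) 0)) {a Q Φ : ℝ}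
    (ha : 0 ≤ a) (hQ : Q ≤ (2 * (m : ℝ) + 1) ^ 2 * (((D + 1 : ℕ) : ℝ) * s₂ * Φ))
    (hV : (∫ t in Set.Icc (-s₂) 0, ∑ x ∈ box (D + 1) m, v t x ^ 2)
      / (2 * (m : ℝ) + 1) ^ (D + 1) ≤ a * Q) :
    hOneNormSq ω q (Set.Icc (-s₁) 0) n v ≤ 9 * (3 ^ (D + 1)) ^ 2 * ((D + 1 : ℕ) : ℝ) ^ 2 * a
      * (avgNorm p (boxBonds (D + 1) m) ω * (s₂ / s₁) * Φ)
      + gradNormSq ω (Set.Icc (-s₁) 0) n v := by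
  have hn : 0 < n := by omega
  have hs₂ : 0 < s₂ := hs₁.trans hs
  have hmn : (m : ℝ) ≤ 2 * n := by exact_mod_cast hm
  have hL : (avgNorm q (boxBonds (D + 1) n) fun b => (ω b)⁻¹)⁻¹
      ≤ 3 ^ (D + 1) * ((D + 1 : ℕ) : ℝ) * avgNorm p (boxBonds (D + 1) m) ω :=
    (inv_avgNorm_inv_le hp hq (boxBonds_nonempty hn) hω).trans
      (avgNorm_le_of_le_two_mul hp hω hnm hm)
  have hL0 : 0 ≤ (avgNorm q (boxBonds (D + 1) n) fun b => (ω b)⁻¹)⁻¹ :=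
    inv_nonneg.2 (avgNorm_nonneg _ _ _)
  have hN : ((2 * (n : ℝ) + 1) ^ 2)⁻¹ ≤ 9 * ((2 * (m : ℝ) + 1) ^ 2)⁻¹ := by
    rw [← div_eq_mul_inv, inv_le_comm₀ (by positivity) (by positivity), inv_div,
      div_le_iff₀ (by norm_num)]
    nlinarith [(Nat.cast_nonneg m : (0 : ℝ) ≤ m)]
  have hcont : ContinuousOn (fun t => ∑ x ∈ box (D + 1) m, v t x ^ 2) (Set.Icc (-s₂) 0) :=
    continuousOn_finsetSum _ fun x hx => (hv x hx).pow 2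
  have hJ : ∫ t in Set.Icc (-s₁) 0, ∑ x ∈ box (D + 1) n, v t x ^ 2
      ≤ ∫ t in Set.Icc (-s₂) 0, ∑ x ∈ box (D + 1) m, v t x ^ 2 := by
    have hsub : Set.Icc (-s₁) 0 ⊆ Set.Icc (-s₂) 0 := Set.Icc_subset_Icc (by linarith) le_rfl
    refine (integral_mono_of_nonneg (Filter.Eventually.of_forall fun t =>
      Finset.sum_nonneg fun x _ => sq_nonneg _) (hcont.mono hsub).integrableOn_Icc
      (Filter.Eventually.of_forall fun t => Finset.sum_le_sum_of_subset_of_nonneg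
        (box_mono hnm.le) fun x _ _ => sq_nonneg _)).trans ?_
    exact setIntegral_mono_set hcont.integrableOn_Icc (Filter.Eventually.of_forall fun t =>
      Finset.sum_nonneg fun x _ => sq_nonneg _) hsub.eventuallyLE
  have hJ0 : 0 ≤ ∫ t in Set.Icc (-s₂) 0, ∑ x ∈ box (D + 1) m, v t x ^ 2 :=
    integral_nonneg fun t => Finset.sum_nonneg fun b _ => sq_nonneg _
  have hJ1 : 0 ≤ ∫ t in Set.Icc (-s₁) 0, ∑ x ∈ box (D + 1) n, v t x ^ 2 :=
    integral_nonneg fun t => Finset.sum_nonneg fun b _ => sq_nonneg _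
  have hcard : ((2 * (n : ℝ) + 1) ^ (D + 1))⁻¹
      ≤ 3 ^ (D + 1) * ((2 * (m : ℝ) + 1) ^ (D + 1))⁻¹ := by
    rw [← div_eq_mul_inv, inv_le_comm₀ (by positivity) (by positivity), inv_div,
      div_le_iff₀ (by positivity)]
    linarith [(le_three_pow_mul_card (D := D) hnm hm).2]
  have hΩ := avgNorm_nonneg p (boxBonds (D + 1) m) ω
  rw [hOneNormSq, card_box_rpow, integral_avgNorm_two_sq_eq hs₁]
  refine add_le_add_left ?_ _
  set J := ∫ t in Set.Icc (-s₂) 0, ∑ x ∈ box (D + 1) m, v t x ^ 2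
  set M := (2 * (m : ℝ) + 1) ^ (D + 1)
  set Ω := avgNorm p (boxBonds (D + 1) m) ω
  set d : ℝ := ((D + 1 : ℕ) : ℝ)
  have hJM : J / M ≤ a * ((2 * (m : ℝ) + 1) ^ 2 * (d * s₂ * Φ)) :=
    hV.trans (mul_le_mul_of_nonneg_left hQ ha)
  have hN0 : (0 : ℝ) < (2 * (m : ℝ) + 1) ^ 2 := by positivity
  calc _ ≤ 9 * ((2 * (m : ℝ) + 1) ^ 2)⁻¹ * (3 ^ (D + 1) * d * Ω)
        * (s₁⁻¹ * (3 ^ (D + 1) * M⁻¹ * J)) := by gcongr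
    _ = 9 * ((2 * (m : ℝ) + 1) ^ 2)⁻¹ * (3 ^ (D + 1) * d * Ω)
        * (s₁⁻¹ * (3 ^ (D + 1) * (J / M))) := by ring
    _ ≤ 9 * ((2 * (m : ℝ) + 1) ^ 2)⁻¹ * (3 ^ (D + 1) * d * Ω)
        * (s₁⁻¹ * (3 ^ (D + 1) * (a * ((2 * (m : ℝ) + 1) ^ 2 * (d * s₂ * Φ))))) := by
        gcongr
    _ = _ := by field_simp

/-- The one-step improvement of the `L^∞(L²)` and `H¹` norms of a power of a subcaloric
function. -/
theorem exists_hOne_estimate (hD : 1 ≤ D) {p q : ℝ} (hp : 1 < p)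
    (hq : ((D + 1 : ℕ) : ℝ) / 2 < q) (hpq : 1 / p + 1 / q < 2 / (((D + 1 : ℕ) : ℝ) - 1)) :
    ∃ c : ℝ, 1 ≤ c ∧ ∀ ω : Bond (D + 1) → ℝ, (∀ b, 0 < ω b) → ∀ n m : ℕ, n < m → m ≤ 2 * n →
      ∀ s₁ s₂ : ℝ, 0 < s₁ → s₁ < s₂ → ∀ u : ℝ → Vertex (D + 1) → ℝ,
        (∀ t ∈ Set.Icc (-s₂) 0, ∀ x ∈ box (D + 1) m, 0 ≤ u t x) →
        IsSubcaloric ω u (Set.Icc (-s₂) 0) (box (D + 1) m) → ∀ α : ℝ, 1 ≤ α →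
      ∀ X : ℝ, X = α ^ 2
          * (avgNorm p (boxBonds (D + 1) m) ω / (1 - (n : ℝ) / m) ^ gam (D + 1) p q
                + (m : ℝ) ^ 2 / (s₂ - s₁))
          * (s₂ / s₁)
          * (s₂ ^ (1 - nu (D + 1) p q) * (⨆ t : Set.Icc (-s₂) 0,
                s₂⁻¹ * avgNorm 2 (box (D + 1) m) (fun x => u t x ^ α) ^ 2) ^ (1 - nu (D + 1) p q)
            * (avgNorm q (boxBonds (D + 1) m) (fun b => (ω b)⁻¹)
            * hOneNormSq ω q (Set.Icc (-s₂) 0) m (fun t x => u t x ^ (α * nu (D + 1) p q)))) →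
      0 ≤ X ∧
        (⨆ t : Set.Icc (-s₁) 0, s₁⁻¹ * avgNorm 2 (box (D + 1) n) (fun x => u t x ^ α) ^ 2)
          + hOneNormSq ω q (Set.Icc (-s₁) 0) n (fun t x => u t x ^ α) ≤ c * X := by
  have hq1 : 1 < q := one_lt_of_half_lt (by omega) hq
  have hq0 : 0 < q := by linarith
  obtain ⟨σ, hσ, -, hsum⟩ := exists_slice_exponent hD hp hpq
  have hθ := one_lt_theta hp hpq
  have hν := nu_mem_Ioo (by omega : 2 ≤ D + 1) hp hq hpq
  have hδ := deltaTwo_pos (by omega : 2 ≤ D + 1) hq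
  have hγ2 := two_lt_gam hp hq1 hpq
  have hνeq : 1 - nu (D + 1) p q
      = deltaTwo (D + 1) q * (1 - 1 / theta (D + 1) p q) := by unfold nu; ring
  have hγeq : gam (D + 1) p q = 2 + 1 / p + 1 / theta (D + 1) p q / q := by
    unfold gam; rw [div_div]
  set θ := theta (D + 1) p q
  set ν := nu (D + 1) p q
  set γ := gam (D + 1) p q
  set δ := deltaTwo (D + 1) q with hδdef
  have hκ : 0 < 1 / θ := by positivity
  have hκ1 : 1 / θ < 1 := by rw [div_lt_one (by linarith)]; exact hθ
  obtain ⟨C, hC, H⟩ := exists_cutoff_integral_le hσ hp hq1 (by linarith : 0 ≤ 1 - 1 / θ) hκ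
    (sub_add_cancel _ _) hsum
  obtain ⟨C₁, hC₁, H₁⟩ := exists_integral_interpolation_le hD hq
  rw [← hγeq] at H
  set κ := 1 / θ
  set d : ℝ := ((D + 1 : ℕ) : ℝ) with hd
  have hd1 : 1 ≤ d := by rw [hd]; exact_mod_cast (by omega : 1 ≤ D + 1)
  have h3 : (1 : ℝ) ≤ 3 ^ (D + 1) := one_le_pow₀ (by norm_num)
  have hc0 : (0 : ℝ) ≤ 9 * (3 ^ (D + 1)) ^ 2 * d ^ 2 * C₁ := by positivity
  refine ⟨2 * (3 ^ (D + 1) * (9 * C₁ + 4 * (C * C₁ * d)) * d) + 9 * (3 ^ (D + 1)) ^ 2 * d ^ 2 * C₁,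
    ?_, ?_⟩
  · have h1 : 1 ≤ C * C₁ * d :=
      one_le_mul_of_one_le_of_one_le (one_le_mul_of_one_le_of_one_le hC hC₁) hd1
    have h2 : 1 ≤ 3 ^ (D + 1) * (9 * C₁ + 4 * (C * C₁ * d)) * d :=
      one_le_mul_of_one_le_of_one_le (one_le_mul_of_one_le_of_one_le h3 (by linarith)) hd1
    linarith
  intro ω hω n m hnm hm s₁ s₂ hs₁ hs u hu hsub α hα X hX
  have hs₂ : 0 < s₂ := hs₁.trans hs
  have hss : 0 < s₂ - s₁ := by linarith
  have hα0 : 0 < α := by linarith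
  have hm0 : 0 < m := by omega
  have hne := boxBonds_nonempty (D := D) hm0
  have hvc : ∀ x ∈ box (D + 1) m, ContinuousOn (fun t => u t x ^ α) (Set.Icc (-s₂) 0) :=
    fun x hx => (continuousOn_of_isSubcaloric hsub hx).rpow_const fun s _ => Or.inr (by linarith)
  have hwc : ∀ x ∈ box (D + 1) m, ContinuousOn (fun t => u t x ^ (α * ν)) (Set.Icc (-s₂) 0) :=
    fun x hx => (continuousOn_of_isSubcaloric hsub hx).rpow_const
      fun s _ => Or.inr (mul_nonneg hα0.le hν.1.le)
  have hl : 0 < avgNorm q (boxBonds (D + 1) m) fun b => (ω b)⁻¹ :=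
    avgNorm_pos hne fun b _ => inv_pos.2 (hω b)
  have hQ := sum_inv_rpow_le hq0 hω hm0
  have hΩ := avgNorm_nonneg p (boxBonds (D + 1) m) ω
  have hH := hOneNormSq_nonneg hω q hs₂ m (fun t x => u t x ^ (α * ν))
  have hE := integral_energySum_le hω q hs₂ hne hwc
  have hVt := fun t (ht : t ∈ Set.Icc (-s₂) 0) => mean_sq_le_mul_iSup (m := m) hs₂ hvc ht
  have hS : 0 ≤ ⨆ t : Set.Icc (-s₂) 0,
      s₂⁻¹ * avgNorm 2 (box (D + 1) m) (fun x => u t x ^ α) ^ 2 :=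
    Real.iSup_nonneg fun t => by positivity
  rw [← Real.mul_rpow hs₂.le hS] at hX
  set V := s₂ * ⨆ t : Set.Icc (-s₂) 0,
      s₂⁻¹ * avgNorm 2 (box (D + 1) m) (fun x => u t x ^ α) ^ 2
  have hV0 : 0 ≤ V := mul_nonneg hs₂.le hS
  set l := avgNorm q (boxBonds (D + 1) m) fun b => (ω b)⁻¹ with hldef
  set Ω := avgNorm p (boxBonds (D + 1) m) ω with hΩdef
  set h1 := hOneNormSq ω q (Set.Icc (-s₂) 0) m (fun t x => u t x ^ (α * ν))
  have hx0 := one_sub_div_pos hnm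
  -- The splitting `v² = A^(1-κ) (w²)^κ` with `A = (v²)^δ₂ w²`.
  have hvA : ∀ t ∈ Set.Icc (-s₂) 0, ∀ x ∈ box (D + 1) m, (u t x ^ α) ^ 2
      = (((u t x ^ α) ^ 2) ^ δ * (u t x ^ (α * ν)) ^ 2) ^ (1 - κ)
        * ((u t x ^ (α * ν)) ^ 2) ^ κ := fun t ht x hx => by
    rw [rpow_mul_rpow_interpolation (sq_nonneg _) (sq_nonneg _) hκ.le hκ1.le, ← hνeq]
    exact sq_rpow_eq (hu t ht x hx) hα0 hν.1
  obtain ⟨G, hG, hGne, hF⟩ := H ω n m s₂ l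
    (fun t x => ((u t x ^ α) ^ 2) ^ δ * (u t x ^ (α * ν)) ^ 2) (fun t x => u t x ^ α)
    (fun t x => u t x ^ (α * ν)) hω hnm hl hQ
    (fun t _ x _ => mul_nonneg (Real.rpow_nonneg (sq_nonneg _) _) (sq_nonneg _))
    (fun x hx => (((hvc x hx).pow 2).rpow_const fun _ _ => Or.inr hδ.le).mul ((hwc x hx).pow 2))
    hvc hwc hvA
  -- The interpolation inequality is used twice: at the endpoint exponent `δ₂` it bounds the
  -- integral of `A`, and below, at `1 - ν`, the `L²` norm of `u^α` itself.
  have hIA := H₁ ω m s₂ l (fun t x => u t x ^ α) (fun t x => u t x ^ (α * ν)) δ V hω hl hQ hwc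
    hδ.le le_rfl hVt
  have hνδ : 1 - ν ≤ δ := by rw [hνeq]; nlinarith
  have hIv := H₁ ω m s₂ l (fun t x => u t x ^ α) (fun t x => u t x ^ (α * ν)) (1 - ν) V hω hl hQ
    hwc (by linarith [hν.2]) hνδ hVt
  have hcongr : ∫ t in Set.Icc (-s₂) 0, ∑ x ∈ box (D + 1) m,
        ((u t x ^ α) ^ 2) ^ (1 - ν) * (u t x ^ (α * ν)) ^ 2
      = ∫ t in Set.Icc (-s₂) 0, ∑ x ∈ box (D + 1) m, (u t x ^ α) ^ 2 :=
    setIntegral_congr_fun measurableSet_Icc fun t ht => Finset.sum_congr rfl fun x hx =>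
      (sq_rpow_eq (hu t ht x hx) hα0 hν.1).symm
  rw [hcongr] at hIv
  have hM : (0 : ℝ) < (2 * (m : ℝ) + 1) ^ (D + 1) := by positivity
  have hEn : 0 ≤ ∫ t in Set.Icc (-s₂) 0, energySum ω l m fun x => u t x ^ (α * ν) :=
    integral_nonneg fun t => energySum_nonneg hω hl m _
  have hA0 : 0 ≤ (∫ t in Set.Icc (-s₂) 0, ∑ x ∈ box (D + 1) m,
      ((u t x ^ α) ^ 2) ^ δ * (u t x ^ (α * ν)) ^ 2) / (2 * (m : ℝ) + 1) ^ (D + 1) :=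
    div_nonneg (integral_nonneg fun t => Finset.sum_nonneg fun x _ =>
      mul_nonneg (Real.rpow_nonneg (sq_nonneg _) _) (sq_nonneg _)) hM.le
  set IA := (∫ t in Set.Icc (-s₂) 0, ∑ x ∈ box (D + 1) m,
      ((u t x ^ α) ^ 2) ^ δ * (u t x ^ (α * ν)) ^ 2) / (2 * (m : ℝ) + 1) ^ (D + 1)
  set EE := (∫ t in Set.Icc (-s₂) 0, energySum ω l m fun x => u t x ^ (α * ν))
    / (2 * (m : ℝ) + 1) ^ (D + 1) with hEE
  have hEE0 : 0 ≤ EE := div_nonneg hEn hM.le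
  set K := (2 * (m : ℝ) + 1) ^ 2 * (l * EE) with hK
  have hK0 : 0 ≤ K := by positivity
  have hVν : 0 ≤ V ^ (1 - ν) := Real.rpow_nonneg hV0 _
  have hQ' : V ^ (1 - ν) * K
      ≤ (2 * (m : ℝ) + 1) ^ 2 * (d * s₂ * (V ^ (1 - ν) * (l * h1))) := by
    calc V ^ (1 - ν) * K = (2 * (m : ℝ) + 1) ^ 2 * (V ^ (1 - ν) * l * EE) := by rw [hK]; ring
      _ ≤ (2 * (m : ℝ) + 1) ^ 2 * (V ^ (1 - ν) * l * (d * s₂ * h1)) := by gcongr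
      _ = _ := by ring
  -- The powers recombine: `V^(δ₂ (1-κ)) = V^(1-ν)` and `K` reappears to the first power.
  have hmix : IA ^ (1 - κ) * K ^ κ ≤ C₁ * (V ^ (1 - ν) * K) := by
    have hVδ : 0 ≤ V ^ δ * K := mul_nonneg (Real.rpow_nonneg hV0 _) hK0
    have hC1 : C₁ ^ (1 - κ) ≤ C₁ := by
      calc C₁ ^ (1 - κ) ≤ C₁ ^ (1 : ℝ) :=
            Real.rpow_le_rpow_of_exponent_le hC₁ (by linarith)
        _ = C₁ := Real.rpow_one _
    calc IA ^ (1 - κ) * K ^ κ ≤ (C₁ * (V ^ δ * K)) ^ (1 - κ) * K ^ κ := by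
          gcongr
      _ = C₁ ^ (1 - κ) * ((V ^ δ * K) ^ (1 - κ) * K ^ κ) := by
          rw [Real.mul_rpow (by linarith) hVδ]; ring
      _ = C₁ ^ (1 - κ) * (V ^ (1 - ν) * K) := by
          rw [rpow_mul_rpow_interpolation hV0 hK0 hκ.le hκ1.le, ← hνeq]
      _ ≤ _ := mul_le_mul_of_nonneg_right hC1 (mul_nonneg hVν hK0)
  have hxg : 0 < (1 - (n : ℝ) / m) ^ γ := Real.rpow_pos_of_pos hx0 _
  have hF' : (∫ t in Set.Icc (-s₂) 0, ∑ b ∈ boxBonds (D + 1) m,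
          ω b * (grad (cutoff G) b ^ 2
          * ((u t b.1 ^ α) ^ 2 + (u t (b.1 + unitVec b.2) ^ α) ^ 2)))
        / (2 * (m : ℝ) + 1) ^ (D + 1)
      ≤ C * C₁ * d * (((2 * (m : ℝ) + 1) ^ 2)⁻¹ * ((1 - (n : ℝ) / m) ^ γ)⁻¹ * Ω
        * (V ^ (1 - ν) * K)) := by
    rw [div_le_iff₀ hM]
    refine hF.trans ?_
    have hP := mean_rpow_le_avgNorm hp hω hm0
    have hP0 : 0 ≤ ((∑ b ∈ boxBonds (D + 1) m, ω b ^ p) / (2 * (m : ℝ) + 1) ^ (D + 1)) ^ (1 / p) :=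
      Real.rpow_nonneg (div_nonneg (Finset.sum_nonneg fun b _ =>
        Real.rpow_nonneg (hω b).le _) hM.le) _
    have h4 := mul_le_mul hP hmix (mul_nonneg (Real.rpow_nonneg hA0 _) (Real.rpow_nonneg hK0 _))
      (mul_nonneg (Nat.cast_nonneg _) hΩ)
    calc _ = C * ((2 * (m : ℝ) + 1) ^ (D + 1) / (2 * (m : ℝ) + 1) ^ 2
            * ((1 - (n : ℝ) / m) ^ γ)⁻¹) * ((((∑ b ∈ boxBonds (D + 1) m, ω b ^ p)
              / (2 * (m : ℝ) + 1) ^ (D + 1)) ^ (1 / p)) * (IA ^ (1 - κ) * K ^ κ)) := by ring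
      _ ≤ C * ((2 * (m : ℝ) + 1) ^ (D + 1) / (2 * (m : ℝ) + 1) ^ 2
            * ((1 - (n : ℝ) / m) ^ γ)⁻¹) * (d * Ω * (C₁ * (V ^ (1 - ν) * K))) :=
          mul_le_mul_of_nonneg_left h4 (by positivity)
      _ = _ := by ring
  have hC10 : 0 ≤ C₁ := by linarith
  obtain ⟨k1, k2⟩ := sup_le_and_gradNormSq_le_of_bounds hω hnm hm hs₁ hs hu hsub hα hG hGne
    hC10 (by positivity) hΩ (mul_nonneg hVν (mul_nonneg hl.le hH)) hQ' hIv hF'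
  have k3 := hOneNormSq_le_of_bounds hp hq1 hω hnm hm hs₁ hs hvc hC10 hQ' hIv
  have hΦ : 0 ≤ V ^ (1 - ν) * (l * h1) := mul_nonneg hVν (mul_nonneg hl.le hH)
  have hy1 : (1 - (n : ℝ) / m) ^ γ ≤ 1 :=
    Real.rpow_le_one hx0.le one_sub_div_le_one (by linarith)
  -- The zeroth-order part of the `H¹` norm on the small cylinder costs only `Ω`, which is dominated
  -- because `1 - n/m ≤ 1`, `γ > 0` and `α ≥ 1`.
  have hΩX : Ω * (s₂ / s₁) * (V ^ (1 - ν) * (l * h1)) ≤ X := by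
    rw [hX]
    refine mul_le_mul_of_nonneg_right (mul_le_mul_of_nonneg_right ?_ (by positivity)) hΦ
    calc Ω ≤ Ω / (1 - (n : ℝ) / m) ^ γ := le_div_self hΩ hxg hy1
      _ ≤ Ω / (1 - (n : ℝ) / m) ^ γ + (m : ℝ) ^ 2 / (s₂ - s₁) :=
          le_add_of_nonneg_right (by positivity)
      _ ≤ _ := le_mul_of_one_le_left (by positivity) (one_le_pow₀ hα)
  rw [← hX] at k1 k2
  refine ⟨le_trans (by positivity) hΩX, ?_⟩
  have k4 := mul_le_mul_of_nonneg_left hΩX hc0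
  linarith

end Interpolated

/-! ### Conclusion -/

theorem lemma2 (d : ℕ) (hd : 2 ≤ d) (p q : ℝ) (hp : 1 < p) (hq : (d : ℝ) / 2 < q)
    (hpq : 1 / p + 1 / q < 2 / ((d : ℝ) - 1)) :
    (0 < deltaOne d p q ∧ 0 < deltaTwo d q ∧ 1 < theta d p q ∧
      nu d p q ∈ Set.Ioo (0 : ℝ) 1 ∧ 2 < gam d p q) ∧
    ∃ c : ℝ, 1 ≤ c ∧
      ∀ ω : Bond d → ℝ, (∀ b, 0 < ω b) →
      ∀ n m : ℕ, n < m → m ≤ 2 * n →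
      ∀ s₁ s₂ : ℝ, 0 < s₁ → s₁ < s₂ →
      ∀ u : ℝ → Vertex d → ℝ,
        (∀ t ∈ Set.Icc (-s₂) 0, ∀ x ∈ box d m, 0 ≤ u t x) →
        IsSubcaloric ω u (Set.Icc (-s₂) 0) (box d m) →
      ∀ α : ℝ, 1 ≤ α →
        ((⨆ t : Set.Icc (-s₁) 0, s₁⁻¹ * avgNorm 2 (box d n) (fun x => u t x ^ α) ^ 2)
            + hOneNormSq ω q (Set.Icc (-s₁) 0) n (fun t x => u t x ^ α)
          ≤ c * α ^ 2
            * (⨆ t : Set.Icc (-s₂) 0,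
                s₂⁻¹ * avgNorm 2 (box d m) (fun x => u t x ^ α) ^ 2) ^ (1 - nu d p q)
            * s₂ ^ (1 - nu d p q)
            * avgNorm q (boxBonds d m) (fun b => (ω b)⁻¹)
            * (avgNorm p (boxBonds d m) ω / (1 - (n : ℝ) / m) ^ gam d p q
                + (m : ℝ) ^ 2 / (s₂ - s₁))
            * (s₂ / s₁)
            * hOneNormSq ω q (Set.Icc (-s₂) 0) m (fun t x => u t x ^ (α * nu d p q)))
        ∧ ((⨆ t : Set.Icc (-s₁) 0, s₁⁻¹ * avgNorm 2 (box d n) (fun x => u t x ^ α) ^ 2)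
            + gradNormSq ω (Set.Icc (-s₁) 0) n (fun t x => u t x ^ α)
          ≤ c * α ^ 2 / (m : ℝ) ^ 2
            * (avgNorm p (boxBonds d m) ω / (1 - (n : ℝ) / m) ^ 2
                + (m : ℝ) ^ 2 / (s₂ - s₁))
            * (s₂ / s₁)
            * ⨍ t in Set.Icc (-s₂) 0,
                avgNorm (2 * p / (p - 1)) (box d m) (fun x => u t x ^ α) ^ 2)
        ∧ ((⨆ t : Set.Icc (-s₁) 0, s₁⁻¹ * avgNorm 2 (box d n) (fun x => u t x ^ α) ^ 2)
          ≤ c * α ^ 2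
            * avgNorm q (boxBonds d m) (fun b => (ω b)⁻¹)
            * (avgNorm p (boxBonds d m) ω / (1 - (n : ℝ) / m) ^ (2 + 1 / p + 1 / q)
                + (m : ℝ) ^ 2 / (s₂ - s₁))
            * (s₂ / s₁)
            * hOneNormSq ω q (Set.Icc (-s₂) 0) m (fun t x => u t x ^ α)) := by
  refine ⟨⟨deltaOne_pos hpq, deltaTwo_pos hd hq, one_lt_theta hp hpq, nu_mem_Ioo hd hp hq hpq,
    two_lt_gam hp (one_lt_of_half_lt hd hq) hpq⟩, ?_⟩
  -- `D ≥ 1` is the dimension of the slices.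
  obtain ⟨D, rfl⟩ : ∃ D, d = D + 1 := ⟨d - 1, by omega⟩
  obtain ⟨c₁, hc₁, H₁⟩ := exists_hOne_estimate (by omega) hp hq hpq
  obtain ⟨c₃, hc₃, H₃⟩ := exists_sup_estimate (by omega) hp hq hpq
  set c₂ : ℝ := 16 * ((D + 1 : ℕ) : ℝ) * 3 ^ (D + 1)
  have hc₂ : 0 ≤ c₂ := by positivity
  refine ⟨c₁ + c₂ + c₃, by linarith, ?_⟩
  intro ω hω n m hnm hm s₁ s₂ hs₁ hs u hu hsub α hα
  obtain ⟨x₁, h₁⟩ := H₁ ω hω n m hnm hm s₁ s₂ hs₁ hs u hu hsub α hα _ rfl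
  obtain ⟨x₂, h₂⟩ := energy_estimate hp hω hnm hm hs₁ hs hu hsub hα rfl
  obtain ⟨x₃, h₃⟩ := H₃ ω hω n m hnm hm s₁ s₂ hs₁ hs u hu hsub α hα _ rfl
  -- Enlarging each constant to the common sum is legitimate because all three right-hand sides are
  -- nonnegative.
  have l₁ : c₁ ≤ c₁ + c₂ + c₃ := by linarith
  have l₂ : c₂ ≤ c₁ + c₂ + c₃ := by linarith
  have l₃ : c₃ ≤ c₁ + c₂ + c₃ := by linarith
  refine ⟨(h₁.trans (mul_le_mul_of_nonneg_right l₁ x₁)).trans_eq (by ring),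
    (h₂.trans (mul_le_mul_of_nonneg_right l₂ x₂)).trans_eq (by ring),
    (h₃.trans (mul_le_mul_of_nonneg_right l₃ x₃)).trans_eq (by ring)⟩
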